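/- Let $G=(A\cup B,E)$ be a bipartite graph with $|A|=|B|=n$ and $|E|=m$, in which every agent $a\in A$ has a strict partial order $\succ_a$ (irreflexive and transitive) on the set of her neighbours in $B$. An assignment is a perfect matching of $G$; $M(a)$ denotes the partner of $a$ in $M$. For assignments $M,N$ let $\phi(M,N)$ be the number of agents $a$ with $M(a)\succ_a N(a)$, let $\Delta(M,N)=\phi(M,N)-\phi(N,M)$, and let the unpopularity margin of $M$ be $\mu(M)=\max_N\Delta(N,M)$, where $N$ ranges over all assignments of $G$. For every fixed integer $k\ge 0$, there is an algorithm that, given $G$ and the preferences, decides whether $G$ has an assignment $M$ with $\mu(M)\le k$ in time $O(m^{k+1}\cdot n^{5/2})$ (that is, in at most $C\,(m^{k+1}n^{5/2}+1)$ steps for all instances, with a constant $C$ depending only on $k$). Here time is counted on a word RAM with words of $O(\log n)$ bits and unit-cost elementary instructions (addition, truncated subtraction, multiplication, comparison, indirect reading and writing of memory cells). Sides $A$ and $B$ are numbered, and the input in memory consists of $n$, $m$, the adjacency matrix of $G$ and the table of comparison bits $[\,b\succ_a b'\,]$. -/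

import Mathlib

/-! ### Word RAM: a unit-cost random access machine with bounded words -/

namespace WordRAM

/-- Arithmetic operations on words; subtraction is truncated at `0`. -/
inductive Op where
  | add | sub | mul

/-- The value of an arithmetic operation. -/
def Op.eval : Op → ℕ → ℕ → ℕ
  | .add, u, v => u + v
  | .sub, u, v => u - v
  | .mul, u, v => u * v

/-- Elementary instructions. Registers are named by natural numbers; a program is a finite
object, so it mentions only finitely many of them.
* `const x v`: write the constant `v` to register `x`;
* `arith o x y z`: write `o` of registers `y` and `z` to register `x`;
* `load x y`: write the memory cell whose address is in register `y` to register `x`;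
* `store x y`: write register `y` to the memory cell whose address is in register `x`. -/
inductive Instr where
  | const (x v : ℕ)
  | arith (o : Op) (x y z : ℕ)
  | load (x y : ℕ)
  | store (x y : ℕ)

/-- Tests comparing the contents of two registers. -/
inductive Test where
  | lt (x y : ℕ)
  | eq (x y : ℕ)

/-- Programs: elementary instructions closed under sequencing, branching and while-loops. -/
inductive Prog where
  | instr (i : Instr)
  | seq (p q : Prog)
  | branch (b : Test) (p q : Prog)
  | loop (b : Test) (p : Prog)

/-- A machine state: the contents of the registers and of the memory. -/
structure State where
  reg : ℕ → ℕ
  mem : ℕ → ℕ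

/-- Overwrite register `x` by `v`. -/
def State.setReg (s : State) (x v : ℕ) : State :=
  { s with reg := Function.update s.reg x v }

/-- Overwrite memory cell `i` by `v`. -/
def State.setMem (s : State) (i v : ℕ) : State :=
  { s with mem := Function.update s.mem i v }

/-- The truth of a test in a state. -/
def Test.Holds : Test → State → Prop
  | .lt x y, s => s.reg x < s.reg y
  | .eq x y, s => s.reg x = s.reg y

/-- The effect of one instruction on a machine whose words are the numbers below `W`. The machine
gets stuck (`none`) when the value to be written to a register is not a word, so that no
register can ever hold a number `≥ W` and no address `≥ W` can be used. -/
def Instr.step (W : ℕ) : Instr → State → Option State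
  | .const x v, s => if v < W then some (s.setReg x v) else none
  | .arith o x y z, s =>
      if o.eval (s.reg y) (s.reg z) < W then some (s.setReg x (o.eval (s.reg y) (s.reg z)))
      else none
  | .load x y, s => if s.mem (s.reg y) < W then some (s.setReg x (s.mem (s.reg y))) else none
  | .store x y, s => some (s.setMem (s.reg x) (s.reg y))

/-- `Exec W p s t s'`: on a machine with words below `W`, the program `p` started in state `s`
halts in state `s'` after exactly `t` steps. Every elementary instruction and every evaluation of
a test is one step. -/
inductive Exec (W : ℕ) : Prog → State → ℕ → State → Prop
  | instr {i : Instr} {s s' : State} (h : i.step W s = some s') : Exec W (.instr i) s 1 s'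
  | seq {p q : Prog} {s s' s'' : State} {t t' : ℕ} (hp : Exec W p s t s')
      (hq : Exec W q s' t' s'') : Exec W (.seq p q) s (t + t') s''
  | branch_true {b : Test} {p q : Prog} {s s' : State} {t : ℕ} (hb : b.Holds s)
      (hp : Exec W p s t s') : Exec W (.branch b p q) s (1 + t) s'
  | branch_false {b : Test} {p q : Prog} {s s' : State} {t : ℕ} (hb : ¬ b.Holds s)
      (hq : Exec W q s t s') : Exec W (.branch b p q) s (1 + t) s'
  | loop_true {b : Test} {p : Prog} {s s' s'' : State} {t t' : ℕ} (hb : b.Holds s)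
      (hp : Exec W p s t s') (hl : Exec W (.loop b p) s' t' s'') :
      Exec W (.loop b p) s (1 + t + t') s''
  | loop_false {b : Test} {p : Prog} {s : State} (hb : ¬ b.Holds s) :
      Exec W (.loop b p) s 1 s

/-- The initial state on a given memory: all registers are `0`. -/
def initial (mem : ℕ → ℕ) : State where
  reg := fun _ => 0
  mem := mem

end WordRAM

/-! ### Assignments under one-sided preferences -/

/-- An instance: a bipartite graph with `n` agents and `n` objects (both numbered `0, …, n - 1`),
edge set `edges` (pairs of an agent and an object), in which every agent `a` has a strict partial
order on her neighbours; `pref a b b'` says that `a` prefers `b` to `b'`. -/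
structure PrefInstance (n : ℕ) where
  edges : Finset (Fin n × Fin n)
  pref : Fin n → Fin n → Fin n → Prop
  pref_adj : ∀ a b b', pref a b b' → (a, b) ∈ edges ∧ (a, b') ∈ edges
  pref_irrefl : ∀ a b, ¬ pref a b b
  pref_trans : ∀ a b b' b'', pref a b b' → pref a b' b'' → pref a b b''

namespace PrefInstance

variable {n : ℕ}

/-- Assignments are the perfect matchings of the graph: bijections from agents to objects that
send every agent to one of her neighbours. -/
def IsAssignment (G : PrefInstance n) (M : Fin n ≃ Fin n) : Prop :=
  ∀ a, (a, M a) ∈ G.edges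

open Classical in
/-- The number of agents who prefer `M` to `N`. -/
noncomputable def phi (G : PrefInstance n) (M N : Fin n ≃ Fin n) : ℕ :=
  (Finset.univ.filter fun a => G.pref a (M a) (N a)).card

/-- The margin by which `M` defeats `N`. -/
noncomputable def delta (G : PrefInstance n) (M N : Fin n ≃ Fin n) : ℤ :=
  (G.phi M N : ℤ) - (G.phi N M : ℤ)

/-- The unpopularity margin of an assignment `M`: the maximum of `delta N M` over all assignments
`N`. (The set is finite, and it is nonempty since it contains `delta M M`.) -/
noncomputable def unpopularityMargin (G : PrefInstance n) (M : Fin n ≃ Fin n) : ℤ :=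
  sSup {d : ℤ | ∃ N : Fin n ≃ Fin n, G.IsAssignment N ∧ d = G.delta N M}

/-- There is an assignment with unpopularity margin at most `k`. -/
def HasMarginAtMost (G : PrefInstance n) (k : ℕ) : Prop :=
  ∃ M : Fin n ≃ Fin n, G.IsAssignment M ∧ G.unpopularityMargin M ≤ (k : ℤ)

open Classical in
/-- The memory that holds the instance: cell `0` holds `n`, cell `1` holds the number of edges,
then comes the `n × n` adjacency matrix (row `a`, column `b`), then the `n × n × n` table of
comparison bits `pref a b b'`; all remaining cells are `0`. -/
noncomputable def encode (G : PrefInstance n) (i : ℕ) : ℕ :=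
  if i = 0 then n
  else if i = 1 then G.edges.card
  else if (∃ a b : Fin n, (a, b) ∈ G.edges ∧ i = 2 + ((a : ℕ) * n + b)) ∨
      (∃ a b b' : Fin n, G.pref a b b' ∧
        i = 2 + n * n + (((a : ℕ) * n + b) * n + b')) then 1
  else 0

end PrefInstance

/-! Duality. Fix an assignment `M` and give an edge (a, b) the weight 1, -1 or 0 according to
whether a prefers b to M(a), prefers M(a) to b, or neither. The unpopularity margin of `M` is the
maximum weight of an assignment. By integral linear programming duality it is at most k if and only
if there are natural numbers l(b) (levels of objects) and s(a) (loads of agents, of total at most k)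
such that l(b) plus the weight of (a, b) is at most l(M(a)) + s(a) on every edge
(`Certifies.unpopularityMargin_le`, `exists_certifies`). Closing gaps between the levels makes them
smaller than n (`Certifies.exists_lt`).

Guessing. The loads are unknown, so all ways to place at most k units on the edges are tried, in at
most (m+1)^k trials. An agent may then be matched only along an edge that carries her whole load.
With this rule, the load of an agent is known for each possible partner, and whether an edge is
acceptable depends only on the levels (`success_iff`).

Raising levels. For fixed loads, the levels start at 0 and stay below the levels of every solution
that are smaller than n. A perfect matching of accepted edges is a solution. Otherwise some
unmatched object r starts no augmenting path, and then every solution whose levels dominate the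
current ones has a strictly larger level at r (`Loaded.Solution.lt_of_stuck`). So the level of r is
raised by one. A level that would reach n refutes the loads, hence there are O(n^2) rounds
(`run_decide`).

One round. Let D be the square root of n, rounded up. An auction with prices up to D takes
O((m+n)(D+1)) steps and gives a matching at most D short of the maximum (`freeCount_le_add`). At
most D augmentations and one failed search complete the round (`run_phase`). Counters of the reasons
for rejecting each edge make acceptance testable in constant time and are updated in O(m) steps when
a level rises (`run_raise`). In total this is m^k times n^2 times m√n; instances with m < n have no
assignment and are rejected at once.

The machine. The algorithm is written in a small imperative language whose commands carry exact
machine costs, and a compiler is proved correct for it (`Run.exec_compile`). Stored values grow by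
at most the number of elapsed steps, so a polynomial running time keeps all numbers polynomial in n,
and words of O(log n) bits suffice (`exists_prog`). -/

set_option linter.constructorNameAsVariable false

/-! ### An imperative language with named variables and arrays, compiled to the word RAM -/

namespace Imp

/-- Variables. -/
inductive Var where
  | res | n | m | D | i | a | x | y | c | act | hd | tl | fnd | flag | done | g (j : ℕ)
  deriving DecidableEq

/-- Arrays. -/
inductive Arr where
  | ea | eb | st | ld | fa | lv | cnt | dl | pr | cur | ma | mb | vis | par | qu
  deriving DecidableEq

/-- A numbering of the variables. -/
def Var.code : Var → ℕ
  | res => 0 | n => 1 | m => 2 | D => 3 | i => 4 | a => 5 | x => 6 | y => 7 | c => 8 | act => 9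
  | hd => 10 | tl => 11 | fnd => 12 | flag => 13 | done => 14 | g j => 15 + j

/-- A numbering of the arrays. -/
def Arr.code : Arr → ℕ
  | ea => 0 | eb => 1 | st => 2 | ld => 3 | fa => 4 | lv => 5 | cnt => 6 | dl => 7 | pr => 8
  | cur => 9 | ma => 10 | mb => 11 | vis => 12 | par => 13 | qu => 14

theorem Var.code_injective : Function.Injective Var.code := by
  intro x y h
  cases x <;> cases y <;> simp only [Var.code] at h <;> first | rfl | omega | (congr 1; omega)

theorem Arr.code_injective : Function.Injective Arr.code := by
  intro x y h
  cases x <;> cases y <;> simp only [Arr.code] at h <;> first | rfl | omega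

theorem Arr.code_lt (j : Arr) : j.code < 16 := by
  cases j <;> simp [Arr.code]

/-- Expressions; `inp e` reads the input. -/
inductive Expr where
  | zero
  | suc (e : Expr)
  | var (x : Var)
  | get (j : Arr) (e : Expr)
  | inp (e : Expr)
  | add (e f : Expr)
  | sub (e f : Expr)
  | mul (e f : Expr)

/-- Values of the variables and the arrays, and the read-only input. -/
structure State where
  v : Var → ℕ
  r : Arr → ℕ → ℕ
  I : ℕ → ℕ

/-- Overwrite a variable. -/
def State.setv (σ : State) (x : Var) (k : ℕ) : State := ⟨Function.update σ.v x k, σ.r, σ.I⟩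

/-- Overwrite an array entry. -/
def State.setr (σ : State) (j : Arr) (i k : ℕ) : State :=
  ⟨σ.v, Function.update σ.r j (Function.update (σ.r j) i k), σ.I⟩

@[simp] theorem State.setv_v (σ : State) (x y : Var) (k : ℕ) :
    (σ.setv x k).v y = if y = x then k else σ.v y := by
  simp [State.setv, Function.update_apply]

@[simp] theorem State.setv_r (σ : State) (x : Var) (k : ℕ) : (σ.setv x k).r = σ.r := rfl

@[simp] theorem State.setv_I (σ : State) (x : Var) (k : ℕ) : (σ.setv x k).I = σ.I := rfl

@[simp] theorem State.setr_v (σ : State) (j : Arr) (i k : ℕ) : (σ.setr j i k).v = σ.v := rfl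

@[simp] theorem State.setr_I (σ : State) (j : Arr) (i k : ℕ) : (σ.setr j i k).I = σ.I := rfl

@[simp] theorem State.setr_r (σ : State) (j j' : Arr) (i k : ℕ) :
    (σ.setr j i k).r j' = if j' = j then Function.update (σ.r j) i k else σ.r j' := by
  simp only [State.setr, Function.update_apply]

/-- The value of an expression. -/
@[simp] def Expr.eval : Expr → State → ℕ
  | zero, _ => 0
  | suc e, σ => e.eval σ + 1
  | var x, σ => σ.v x
  | get j e, σ => σ.r j (e.eval σ)
  | inp e, σ => σ.I (e.eval σ)
  | add e f, σ => e.eval σ + f.eval σ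
  | sub e f, σ => e.eval σ - f.eval σ
  | mul e f, σ => e.eval σ * f.eval σ

/-- The number of machine steps that evaluate an expression. -/
@[simp] def Expr.cost : Expr → ℕ
  | zero => 1
  | suc e => e.cost + 2
  | var _ => 1
  | get _ e => e.cost + 6
  | inp e => e.cost + 1
  | add e f => e.cost + f.cost + 1
  | sub e f => e.cost + f.cost + 1
  | mul e f => e.cost + f.cost + 1

/-- The exponent in a bound of all intermediate values. -/
def Expr.size : Expr → ℕ
  | zero => 1
  | suc e => e.size + 1
  | var _ => 1
  | get _ e => e.size + 1
  | inp e => e.size + 1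
  | add e f => e.size + f.size
  | sub e f => e.size + f.size
  | mul e f => e.size + f.size

/-- Expressions whose value exceeds the values in the state by at most their cost. -/
@[simp] def Expr.Tame : Expr → Prop
  | zero => True
  | suc e => e.Tame
  | var _ => True
  | get _ _ => True
  | inp _ => True
  | add _ _ => False
  | sub e _ => e.Tame
  | mul _ _ => False

/-- Conditions. -/
inductive Cond where
  | lt (e f : Expr)
  | eq (e f : Expr)

/-- The truth of a condition. -/
@[simp] def Cond.Holds : Cond → State → Prop
  | lt e f, σ => e.eval σ < f.eval σ
  | eq e f, σ => e.eval σ = f.eval σ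

instance (b : Cond) (σ : State) : Decidable (b.Holds σ) := by
  cases b <;> simp only [Cond.Holds] <;> infer_instance

/-- The number of steps that evaluate the two sides of a condition. -/
@[simp] def Cond.cost : Cond → ℕ
  | lt e f => e.cost + f.cost
  | eq e f => e.cost + f.cost

/-- The exponent in a bound of all intermediate values. -/
def Cond.size : Cond → ℕ
  | lt e f => max e.size f.size
  | eq e f => max e.size f.size

/-- Commands. -/
inductive Com where
  | skip
  | set (x : Var) (e : Expr)
  | put (j : Arr) (e f : Expr)
  | seq (p q : Com)
  | ite (b : Cond) (p q : Com)
  | loop (b : Cond) (p : Com)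

/-- Only tame expressions are stored. -/
@[simp] def Com.Tame : Com → Prop
  | skip => True
  | set _ e => e.Tame
  | put _ _ f => f.Tame
  | seq p q => p.Tame ∧ q.Tame
  | ite _ p q => p.Tame ∧ q.Tame
  | loop _ p => p.Tame

/-- The exponent in a bound of all intermediate values. -/
def Com.size : Com → ℕ
  | skip => 1
  | set _ e => e.size
  | put _ e f => max e.size f.size
  | seq p q => max p.size q.size
  | ite b p q => max b.size (max p.size q.size)
  | loop b p => max b.size p.size

/-- `Run p σ t σ'`: the command `p` started in `σ` halts in `σ'` after `t` machine steps. -/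
inductive Run : Com → State → ℕ → State → Prop
  | skip {σ : State} : Run .skip σ 1 σ
  | set {x : Var} {e : Expr} {σ : State} : Run (.set x e) σ (e.cost + 1) (σ.setv x (e.eval σ))
  | put {j : Arr} {e f : Expr} {σ : State} :
      Run (.put j e f) σ (e.cost + f.cost + 6) (σ.setr j (e.eval σ) (f.eval σ))
  | seq {p q : Com} {σ σ' σ'' : State} {t t' : ℕ} (hp : Run p σ t σ') (hq : Run q σ' t' σ'') :
      Run (.seq p q) σ (t + t') σ''
  | ite_true {b : Cond} {p q : Com} {σ σ' : State} {t : ℕ} (hb : b.Holds σ) (hp : Run p σ t σ') :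
      Run (.ite b p q) σ (b.cost + (1 + t)) σ'
  | ite_false {b : Cond} {p q : Com} {σ σ' : State} {t : ℕ} (hb : ¬ b.Holds σ)
      (hq : Run q σ t σ') : Run (.ite b p q) σ (b.cost + (1 + t)) σ'
  | loop_true {b : Cond} {p : Com} {σ σ' σ'' : State} {t t' : ℕ} (hb : b.Holds σ)
      (hp : Run p σ t σ') (hl : Run (.loop b p) σ' t' σ'') :
      Run (.loop b p) σ (b.cost + (1 + t) + t') σ''
  | loop_false {b : Cond} {p : Com} {σ : State} (hb : ¬ b.Holds σ) :
      Run (.loop b p) σ (b.cost + 1) σ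

/-! #### The compiler -/

open WordRAM

/-- Temporary registers are odd, above the registers `1` (base address) and `3` (zero). -/
def tmp (d : ℕ) : ℕ := 5 + 2 * d

/-- Turn the index in `tmp d` into the address of an entry of the array `j`. -/
def addrCode (j : Arr) (d : ℕ) : Prog :=
  .seq (.instr (.const (tmp (d + 1)) 16)) <|
  .seq (.instr (.arith .mul (tmp d) (tmp d) (tmp (d + 1)))) <|
  .seq (.instr (.arith .add (tmp d) (tmp d) 1)) <|
  .seq (.instr (.const (tmp (d + 1)) j.code)) <|
    .instr (.arith .add (tmp d) (tmp d) (tmp (d + 1)))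

/-- Code that leaves the value of an expression in `tmp d`. -/
def Expr.compile : Expr → ℕ → Prog
  | zero, d => .instr (.const (tmp d) 0)
  | suc e, d => .seq (e.compile d) <| .seq (.instr (.const (tmp (d + 1)) 1)) <|
      .instr (.arith .add (tmp d) (tmp d) (tmp (d + 1)))
  | var x, d => .instr (.arith .add (tmp d) (2 * x.code) 3)
  | get j e, d => .seq (e.compile d) <| .seq (addrCode j d) (.instr (.load (tmp d) (tmp d)))
  | inp e, d => .seq (e.compile d) (.instr (.load (tmp d) (tmp d)))
  | add e f, d => .seq (.seq (e.compile d) (f.compile (d + 1)))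
      (.instr (.arith .add (tmp d) (tmp d) (tmp (d + 1))))
  | sub e f, d => .seq (.seq (e.compile d) (f.compile (d + 1)))
      (.instr (.arith .sub (tmp d) (tmp d) (tmp (d + 1))))
  | mul e f, d => .seq (.seq (e.compile d) (f.compile (d + 1)))
      (.instr (.arith .mul (tmp d) (tmp d) (tmp (d + 1))))

/-- Code that leaves the two sides of a condition in `tmp 0` and `tmp 1`. -/
def Cond.compile : Cond → Prog
  | lt e f => .seq (e.compile 0) (f.compile 1)
  | eq e f => .seq (e.compile 0) (f.compile 1)

/-- The test of a condition evaluated by `Cond.compile`. -/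
def Cond.test : Cond → Test
  | lt _ _ => .lt (tmp 0) (tmp 1)
  | eq _ _ => .eq (tmp 0) (tmp 1)

/-- Code for a command. -/
def Com.compile : Com → Prog
  | skip => .instr (.const (tmp 0) 0)
  | set x e => .seq (e.compile 0) (.instr (.arith .add (2 * x.code) (tmp 0) 3))
  | put j e f => .seq (e.compile 0) <| .seq (addrCode j 0) <| .seq (f.compile 1) <|
      .instr (.store (tmp 0) (tmp 1))
  | seq p q => .seq p.compile q.compile
  | ite b p q => .seq b.compile (.branch b.test p.compile q.compile)
  | loop b p => .seq b.compile (.loop b.test (.seq p.compile b.compile))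

/-- The machine state `s` represents `σ`, with arrays stored from address `B` on. -/
structure Rel (B : ℕ) (σ : State) (s : WordRAM.State) : Prop where
  base : s.reg 1 = B
  zero : s.reg 3 = 0
  var : ∀ x : Var, s.reg (2 * x.code) = σ.v x
  inp : ∀ i < B, s.mem i = σ.I i
  arr : ∀ j i, s.mem (B + 16 * i + Arr.code j) = σ.r j i

/-- All values in a state are at most `k`. -/
structure State.Bounded (σ : State) (k : ℕ) : Prop where
  v : ∀ x, σ.v x ≤ k
  r : ∀ j i, σ.r j i ≤ k
  I : ∀ i, σ.I i ≤ k

theorem State.Bounded.mono {σ : State} {k l : ℕ} (h : σ.Bounded k) (hkl : k ≤ l) : σ.Bounded l :=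
  ⟨fun x => (h.v x).trans hkl, fun j i => (h.r j i).trans hkl, fun i => (h.I i).trans hkl⟩

/-! ### Growth of values -/

theorem Expr.one_le_size (e : Expr) : 1 ≤ e.size := by
  induction e <;> simp only [Expr.size] <;> omega

/-- Two numbers that are at least 2 have a sum at most their product. So for `k ≥ 2` sums are
covered by adding exponents, just as products are. -/
theorem Expr.eval_le_pow {σ : State} {k : ℕ} (hk : 2 ≤ k) (h : σ.Bounded k) (e : Expr) :
    e.eval σ ≤ k ^ e.size := by
  have two (e : Expr) : 2 ≤ k ^ e.size :=
    hk.trans (Nat.le_self_pow (by have := e.one_le_size; omega) k)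
  have self (s : ℕ) : k ≤ k ^ (s + 1) := Nat.le_self_pow (by omega) k
  induction e with
  | zero => simp
  | suc e ih =>
    have := two e
    simp only [Expr.eval, Expr.size, pow_succ]
    nlinarith
  | var x => simpa [Expr.size] using h.v x
  | get j e ih => exact (h.r _ _).trans (self _)
  | inp e ih => exact (h.I _).trans (self _)
  | add e f ihe ihf =>
    simp only [Expr.eval, Expr.size, pow_add]
    nlinarith [two e, two f]
  | sub e f ihe ihf =>
    simp only [Expr.eval, Expr.size, pow_add]
    have := Nat.sub_le (e.eval σ) (f.eval σ)
    nlinarith [two e, two f]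
  | mul e f ihe ihf =>
    simp only [Expr.eval, Expr.size, pow_add]
    exact Nat.mul_le_mul ihe ihf

/-- Only successors increase a tame value, and each is paid for in the cost. This rules out repeated
doubling or squaring of stored values, which would overflow short words in polynomial time. -/
theorem Expr.Tame.eval_le {σ : State} {k : ℕ} (h : σ.Bounded k) {e : Expr} (he : e.Tame) :
    e.eval σ ≤ k + e.cost := by
  induction e with
  | zero => simp
  | suc e ih => have := ih he; simp only [Expr.eval, Expr.cost]; omega
  | var x => have := h.v x; simp only [Expr.eval]; omega
  | get j e ih => have := h.r j (e.eval σ); simp only [Expr.eval]; omega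
  | inp e ih => have := h.I (e.eval σ); simp only [Expr.eval]; omega
  | add e f ihe ihf => exact he.elim
  | sub e f ihe ihf => have := ihe he; simp only [Expr.eval, Expr.cost]; omega
  | mul e f ihe ihf => exact he.elim

/-- `s'` agrees with `s` in the memory and in all registers but `tmp d, tmp (d + 1), …`. -/
structure AgreeBelow (d : ℕ) (s s' : WordRAM.State) : Prop where
  mem : s'.mem = s.mem
  even : ∀ x, s'.reg (2 * x) = s.reg (2 * x)
  odd : ∀ x < d + 2, s'.reg (2 * x + 1) = s.reg (2 * x + 1)

theorem AgreeBelow.trans {d d' : ℕ} {s s' s'' : WordRAM.State} (h : AgreeBelow d s s')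
    (h' : AgreeBelow d' s' s'') (hd : d ≤ d') : AgreeBelow d s s'' :=
  ⟨h'.mem.trans h.mem, fun x => (h'.even x).trans (h.even x),
    fun x hx => (h'.odd x (by omega)).trans (h.odd x hx)⟩

theorem AgreeBelow.setReg {d k : ℕ} {s s' : WordRAM.State} (h : AgreeBelow d s s') {d' : ℕ}
    (hd : d ≤ d') : AgreeBelow d s (s'.setReg (tmp d') k) := by
  refine ⟨h.mem, fun x => ?_, fun x hx => ?_⟩
  · rw [← h.even]
    simp only [WordRAM.State.setReg, tmp]
    exact Function.update_of_ne (by omega) _ _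
  · rw [← h.odd x hx]
    simp only [WordRAM.State.setReg, tmp]
    exact Function.update_of_ne (by omega) _ _

theorem AgreeBelow.refl (d : ℕ) (s : WordRAM.State) : AgreeBelow d s s :=
  ⟨rfl, fun _ => rfl, fun _ _ => rfl⟩

theorem AgreeBelow.tmp {d d' : ℕ} {s s' : WordRAM.State} (h : AgreeBelow d s s') (hd : d' < d) :
    s'.reg (tmp d') = s.reg (tmp d') := by
  have := h.odd (d' + 2) (by omega)
  simpa only [Imp.tmp, show 2 * (d' + 2) + 1 = 5 + 2 * d' by ring] using this

theorem Rel.of_agreeBelow {B d : ℕ} {σ : State} {s s' : WordRAM.State} (h : Rel B σ s)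
    (h' : AgreeBelow d s s') : Rel B σ s' :=
  ⟨(h'.odd 0 (by omega)).trans h.base, (h'.odd 1 (by omega)).trans h.zero,
    fun x => (h'.even _).trans (h.var x), fun i hi => by rw [h'.mem, h.inp i hi],
    fun j i => by rw [h'.mem, h.arr j i]⟩

/-! ### Correctness and exact cost of compiled code -/

theorem exec_const {W x k : ℕ} {s : WordRAM.State} (hk : k < W) :
    Exec W (.instr (.const x k)) s 1 (s.setReg x k) :=
  .instr (by simp [Instr.step, hk])

theorem exec_arith {W x y z k : ℕ} {o : Op} {s : WordRAM.State} (hk : o.eval (s.reg y) (s.reg z) = k)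
    (hW : k < W) : Exec W (.instr (.arith o x y z)) s 1 (s.setReg x k) :=
  .instr (by simp [Instr.step, hk, hW])

theorem exec_load {W x y k : ℕ} {s : WordRAM.State} (hk : s.mem (s.reg y) = k) (hW : k < W) :
    Exec W (.instr (.load x y)) s 1 (s.setReg x k) :=
  .instr (by simp [Instr.step, hk, hW])

@[simp] theorem setReg_same (s : WordRAM.State) (x k : ℕ) : (s.setReg x k).reg x = k := by
  simp [WordRAM.State.setReg]

theorem setReg_ne (s : WordRAM.State) {x y : ℕ} (k : ℕ) (h : y ≠ x) :
    (s.setReg x k).reg y = s.reg y := by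
  simp [WordRAM.State.setReg, h]

/-- The arrays are interleaved with stride 16, which exceeds every array code. Distinct entries get
distinct addresses without any bound on the lengths of the arrays. -/
theorem exec_addrCode {W B i d : ℕ} {s : WordRAM.State} (j : Arr) (hB : s.reg 1 = B)
    (hi : s.reg (tmp d) = i) (hW : B + 16 * i + 16 < W) :
    ∃ s', Exec W (addrCode j d) s 5 s' ∧ s'.reg (tmp d) = B + 16 * i + j.code ∧
      AgreeBelow d s s' := by
  have hj := j.code_lt
  have h01 : tmp d ≠ tmp (d + 1) := by unfold tmp; omega
  have h1 : 1 ≠ tmp (d + 1) := by unfold tmp; omega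
  have h1' : 1 ≠ tmp d := by unfold tmp; omega
  refine ⟨_, .seq (exec_const (by omega)) <| .seq (exec_arith (k := 16 * i) ?_ (by omega)) <|
    .seq (exec_arith (k := B + 16 * i) ?_ (by omega)) <| .seq (exec_const (k := j.code) (by omega)) <|
    exec_arith (k := B + 16 * i + j.code) ?_ (by omega), ?_, ?_⟩
  · simp [Op.eval, setReg_ne _ _ h01, hi, mul_comm]
  · simp [Op.eval, setReg_ne _ _ h1, setReg_ne _ _ h1', hB, add_comm]
  · simp [Op.eval, setReg_ne _ _ h01]
  · simp
  · exact (((((AgreeBelow.refl d s).setReg (by omega)).setReg le_rfl).setReg le_rfl).setReg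
      (by omega)).setReg le_rfl

theorem exec_op {W d kx ky k : ℕ} {o : Op} {s s' s'' : WordRAM.State} {t t' : ℕ} {p q : Prog}
    (hp : Exec W p s t s') (hx : s'.reg (tmp d) = kx) (hs' : AgreeBelow d s s')
    (hq : Exec W q s' t' s'') (hy : s''.reg (tmp (d + 1)) = ky) (hs'' : AgreeBelow (d + 1) s' s'')
    (hk : o.eval kx ky = k) (hW : k < W) :
    ∃ u, Exec W (.seq (.seq p q) (.instr (.arith o (tmp d) (tmp d) (tmp (d + 1))))) s (t + t' + 1) u ∧
      u.reg (tmp d) = k ∧ AgreeBelow d s u :=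
  ⟨_, .seq (.seq hp hq) (exec_arith (k := k) (by rw [hs''.tmp (by omega), hx, hy, hk]) hW), by simp,
    (hs'.trans hs'' (by omega)).setReg le_rfl⟩

/-- Here `d` acts as a stack pointer: a second operand is evaluated at `d + 1` and so leaves the
first one in `tmp d` intact. Every intermediate value is below `B`, so input reads stay in front of
the arrays and array addresses stay below `17 * B + 16`. -/
theorem Expr.exec_compile {W B k : ℕ} (hk : 2 ≤ k) (hW : 17 * B + 16 < W) {σ : State}
    (hσ : σ.Bounded k) (e : Expr) (he : k ^ e.size < B) (d : ℕ) (s : WordRAM.State)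
    (hs : Rel B σ s) :
    ∃ s', Exec W (e.compile d) s e.cost s' ∧ s'.reg (tmp d) = e.eval σ ∧ AgreeBelow d s s' := by
  have hle := e.eval_le_pow hk hσ
  have hlt : e.eval σ < W := by omega
  have mono {a b : ℕ} (h : a ≤ b) (hb : k ^ b < B) : k ^ a < B :=
    (Nat.pow_le_pow_right (by omega) h).trans_lt hb
  have h01 : tmp d ≠ tmp (d + 1) := by unfold tmp; omega
  induction e generalizing d s with
  | zero => exact ⟨_, exec_const (by omega), by simp, (AgreeBelow.refl d s).setReg le_rfl⟩
  | suc e ih =>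
    have he' : k ^ e.size < B := mono (by simp only [Expr.size]; omega) he
    have hle' := e.eval_le_pow hk hσ
    obtain ⟨s', hx, hv, ha⟩ := ih he' d s hs hle' (by omega) h01
    refine ⟨_, .seq hx (.seq (exec_const (by omega)) (exec_arith (k := e.eval σ + 1) ?_ hlt)), ?_, ?_⟩
    · simp [Op.eval, setReg_ne _ _ h01, hv]
    · simp
    · exact (ha.setReg (by omega)).setReg le_rfl
  | var x =>
    exact ⟨_, exec_arith (k := σ.v x) (by simp [Op.eval, hs.var, hs.zero]) hlt, by simp,
      (AgreeBelow.refl d s).setReg le_rfl⟩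
  | get j e ih =>
    have he' : k ^ e.size < B := mono (by simp only [Expr.size]; omega) he
    have hle' := e.eval_le_pow hk hσ
    obtain ⟨s', hx, hv, ha⟩ := ih he' d s hs hle' (by omega) h01
    obtain ⟨s'', hx', hv', ha'⟩ := exec_addrCode (W := W) j (hs.of_agreeBelow ha).base hv (by omega)
    have hr := ((hs.of_agreeBelow ha).of_agreeBelow ha').arr j (e.eval σ)
    exact ⟨_, .seq hx (.seq hx' (exec_load (k := σ.r j (e.eval σ)) (by rw [hv', hr]) hlt)), by simp,
      (ha.trans ha' le_rfl).setReg le_rfl⟩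
  | inp e ih =>
    have he' : k ^ e.size < B := mono (by simp only [Expr.size]; omega) he
    have hle' := e.eval_le_pow hk hσ
    obtain ⟨s', hx, hv, ha⟩ := ih he' d s hs hle' (by omega) h01
    have hr := (hs.of_agreeBelow ha).inp (e.eval σ) (by omega)
    exact ⟨_, .seq hx (exec_load (k := σ.I (e.eval σ)) (by rw [hv, hr]) hlt), by simp,
      ha.setReg le_rfl⟩
  | add e f ihe ihf =>
    have he' : k ^ e.size < B := mono (by simp only [Expr.size]; omega) he
    have hle' := e.eval_le_pow hk hσ
    obtain ⟨s', hx, hv, ha⟩ := ihe he' d s hs hle' (by omega) h01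
    have hf' : k ^ f.size < B := mono (by simp only [Expr.size]; omega) he
    have hlf' := f.eval_le_pow hk hσ
    obtain ⟨s'', hx', hv', ha'⟩ := ihf hf' (d + 1) s' (hs.of_agreeBelow ha) hlf' (by omega)
      (by unfold tmp; omega)
    exact exec_op hx hv ha hx' hv' ha' rfl hlt
  | sub e f ihe ihf =>
    have he' : k ^ e.size < B := mono (by simp only [Expr.size]; omega) he
    have hle' := e.eval_le_pow hk hσ
    obtain ⟨s', hx, hv, ha⟩ := ihe he' d s hs hle' (by omega) h01
    have hf' : k ^ f.size < B := mono (by simp only [Expr.size]; omega) he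
    have hlf' := f.eval_le_pow hk hσ
    obtain ⟨s'', hx', hv', ha'⟩ := ihf hf' (d + 1) s' (hs.of_agreeBelow ha) hlf' (by omega)
      (by unfold tmp; omega)
    exact exec_op hx hv ha hx' hv' ha' rfl hlt
  | mul e f ihe ihf =>
    have he' : k ^ e.size < B := mono (by simp only [Expr.size]; omega) he
    have hle' := e.eval_le_pow hk hσ
    obtain ⟨s', hx, hv, ha⟩ := ihe he' d s hs hle' (by omega) h01
    have hf' : k ^ f.size < B := mono (by simp only [Expr.size]; omega) he
    have hlf' := f.eval_le_pow hk hσ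
    obtain ⟨s'', hx', hv', ha'⟩ := ihf hf' (d + 1) s' (hs.of_agreeBelow ha) hlf' (by omega)
      (by unfold tmp; omega)
    exact exec_op hx hv ha hx' hv' ha' rfl hlt

theorem Cond.exec_compile {W B k : ℕ} (hk : 2 ≤ k) (hW : 17 * B + 16 < W) {σ : State}
    (hσ : σ.Bounded k) (b : Cond) (hb : k ^ b.size < B) (s : WordRAM.State) (hs : Rel B σ s) :
    ∃ s', Exec W b.compile s b.cost s' ∧ (b.test.Holds s' ↔ b.Holds σ) ∧ Rel B σ s' := by
  have mono {a b : ℕ} (h : a ≤ b) (hb : k ^ b < B) : k ^ a < B :=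
    (Nat.pow_le_pow_right (by omega) h).trans_lt hb
  cases b with
  | lt e f =>
    obtain ⟨s', hx, hv, ha⟩ := e.exec_compile hk hW hσ
      (mono (by simp only [Cond.size]; omega) hb) 0 s hs
    obtain ⟨s'', hx', hv', ha'⟩ := f.exec_compile hk hW hσ
      (mono (by simp only [Cond.size]; omega) hb) 1 s' (hs.of_agreeBelow ha)
    refine ⟨s'', .seq hx hx', ?_, (hs.of_agreeBelow ha).of_agreeBelow ha'⟩
    simp only [Cond.test, Test.Holds, Cond.Holds, ha'.tmp one_pos, hv, hv']
  | eq e f =>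
    obtain ⟨s', hx, hv, ha⟩ := e.exec_compile hk hW hσ
      (mono (by simp only [Cond.size]; omega) hb) 0 s hs
    obtain ⟨s'', hx', hv', ha'⟩ := f.exec_compile hk hW hσ
      (mono (by simp only [Cond.size]; omega) hb) 1 s' (hs.of_agreeBelow ha)
    refine ⟨s'', .seq hx hx', ?_, (hs.of_agreeBelow ha).of_agreeBelow ha'⟩
    simp only [Cond.test, Test.Holds, Cond.Holds, ha'.tmp one_pos, hv, hv']

/-- The bound on stored values moves along with time: it is `k₀` at the start and `k₀ + t` after `t`
steps. As it never exceeds `k`, the expression bounds apply throughout the run. -/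
theorem Run.exec_compile {W B k S : ℕ} (hk : 2 ≤ k) (hW : 17 * B + 16 < W) (hB : k ^ S < B)
    {p : Com} {σ σ' : State} {t : ℕ} (h : Run p σ t σ') (hp : p.Tame) (hS : p.size ≤ S) {k₀ : ℕ}
    (hσ : σ.Bounded k₀) (ht : k₀ + t ≤ k) (s : WordRAM.State) (hs : Rel B σ s) :
    ∃ s', Exec W p.compile s t s' ∧ Rel B σ' s' ∧ σ'.Bounded (k₀ + t) := by
  have mono {a : ℕ} (h : a ≤ S) : k ^ a < B := (Nat.pow_le_pow_right (by omega) h).trans_lt hB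
  induction h generalizing s k₀ with
  | skip =>
    exact ⟨_, exec_const (by omega), hs.of_agreeBelow ((AgreeBelow.refl 0 s).setReg le_rfl),
      hσ.mono (by omega)⟩
  | @set x e σ =>
    obtain ⟨s', hx, hv, ha⟩ := e.exec_compile hk hW (hσ.mono (by omega)) (mono hS) 0 s hs
    have hs' := hs.of_agreeBelow ha
    have hle := e.eval_le_pow hk (hσ.mono (by omega))
    have hlt := mono hS
    simp only [Com.size] at hlt
    refine ⟨_, .seq hx (exec_arith (k := e.eval σ) (by simp [Op.eval, hv, hs'.zero]) (by omega)),
      ⟨?_, ?_, fun y => ?_, hs'.inp, hs'.arr⟩, ⟨fun y => ?_, fun j i => ?_, fun i => ?_⟩⟩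
    · rw [setReg_ne _ _ (by omega), hs'.base]
    · rw [setReg_ne _ _ (by omega), hs'.zero]
    · by_cases hy : y = x
      · subst hy; simp
      · have : y.code ≠ x.code := fun h => hy (Var.code_injective h)
        rw [setReg_ne _ _ (by omega), hs'.var]
        simp [hy]
    · have h1 := hσ.v y
      have h2 := Expr.Tame.eval_le hσ hp
      simp only [State.setv_v]
      split_ifs <;> omega
    · have := hσ.r j i
      simp only [State.setv_r]; omega
    · have := hσ.I i
      simp only [State.setv_I]; omega
  | @put j e f σ =>
    simp only [Com.size] at hS
    have hle := e.eval_le_pow hk (hσ.mono (by omega))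
    have hlt : k ^ e.size < B := mono (by omega)
    obtain ⟨s1, hx1, hv1, ha1⟩ := e.exec_compile hk hW (hσ.mono (by omega)) hlt 0 s hs
    have hs1 := hs.of_agreeBelow ha1
    obtain ⟨s2, hx2, hv2, ha2⟩ := exec_addrCode (W := W) j hs1.base hv1 (by omega)
    have hs2 := hs1.of_agreeBelow ha2
    obtain ⟨s3, hx3, hv3, ha3⟩ := f.exec_compile hk hW (hσ.mono (by omega)) (mono (by omega)) 1 s2 hs2
    have hs3 := hs2.of_agreeBelow ha3
    have hx := Exec.seq hx1 (.seq hx2 (.seq hx3 (.instr (i := .store (tmp 0) (tmp 1)) (W := W) rfl)))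
    rw [show e.cost + f.cost + 6 = e.cost + (5 + (f.cost + 1)) by ring]
    refine ⟨_, hx, ⟨hs3.base, hs3.zero, hs3.var, fun i hi => ?_, fun j' i => ?_⟩,
      ⟨fun y => ?_, fun j' i => ?_, fun i => ?_⟩⟩
    · simp only [WordRAM.State.setMem, State.setr_I, ha3.tmp one_pos, hv2]
      rw [Function.update_of_ne (by omega), hs3.inp i hi]
    · simp only [WordRAM.State.setMem, State.setr_r, ha3.tmp one_pos, hv2, hv3]
      have hj := j.code_lt
      have hj' := j'.code_lt
      by_cases hjj : j' = j
      · subst hjj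
        by_cases hi : i = e.eval σ
        · subst hi; simp
        · rw [Function.update_of_ne (by omega), hs3.arr]; simp [hi]
      · have : j'.code ≠ j.code := fun h => hjj (Arr.code_injective h)
        rw [Function.update_of_ne (by omega), hs3.arr]; simp [hjj]
    · have := hσ.v y
      simp only [State.setr_v]; omega
    · have h1 := hσ.r j' i
      have h2 := Expr.Tame.eval_le hσ hp
      have h3 := hσ.r j i
      simp only [State.setr_r]
      split_ifs
      · simp only [Function.update_apply]
        split_ifs <;> omega
      · omega
    · have := hσ.I i
      simp only [State.setr_I]; omega
  | @seq p q σ σ' σ'' t t' _ _ ihp ihq =>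
    simp only [Com.size] at hS
    obtain ⟨s1, hx1, hs1, hb1⟩ := ihp hp.1 (by omega) hσ (by omega) s hs
    obtain ⟨s2, hx2, hs2, hb2⟩ := ihq hp.2 (by omega) hb1 (by omega) s1 hs1
    exact ⟨s2, .seq hx1 hx2, hs2, hb2.mono (by omega)⟩
  | @ite_true b p q σ σ' t hb _ ih =>
    simp only [Com.size] at hS
    obtain ⟨s1, hx1, hb1, hs1⟩ := b.exec_compile hk hW (hσ.mono (by omega)) (mono (by omega)) s hs
    obtain ⟨s2, hx2, hs2, hb2⟩ := ih hp.1 (by omega) hσ (by omega) s1 hs1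
    exact ⟨s2, .seq hx1 (.branch_true (hb1.2 hb) hx2), hs2, hb2.mono (by omega)⟩
  | @ite_false b p q σ σ' t hb _ ih =>
    simp only [Com.size] at hS
    obtain ⟨s1, hx1, hb1, hs1⟩ := b.exec_compile hk hW (hσ.mono (by omega)) (mono (by omega)) s hs
    obtain ⟨s2, hx2, hs2, hb2⟩ := ih hp.2 (by omega) hσ (by omega) s1 hs1
    exact ⟨s2, .seq hx1 (.branch_false (fun h => hb (hb1.1 h)) hx2), hs2, hb2.mono (by omega)⟩
  | @loop_true b p σ σ' σ'' t t' hb _ _ ihp ihl =>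
    have hS' := hS
    simp only [Com.size] at hS
    obtain ⟨s1, hx1, hb1, hs1⟩ := b.exec_compile hk hW (hσ.mono (by omega)) (mono (by omega)) s hs
    obtain ⟨s2, hx2, hs2, hb2⟩ := ihp hp (by omega) hσ (by omega) s1 hs1
    obtain ⟨s3, hx3, hs3, hb3⟩ := ihl hp hS' hb2 (by omega) s2 hs2
    -- Compiled loops evaluate the condition in front of the machine loop and again at the end of
    -- each pass. The run of the remaining loop therefore begins with an evaluation that belongs to
    -- the current pass, and is cut there.
    cases hx3 with
    | @seq _ _ _ u _ t1 t2 hc hl =>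
      refine ⟨s3, ?_, hs3, hb3.mono (by omega)⟩
      have := Exec.seq hx1 (.loop_true (hb1.2 hb) (.seq hx2 hc) hl)
      rw [show b.cost + (1 + t) + (t1 + t2) = b.cost + (1 + (t + t1) + t2) by ring]
      exact this
  | @loop_false b p σ hb =>
    simp only [Com.size] at hS
    obtain ⟨s1, hx1, hb1, hs1⟩ := b.exec_compile hk hW (hσ.mono (by omega)) (mono (by omega)) s hs
    exact ⟨s1, .seq hx1 (.loop_false (fun h => hb (hb1.1 h))), hs1, hσ.mono (by omega)⟩

/-- Multiply register `1` by register `5`, `q` times. -/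
def powCode : ℕ → Prog
  | 0 => .instr (.const 1 1)
  | q + 1 => .seq (powCode q) (.instr (.arith .mul 1 1 5))

theorem exec_powCode {W k : ℕ} {s : WordRAM.State} (hs : s.reg 5 = k) (hk : 1 ≤ k) (q : ℕ)
    (hW : k ^ q < W) : Exec W (powCode q) s (q + 1) (s.setReg 1 (k ^ q)) := by
  induction q with
  | zero => exact exec_const (by simpa using hW)
  | succ q ih =>
    have h := ih ((Nat.pow_le_pow_right hk (by omega)).trans_lt hW)
    have h2 : Exec W (.instr (.arith .mul 1 1 5)) (s.setReg 1 (k ^ q)) 1 (s.setReg 1 (k ^ (q + 1))) := by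
      have := exec_arith (x := 1) (y := 1) (z := 5) (o := .mul) (s := s.setReg 1 (k ^ q)) (W := W)
        (k := k ^ (q + 1)) (by simp [Op.eval, setReg_ne, hs, pow_succ]) hW
      convert this using 1
      simp [WordRAM.State.setReg]
    exact .seq h h2

/-- Load the base address `(n + 2) ^ q` of the arrays into register `1`. -/
def prologue (q : ℕ) : Prog :=
  .seq (.instr (.load 5 3)) <| .seq (.instr (.const 7 2)) <|
    .seq (.instr (.arith .add 5 5 7)) (powCode q)

/-- The initial state on a given input. -/
def State.init (I : ℕ → ℕ) : State := ⟨fun _ => 0, fun _ _ => 0, I⟩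

/-- The base address lies beyond all nonzero input cells, so the arrays are initially zero.
Registers `5` and `7` are `tmp 0` and `tmp 1` and carry no value that `Rel` protects. -/
theorem exec_prologue {W q n : ℕ} {I : ℕ → ℕ} (h0 : I 0 = n) (hI : ∀ i, (n + 2) ^ q ≤ i → I i = 0)
    (hq : 1 ≤ q) (hW : (n + 2) ^ q < W) :
    ∃ s, Exec W (prologue q) (WordRAM.initial I) (q + 4) s ∧ Rel ((n + 2) ^ q) (State.init I) s := by
  have h2 : n + 2 < W := (Nat.le_self_pow (by omega) (n + 2)).trans_lt hW
  have h := Exec.seq (exec_load (W := W) (x := 5) (y := 3) (k := n)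
      (s := WordRAM.initial I) (by simpa [WordRAM.initial] using h0) (by omega)) <|
    .seq (exec_const (x := 7) (k := 2) (by omega)) <|
    .seq (exec_arith (x := 5) (y := 5) (z := 7) (k := n + 2) (o := .add)
      (by simp [Op.eval, setReg_ne]) h2) <|
    exec_powCode (k := n + 2) (by simp) (by omega) q hW
  rw [show q + 4 = 1 + (1 + (1 + (q + 1))) by ring]
  refine ⟨_, h, ⟨by simp, ?_, fun x => ?_, fun i _ => rfl, fun j i => hI _ (by omega)⟩⟩
  · simp [setReg_ne, WordRAM.initial]
  · simp only [State.init]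
    rw [setReg_ne _ _ (by omega), setReg_ne _ _ (by omega), setReg_ne _ _ (by omega),
      setReg_ne _ _ (by omega)]
    rfl

/-- A tame command that halts in polynomial time compiles to a word RAM program. -/
theorem exists_prog (p : Com) (hp : p.Tame) (e : ℕ) :
    ∃ (P : Prog) (c C : ℕ), ∀ (n : ℕ) (I : ℕ → ℕ) (t : ℕ) (σ : State), I 0 = n →
      (∀ i, I i ≤ (n + 2) ^ 2) → (∀ i, (n + 2) ^ 3 ≤ i → I i = 0) →
      Run p (State.init I) t σ → t ≤ (n + 2) ^ e →
      ∃ s, Exec (2 ^ (c * Nat.size (n + 1))) P (WordRAM.initial I) (t + C) s ∧ s.reg 0 = σ.v .res := by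
  set S := p.size
  -- Values stay at most `(n + 2) ^ (e + 3)` and intermediate results at most its `S`-th power. The
  -- summand `4` makes the base address strictly larger than that and puts it beyond the input. Six
  -- further factors `n + 2 ≥ 2` in the word size absorb `17 * B + 16`.
  set q := (e + 3) * S + 4 with hq
  refine ⟨.seq (prologue q) p.compile, q + 6, q + 4, fun n I t σ h0 hI hI3 hr ht => ?_⟩
  have hn : n + 2 ≤ 2 ^ Nat.size (n + 1) := Nat.lt_size_self (n + 1)
  have hW : (n + 2) ^ (q + 6) ≤ 2 ^ ((q + 6) * Nat.size (n + 1)) := by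
    rw [mul_comm, pow_mul]; exact Nat.pow_le_pow_left hn _
  set W := 2 ^ ((q + 6) * Nat.size (n + 1))
  have h1 : 1 ≤ (n + 2) ^ q := Nat.one_le_pow _ _ (by omega)
  have hW' : 17 * (n + 2) ^ q + 16 < W := by
    refine lt_of_lt_of_le ?_ hW
    have : 2 ^ 6 ≤ (n + 2) ^ 6 := Nat.pow_le_pow_left (by omega) 6
    rw [pow_add _ q 6]
    nlinarith
  obtain ⟨s, hx, hs⟩ := exec_prologue (W := W) h0
    (fun i hi => hI3 i ((Nat.pow_le_pow_right (by omega) (by omega)).trans hi))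
    (q := q) (by omega) (by omega)
  have hk : 2 ≤ (n + 2) ^ (e + 3) := (show 2 ≤ n + 2 by omega).trans (Nat.le_self_pow (by omega) _)
  have hb : (n + 2) ^ 2 + t ≤ (n + 2) ^ (e + 3) := by
    have a1 : (n + 2) ^ 2 ≤ (n + 2) ^ (e + 2) := Nat.pow_le_pow_right (by omega) (by omega)
    have a2 : (n + 2) ^ e ≤ (n + 2) ^ (e + 2) := Nat.pow_le_pow_right (by omega) (by omega)
    have a3 : (n + 2) ^ (e + 3) = (n + 2) ^ (e + 2) * (n + 2) := pow_succ _ _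
    nlinarith
  obtain ⟨s', hx', hs', -⟩ := hr.exec_compile hk hW' (S := S) (B := (n + 2) ^ q)
    (by rw [← pow_mul]; exact Nat.pow_lt_pow_right (by omega) (by omega)) hp le_rfl
    (k₀ := (n + 2) ^ 2) ⟨fun _ => Nat.zero_le _, fun _ _ => Nat.zero_le _, hI⟩ hb s hs
  refine ⟨s', ?_, by simpa [Var.code] using hs'.var .res⟩
  rw [add_comm t]
  exact .seq hx hx'

end Imp

/-! ### Levels and loads certify the unpopularity margin -/

namespace PrefInstance

variable {n : ℕ}

open Classical in
/-- The comparison bit of `a` for `b` and `b'`. -/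
noncomputable def bit (G : PrefInstance n) (a b b' : Fin n) : ℕ := if G.pref a b b' then 1 else 0

@[simp] theorem bit_self (G : PrefInstance n) (a b : Fin n) : G.bit a b b = 0 := by
  simp [bit, G.pref_irrefl]

theorem bit_le_one (G : PrefInstance n) (a b b' : Fin n) : G.bit a b b' ≤ 1 := by
  unfold bit; split_ifs <;> omega

/-- The levels `l` and the loads `s` certify that the assignment `M` has unpopularity margin at
most `∑ a, s a`. -/
structure Certifies (G : PrefInstance n) (M : Fin n ≃ Fin n) (l s : Fin n → ℕ) : Prop where
  isAssignment : G.IsAssignment M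
  le : ∀ a b, (a, b) ∈ G.edges → l b + G.bit a b (M a) ≤ l (M a) + s a + G.bit a (M a) b

/-! ### Weak and strong duality -/

theorem delta_eq_sum (G : PrefInstance n) (M N : Fin n ≃ Fin n) :
    G.delta N M = ∑ a, ((G.bit a (N a) (M a) : ℤ) - G.bit a (M a) (N a)) := by
  classical
  simp only [delta, phi, Finset.card_filter, Finset.sum_sub_distrib, bit]
  push_cast
  rfl

theorem bddAbove_delta (G : PrefInstance n) (M : Fin n ≃ Fin n) :
    BddAbove {d : ℤ | ∃ N : Fin n ≃ Fin n, G.IsAssignment N ∧ d = G.delta N M} := by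
  refine (Set.Finite.subset (Set.finite_range fun N : Fin n ≃ Fin n => G.delta N M) ?_).bddAbove
  rintro d ⟨N, -, rfl⟩
  exact ⟨N, rfl⟩

/-- Weak duality: add up the certificate inequalities on the edges of a competing assignment. The
levels cancel because both assignments are bijections onto the objects. -/
theorem Certifies.unpopularityMargin_le {G : PrefInstance n} {M : Fin n ≃ Fin n} {l s : Fin n → ℕ}
    (h : G.Certifies M l s) {k : ℕ} (hs : ∑ a, s a ≤ k) : G.unpopularityMargin M ≤ k := by
  refine csSup_le ⟨_, M, h.isAssignment, rfl⟩ ?_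
  rintro d ⟨N, hN, rfl⟩
  rw [delta_eq_sum]
  have hle : ∀ a ∈ Finset.univ, (G.bit a (N a) (M a) : ℤ) - G.bit a (M a) (N a) ≤
      (l (M a) : ℤ) - l (N a) + s a := by
    intro a _
    have := h.le a (N a) (hN a)
    omega
  refine (Finset.sum_le_sum hle).trans ?_
  rw [Finset.sum_add_distrib, Finset.sum_sub_distrib, Equiv.sum_comp M fun b => (l b : ℤ),
    Equiv.sum_comp N fun b => (l b : ℤ)]
  have : (∑ a, (s a : ℤ)) ≤ k := by exact_mod_cast hs
  linarith

/-- Integral linear programming duality for the assignment problem on a graph with a perfect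
matching of weight `0`. -/
theorem exists_potentials (E : Finset (Fin n × Fin n)) (w : Fin n → Fin n → ℤ) (M : Fin n ≃ Fin n)
    (hM : ∀ a, (a, M a) ∈ E) (hw : ∀ a, w a (M a) = 0) (hw1 : ∀ a b, w a b ≤ 1) :
    ∃ (α β : Fin n → ℤ) (N : Fin n ≃ Fin n), (∀ a b, (a, b) ∈ E → w a b ≤ α a + β b) ∧
      (∀ a, (a, N a) ∈ E) ∧ ∑ a, w a (N a) = ∑ a, α a + ∑ b, β b := by
  classical
  let feas (α β : Fin n → ℤ) : Prop := ∀ a b, (a, b) ∈ E → w a b ≤ α a + β b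
  have nonneg {α β : Fin n → ℤ} (h : feas α β) : 0 ≤ ∑ a, α a + ∑ b, β b := by
    rw [← Equiv.sum_comp M β, ← Finset.sum_add_distrib]
    exact Finset.sum_nonneg fun a _ => by have := h a (M a) (hM a); rw [hw] at this; exact this
  have hne : ∃ d : ℕ, ∃ α β : Fin n → ℤ, feas α β ∧ (d : ℤ) = ∑ a, α a + ∑ b, β b := by
    have h0 : feas (fun _ => 1) fun _ => 0 := fun a b _ => by simpa using hw1 a b
    exact ⟨(_ : ℤ).toNat, _, _, h0, Int.toNat_of_nonneg (nonneg h0)⟩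
  -- An integral feasible dual of least total exists: totals are nonnegative since `M` is a perfect
  -- matching of weight `0`, and `α = 1`, `β = 0` is feasible.
  obtain ⟨α, β, hf, hd⟩ := Nat.find_spec hne
  let T (a : Fin n) : Finset (Fin n) := Finset.univ.filter fun b => (a, b) ∈ E ∧ w a b = α a + β b
  have hall : ∀ X : Finset (Fin n), X.card ≤ (X.biUnion T).card := by
    intro X
    by_contra! hlt
    -- The Hungarian step. If `X` violates Hall's condition for the tight edges, lower `α` on `X`
    -- and raise `β` on its tight neighbours. Edges from `X` that are not tight have slack at least
    -- `1` by integrality, so feasibility survives, while the total falls.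
    let α' (a : Fin n) : ℤ := α a - if a ∈ X then 1 else 0
    let β' (b : Fin n) : ℤ := β b + if b ∈ X.biUnion T then 1 else 0
    have hf' : feas α' β' := by
      intro a b hab
      have h1 := hf a b hab
      simp only [α', β']
      by_cases ha : a ∈ X
      · by_cases hb : b ∈ X.biUnion T
        · simp only [ha, hb, if_true]; omega
        · have : w a b ≠ α a + β b := fun h => hb <| Finset.mem_biUnion.2
            ⟨a, ha, by simp only [T, Finset.mem_filter_univ]; exact ⟨hab, h⟩⟩
          simp only [ha, hb, if_true, if_false]; omega
      · simp only [ha, if_false]; split_ifs <;> omega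
    have hsum : ∑ a, α' a + ∑ b, β' b =
        ∑ a, α a + ∑ b, β b - X.card + (X.biUnion T).card := by
      simp only [α', β', Finset.sum_sub_distrib, Finset.sum_add_distrib, Finset.sum_ite_mem,
        Finset.univ_inter, Finset.sum_const, nsmul_eq_mul, mul_one]
      ring
    have hn := nonneg hf'
    exact Nat.find_min hne (m := (∑ a, α' a + ∑ b, β' b).toNat) (by omega)
      ⟨α', β', hf', Int.toNat_of_nonneg hn⟩
  obtain ⟨f, hinj, hfT⟩ := (Finset.all_card_le_biUnion_card_iff_exists_injective T).1 hall
  have hT : ∀ a, (a, f a) ∈ E ∧ w a (f a) = α a + β (f a) := fun a => by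
    have := hfT a; simpa only [T, Finset.mem_filter_univ] using this
  let N := Equiv.ofBijective f (Finite.injective_iff_bijective.1 hinj)
  refine ⟨α, β, N, hf, fun a => (hT a).1, ?_⟩
  rw [← Equiv.sum_comp N β, ← Finset.sum_add_distrib]
  exact Finset.sum_congr rfl fun a _ => (hT a).2

/-- Strong duality: optimal potentials have total `G.delta N M` for some assignment `N`, and this is
at most the margin. -/
theorem exists_certifies {G : PrefInstance n} {M : Fin n ≃ Fin n} (hM : G.IsAssignment M) {k : ℕ}
    (hk : G.unpopularityMargin M ≤ k) : ∃ l s : Fin n → ℕ, G.Certifies M l s ∧ ∑ a, s a ≤ k := by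
  obtain ⟨α, β, N, hf, hN, hsum⟩ := exists_potentials G.edges
    (fun a b => (G.bit a b (M a) : ℤ) - G.bit a (M a) b) M hM (by simp) (fun a b => by
      have := G.bit_le_one a b (M a); omega)
  rw [← delta_eq_sum] at hsum
  have hle : ∑ a, α a + ∑ b, β b ≤ k :=
    hsum ▸ (le_csSup (G.bddAbove_delta M) ⟨N, hN, rfl⟩).trans hk
  have hB : ∀ b, β b ≤ ∑ b, |β b| := fun b => (le_abs_self _).trans
    (Finset.single_le_sum (f := fun b => |β b|) (fun _ _ => abs_nonneg _) (Finset.mem_univ b))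
  have hs : ∀ a, 0 ≤ α a + β (M a) := fun a => by have := hf a (M a) (hM a); simpa using this
  -- Levels are the negated object potentials, shifted to be nonnegative. Loads are the slacks on
  -- the edges of `M`, which are nonnegative because these edges have weight `0`.
  refine ⟨fun b => (∑ b, |β b| - β b).toNat, fun a => (α a + β (M a)).toNat, ⟨hM, fun a b hab => ?_⟩,
    ?_⟩
  · have h1 := hf a b hab
    have h2 := hs a
    have h3 := hB b
    have h4 := hB (M a)
    change (_ : ℤ).toNat + _ ≤ (_ : ℤ).toNat + (_ : ℤ).toNat + _
    omega
  · have : ((∑ a, (α a + β (M a)).toNat : ℕ) : ℤ) = ∑ a, (α a + β (M a)) := by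
      push_cast
      exact Finset.sum_congr rfl fun a _ => Int.toNat_of_nonneg (hs a)
    rw [Finset.sum_add_distrib, Equiv.sum_comp M β] at this
    change ∑ a, (α a + β (M a)).toNat ≤ k
    omega

/-- Levels of a certificate can be chosen below `n`. -/
theorem Certifies.exists_lt {G : PrefInstance n} {M : Fin n ≃ Fin n} {l s : Fin n → ℕ}
    (h : G.Certifies M l s) : ∃ l' : Fin n → ℕ, G.Certifies M l' s ∧ ∀ b, l' b < n := by
  classical
  have hne : ∃ d : ℕ, ∃ l' : Fin n → ℕ, G.Certifies M l' s ∧ d = ∑ b, l' b := ⟨_, l, h, rfl⟩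
  obtain ⟨l', hl', hd⟩ := Nat.find_spec hne
  refine ⟨l', hl', fun b₀ => ?_⟩
  by_contra! hb₀
  -- Pigeonhole: if all values below `n` occurred besides a level `≥ n`, the `n` objects would have
  -- `n + 1` different levels after truncation at `n`.
  obtain ⟨v, hv, hvl⟩ : ∃ v < n, ∀ b, l' b ≠ v := by
    by_contra! hcon
    have hsub : Finset.range (n + 1) ⊆ Finset.univ.image fun b => min (l' b) n := by
      intro v hv
      rw [Finset.mem_range] at hv
      rcases Nat.lt_or_ge v n with hvn | hvn
      · obtain ⟨b, hb⟩ := hcon v hvn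
        exact Finset.mem_image.2 ⟨b, Finset.mem_univ _, by omega⟩
      · exact Finset.mem_image.2 ⟨b₀, Finset.mem_univ _, by omega⟩
    have := (Finset.card_le_card hsub).trans Finset.card_image_le
    simp at this
  -- Close the gap at `v`. Levels on different sides of the gap differ by at least `2`, so they
  -- still differ by at least `1` afterwards, which is enough for a comparison bit. The sum of the
  -- levels falls, against its minimality.
  let l'' (b : Fin n) : ℕ := if v < l' b then l' b - 1 else l' b
  have hc : G.Certifies M l'' s := by
    refine ⟨h.isAssignment, fun a b hab => ?_⟩
    have h1 := hl'.le a b hab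
    have h2 := hvl b
    have h3 := hvl (M a)
    have h4 := G.bit_le_one a b (M a)
    simp only [l'']
    split_ifs <;> omega
  refine Nat.find_min hne (m := ∑ b, l'' b) ?_ ⟨l'', hc, rfl⟩
  rw [hd]
  refine Finset.sum_lt_sum (fun b _ => ?_) ⟨b₀, Finset.mem_univ _, ?_⟩
  · simp only [l'']; split_ifs <;> omega
  · simp only [l'']; rw [if_pos (by omega)]; omega

end PrefInstance

/-! ### Accepted edges, matchings and Hall violators

Agents and objects are natural numbers below `n`. In a pair of arrays `ma`, `mb` that represents a
matching, the entry `0` means "free" and the entry `k + 1` means "matched to `k`". -/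

/-- The data of an instance with loads: adjacency, comparison bits, loads of the edges and upper
bounds of the loads at every agent. -/
structure Loaded where
  n : ℕ
  adj : ℕ → ℕ → Prop
  pf : ℕ → ℕ → ℕ → ℕ
  ld : ℕ → ℕ → ℕ
  fa : ℕ → ℕ

namespace Loaded

/-- At levels `l`, the object `b` makes the agent `a` reject the object `x`. -/
def Viol (G : Loaded) (l : ℕ → ℕ) (a x b : ℕ) : Prop :=
  l x + G.ld a x + G.pf a x b < l b + G.pf a b x

/-- The edge of `a` and `x` is accepted at levels `l`. -/
def Acc (G : Loaded) (l : ℕ → ℕ) (a x : ℕ) : Prop :=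
  G.adj a x ∧ G.fa a ≤ G.ld a x ∧ ∀ b < G.n, G.adj a b → ¬ G.Viol l a x b

/-- `M` is a perfect matching of accepted edges. -/
structure Solution (G : Loaded) (l M : ℕ → ℕ) : Prop where
  lt : ∀ a < G.n, M a < G.n
  inj : ∀ a < G.n, ∀ a' < G.n, M a = M a' → a = a'
  acc : ∀ a < G.n, G.Acc l a (M a)

/-- The loads at an agent are dominated by `fa`. -/
def LoadsLe (G : Loaded) : Prop :=
  ∀ a < G.n, ∀ b < G.n, ∀ c < G.n, b ≠ c → G.ld a b + G.ld a c ≤ G.fa a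

theorem Solution.exists_eq {G : Loaded} {l M : ℕ → ℕ} (h : G.Solution l M) {b : ℕ} (hb : b < G.n) :
    ∃ a < G.n, M a = b := by
  have := Finset.surj_on_of_inj_on_of_card_le (s := Finset.range G.n) (t := Finset.range G.n)
    (fun a _ => M a) (fun a ha => Finset.mem_range.2 (h.lt a (Finset.mem_range.1 ha)))
    (fun a a' ha ha' e => h.inj a (Finset.mem_range.1 ha) a' (Finset.mem_range.1 ha') e) le_rfl b
    (Finset.mem_range.2 hb)
  obtain ⟨a, ha, rfl⟩ := this
  exact ⟨a, Finset.mem_range.1 ha, rfl⟩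

/-- If `r` is an unmatched object and the set `R` of objects reachable from `r` on alternating
paths contains no augmenting path, then the level of `r` is too small. -/
theorem Solution.lt_of_stuck {G : Loaded} (hG : G.LoadsLe) {l l' M : ℕ → ℕ} (h : G.Solution l' M)
    (hle : ∀ b < G.n, l b ≤ l' b) {R : Finset ℕ} {r : ℕ} (hr : r ∈ R) (hR : ∀ x ∈ R, x < G.n)
    (mate : ℕ → ℕ)
    (hmate : ∀ x ∈ R, ∀ a < G.n, G.Acc l a x → mate a ∈ R ∧ mate a ≠ r ∧ G.Acc l a (mate a))
    (hinj : ∀ a < G.n, ∀ a' < G.n, mate a ∈ R → mate a = mate a' → a = a') : l r < l' r := by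
  classical
  by_contra hlt
  have hrr : l r = l' r := by have := hle r (hR r hr); omega
  -- `T` holds the reached objects whose level is already that of the solution. If `r` were among
  -- them, going from an object to its partner in the solution and on to that agent's mate would
  -- inject `T` into `T` without `r`.
  set T := R.filter fun b => l b = l' b with hT
  have hg : ∀ b, ∃ a, b < G.n → a < G.n ∧ M a = b := fun b => by
    by_cases hb : b < G.n
    · obtain ⟨a, ha, e⟩ := h.exists_eq hb; exact ⟨a, fun _ => ⟨ha, e⟩⟩
    · exact ⟨0, fun h => absurd h hb⟩
  choose g hg using hg
  have key : ∀ b ∈ T, mate (g b) ∈ T.erase r := by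
    intro b hb
    obtain ⟨hbR, hbl⟩ := Finset.mem_filter.1 hb
    obtain ⟨ha, hMa⟩ := hg b (hR b hbR)
    set a := g b
    have hacc' := h.acc a ha
    rw [hMa] at hacc'
    -- Passing from `l'` down to `l` keeps the level of `b` and lowers no other level's chance of
    -- being harmless, so acceptance of `b` carries over.
    have hacc : G.Acc l a b := by
      refine ⟨hacc'.1, hacc'.2.1, fun x hx hax hv => hacc'.2.2 x hx hax ?_⟩
      have := hle x hx
      unfold Viol at hv ⊢
      omega
    obtain ⟨hy, hyr, hya⟩ := hmate b hbR a ha hacc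
    refine Finset.mem_erase.2 ⟨hyr, Finset.mem_filter.2 ⟨hy, ?_⟩⟩
    by_contra hne
    have h1 := hle _ (hR _ hy)
    have h2 := hacc'.2.2 _ (hR _ hy) hya.1
    have h3 := hya.2.2 b (hR b hbR) hacc.1
    have h4 := hacc.2.1
    have h5 := hya.2.1
    have hbne : b ≠ mate a := fun e => hne (e ▸ hbl)
    -- Two different accepted edges at `a` both carry at least `fa a`, while together they carry at
    -- most `fa a`; so both loads are zero. Then the comparison of `b` and `mate a` at `l'` and the
    -- opposite one at `l` leave no room for `mate a` to have a larger level in `l'`.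
    have h6 := hG a ha b (hR b hbR) (mate a) (hR _ hy) hbne
    unfold Viol at h2 h3
    omega
  have hcard := Finset.card_le_card_of_injOn (fun b => mate (g b)) key (by
    intro b hb b' hb' e
    have hb1 := hR b (Finset.mem_filter.1 hb).1
    have hb2 := hR b' (Finset.mem_filter.1 hb').1
    have := hinj _ (hg b hb1).1 _ (hg b' hb2).1
      (Finset.mem_filter.1 (Finset.mem_erase.1 (key b hb)).2).1 e
    rw [← (hg b hb1).2, ← (hg b' hb2).2, this])
  have hrT : r ∈ T := Finset.mem_filter.2 ⟨hr, hrr⟩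
  rw [Finset.card_erase_of_mem hrT] at hcard
  have := Finset.card_pos.2 ⟨r, hrT⟩
  omega

end Loaded

/-- The arrays `ma`, `mb` represent a matching of edges in `E`. -/
structure IsMatching (n : ℕ) (E : ℕ → ℕ → Prop) (ma mb : ℕ → ℕ) : Prop where
  ma_le : ∀ a < n, ma a ≤ n
  mb_le : ∀ b < n, mb b ≤ n
  iff : ∀ a < n, ∀ b < n, ma a = b + 1 ↔ mb b = a + 1
  edge : ∀ a < n, ∀ b < n, mb b = a + 1 → E a b

/-- The number of free objects. -/
def freeCount (n : ℕ) (mb : ℕ → ℕ) : ℕ := ((Finset.range n).filter fun b => mb b = 0).card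

/-- In the auction, a matching that respects prices up to `D ≥ √n` misses the size of every
matching by at most `D`. -/
theorem freeCount_le_add {n D : ℕ} {E : ℕ → ℕ → Prop} {ma mb ma' mb' p d : ℕ → ℕ}
    (hD : n ≤ D * D) (hM : IsMatching n E ma mb) (hM' : IsMatching n E ma' mb')
    (hE : ∀ a < n, ∀ b < n, E a b → d b ≤ p a)
    (hd : ∀ a < n, ∀ b < n, mb b = a + 1 → p a = d b + 1)
    (hp : ∀ a < n, ma a = 0 → p a = 0) (hfree : ∀ b < n, mb b = 0 → d b = D) :
    freeCount n mb ≤ freeCount n mb' + D := by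
  classical
  rcases Nat.eq_zero_or_pos D with rfl | hD0
  · have : n = 0 := by omega
    subst this; simp [freeCount]
  -- Averaging: if each of the `D` price classes had more than `D` agents, there would be at least
  -- `D * (D + 1) > n` agents.
  obtain ⟨v, hv, hvc⟩ : ∃ v ∈ Finset.Icc 1 D,
      ((Finset.range n).filter fun a => p a = v).card ≤ D := by
    by_contra! hcon
    have h1 : ∑ v ∈ Finset.Icc 1 D, (D + 1) ≤
        ∑ v ∈ Finset.Icc 1 D, ((Finset.range n).filter fun a => p a = v).card :=
      Finset.sum_le_sum hcon
    rw [Finset.sum_card_fiberwise_eq_card_filter] at h1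
    have h2 := Finset.card_filter_le (Finset.range n) fun a => p a ∈ Finset.Icc 1 D
    simp only [Finset.sum_const, Nat.card_Icc, Finset.card_range, smul_eq_mul] at h1 h2
    have : D * (D + 1) ≤ n := by simpa using h1.trans h2
    nlinarith
  rw [Finset.mem_Icc] at hv
  -- All free objects of the first matching have label `D ≥ v` and so lie in `S`. It remains to
  -- compare how many objects of `S` the two matchings cover: the first covers at least `A2.card`,
  -- the second at most `A1.card`, and these differ by at most `D`.
  set S := (Finset.range n).filter fun b => v ≤ d b with hS
  set A1 := (Finset.range n).filter fun a => v ≤ p a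
  set A2 := (Finset.range n).filter fun a => v + 1 ≤ p a
  have hA1 : A1.card ≤ A2.card + D := by
    have : A1 ⊆ A2 ∪ (Finset.range n).filter fun a => p a = v := by
      intro a ha
      simp only [A1, A2, Finset.mem_union, Finset.mem_filter, Finset.mem_range] at ha ⊢
      omega
    exact (Finset.card_le_card this).trans ((Finset.card_union_le _ _).trans (by omega))
  have split (f : ℕ → ℕ) : (S.filter fun b => f b = 0).card + (S.filter fun b => ¬ f b = 0).card =
      S.card := Finset.card_filter_add_card_filter_not _
  -- An agent with a positive price is matched, and the label of her partner is her price minus one.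
  have hA2 : A2.card ≤ (S.filter fun b => ¬ mb b = 0).card := by
    refine Finset.card_le_card_of_injOn (fun a => ma a - 1) (fun a ha => ?_) fun a ha a' ha' e => ?_
    · simp only [A2, Finset.coe_filter, Finset.mem_range, Set.mem_ofPred_eq] at ha
      have h0 := hp a ha.1
      have h1 := hM.ma_le a ha.1
      have h2 : ma a = (ma a - 1) + 1 := by omega
      have h3 := (hM.iff a ha.1 _ (by omega)).1 h2
      have h4 := hd a ha.1 _ (by omega) h3
      simp only [S, Finset.coe_filter, Finset.mem_filter, Finset.mem_range, Set.mem_ofPred_eq]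
      omega
    · simp only [A2, Finset.coe_filter, Finset.mem_range, Set.mem_ofPred_eq] at ha ha'
      have h0 := hp a ha.1
      have h1 := hM.ma_le a ha.1
      have h2 : ma a = (ma a - 1) + 1 := by omega
      have h0' := hp a' ha'.1
      have e' : ma a' = (ma a - 1) + 1 := by simp only at e; omega
      have h3 := (hM.iff a ha.1 _ (by omega)).1 h2
      have h4 := (hM.iff a' ha'.1 _ (by omega)).1 e'
      omega
  -- Along any edge the price of the agent is at least the label of the object, so partners of
  -- objects in `S` have price at least `v`.
  have hA1' : (S.filter fun b => ¬ mb' b = 0).card ≤ A1.card := by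
    refine Finset.card_le_card_of_injOn (fun b => mb' b - 1) (fun b hb => ?_) fun b hb b' hb' e => ?_
    · simp only [S, Finset.coe_filter, Finset.mem_filter, Finset.mem_range, Set.mem_ofPred_eq] at hb
      have h1 := hM'.mb_le b hb.1.1
      have h2 := hE _ (by omega) b hb.1.1
        (hM'.edge (mb' b - 1) (by omega) b hb.1.1 (by omega))
      simp only [A1, Finset.coe_filter, Finset.mem_range, Set.mem_ofPred_eq]
      omega
    · simp only [S, Finset.coe_filter, Finset.mem_filter, Finset.mem_range, Set.mem_ofPred_eq] at hb hb'
      have h1 := hM'.mb_le b hb.1.1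
      have h2 := (hM'.iff (mb' b - 1) (by omega) b hb.1.1).2 (by omega)
      have h3 := (hM'.iff (mb' b - 1) (by omega) b' hb'.1.1).2 (by simp only at e; omega)
      omega
  have hF : freeCount n mb = (S.filter fun b => mb b = 0).card := by
    unfold freeCount
    congr 1
    ext b
    simp only [S, Finset.mem_filter, Finset.mem_range]
    constructor
    · rintro ⟨h1, h2⟩; have := hfree b h1 h2; omega
    · rintro ⟨⟨h1, -⟩, h2⟩; exact ⟨h1, h2⟩
  have hF' : (S.filter fun b => mb' b = 0).card ≤ freeCount n mb' :=
    Finset.card_le_card fun b hb => by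
      simp only [S, Finset.mem_filter] at hb ⊢
      exact ⟨hb.1.1, hb.2⟩
  have h1 := split mb
  have h2 := split mb'
  omega

/-! ### Rules for running commands -/

namespace Imp

/-- The effect of a command without loops. -/
@[simp] def Com.den : Com → State → State
  | skip, σ => σ
  | set x e, σ => σ.setv x (e.eval σ)
  | put j e f, σ => σ.setr j (e.eval σ) (f.eval σ)
  | seq p q, σ => q.den (p.den σ)
  | ite b p q, σ => if b.Holds σ then p.den σ else q.den σ
  | loop _ _, σ => σ

/-- A bound of the running time of a command without loops. -/
@[simp] def Com.cost : Com → ℕ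
  | skip => 1
  | set _ e => e.cost + 1
  | put _ e f => e.cost + f.cost + 6
  | seq p q => p.cost + q.cost
  | ite b p q => b.cost + 1 + max p.cost q.cost
  | loop _ _ => 0

/-- Commands without loops. -/
@[simp] def Com.LoopFree : Com → Prop
  | skip => True
  | set _ _ => True
  | put _ _ _ => True
  | seq p q => p.LoopFree ∧ q.LoopFree
  | ite _ p q => p.LoopFree ∧ q.LoopFree
  | loop _ _ => False

theorem Com.LoopFree.run {p : Com} (h : p.LoopFree) (σ : State) :
    ∃ t, Run p σ t (p.den σ) ∧ t ≤ p.cost := by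
  induction p generalizing σ with
  | skip => exact ⟨_, .skip, le_rfl⟩
  | set x e => exact ⟨_, .set, le_rfl⟩
  | put j e f => exact ⟨_, .put, le_rfl⟩
  | seq p q ihp ihq =>
    obtain ⟨t, ht, hle⟩ := ihp h.1 σ
    obtain ⟨t', ht', hle'⟩ := ihq h.2 (p.den σ)
    exact ⟨_, .seq ht ht', by simp only [Com.cost]; omega⟩
  | ite b p q ihp ihq =>
    obtain ⟨t, ht, hle⟩ := ihp h.1 σ
    obtain ⟨t', ht', hle'⟩ := ihq h.2 σ
    by_cases hb : b.Holds σ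
    · exact ⟨_, by rw [Com.den, if_pos hb]; exact .ite_true hb ht, by simp only [Com.cost]; omega⟩
    · exact ⟨_, by rw [Com.den, if_neg hb]; exact .ite_false hb ht', by simp only [Com.cost]; omega⟩
  | loop b p => exact h.elim

/-- The command does not assign to a variable. -/
@[simp] def Com.KeepsVar : Com → Var → Prop
  | skip, _ => True
  | set x _, y => y ≠ x
  | put _ _ _, _ => True
  | seq p q, y => p.KeepsVar y ∧ q.KeepsVar y
  | ite _ p q, y => p.KeepsVar y ∧ q.KeepsVar y
  | loop _ p, y => p.KeepsVar y

/-- The command does not write to an array. -/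
@[simp] def Com.KeepsArr : Com → Arr → Prop
  | skip, _ => True
  | set _ _, _ => True
  | put j _ _, j' => j' ≠ j
  | seq p q, j' => p.KeepsArr j' ∧ q.KeepsArr j'
  | ite _ p q, j' => p.KeepsArr j' ∧ q.KeepsArr j'
  | loop _ p, j' => p.KeepsArr j'

/-- Two states agree on everything that `p` does not write. -/
structure Frame (p : Com) (σ σ' : State) : Prop where
  v : ∀ x, p.KeepsVar x → σ'.v x = σ.v x
  r : ∀ j, p.KeepsArr j → σ'.r j = σ.r j
  I : σ'.I = σ.I

theorem Frame.refl (p : Com) (σ : State) : Frame p σ σ := ⟨fun _ _ => rfl, fun _ _ => rfl, rfl⟩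

theorem Frame.trans {p : Com} {σ σ' σ'' : State} (h : Frame p σ σ') (h' : Frame p σ' σ'') :
    Frame p σ σ'' :=
  ⟨fun x hx => (h'.v x hx).trans (h.v x hx), fun j hj => (h'.r j hj).trans (h.r j hj),
    h'.I.trans h.I⟩

theorem Run.frame {p : Com} {σ σ' : State} {t : ℕ} (h : Run p σ t σ') : Frame p σ σ' := by
  induction h with
  | skip => exact .refl _ _
  | set => exact ⟨fun y hy => by simp [show y ≠ _ from hy], fun _ _ => rfl, rfl⟩
  | put => exact ⟨fun _ _ => rfl, fun j hj => by simp [show j ≠ _ from hj], rfl⟩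
  | seq _ _ ih ih' =>
    exact ⟨fun x hx => (ih'.v x hx.2).trans (ih.v x hx.1),
      fun j hj => (ih'.r j hj.2).trans (ih.r j hj.1), ih'.I.trans ih.I⟩
  | ite_true _ _ ih => exact ⟨fun x hx => ih.v x hx.1, fun j hj => ih.r j hj.1, ih.I⟩
  | ite_false _ _ ih => exact ⟨fun x hx => ih.v x hx.2, fun j hj => ih.r j hj.2, ih.I⟩
  | loop_true _ _ _ ih ih' =>
    exact ⟨fun x hx => (ih'.v x hx).trans (ih.v x hx),
      fun j hj => (ih'.r j hj).trans (ih.r j hj), ih'.I.trans ih.I⟩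
  | loop_false _ => exact .refl _ _

/-- Loops with a potential that pays for the running time. -/
theorem run_loop {b : Cond} {p : Com} (Inv : State → Prop) (μ : State → ℕ) {σ : State}
    (h : Inv σ)
    (step : ∀ σ', Frame p σ σ' → Inv σ' → b.Holds σ' →
      ∃ t σ'', Run p σ' t σ'' ∧ Inv σ'' ∧ t + b.cost + 1 + μ σ'' ≤ μ σ') :
    ∃ t σ', Run (.loop b p) σ t σ' ∧ Frame p σ σ' ∧ Inv σ' ∧ ¬ b.Holds σ' ∧
      t ≤ μ σ + b.cost + 1 := by
  obtain ⟨k, hk⟩ : ∃ k, μ σ ≤ k := ⟨_, le_rfl⟩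
  suffices H : ∀ k σ', Frame p σ σ' → Inv σ' → μ σ' ≤ k →
      ∃ t σ'', Run (.loop b p) σ' t σ'' ∧ Frame p σ σ'' ∧ Inv σ'' ∧ ¬ b.Holds σ'' ∧
        t ≤ μ σ' + b.cost + 1 from H k σ (.refl _ _) h hk
  intro k
  induction k with
  | zero =>
    intro σ' hF hI hμ
    by_cases hb : b.Holds σ'
    · obtain ⟨t, σ'', hr, -, hle⟩ := step σ' hF hI hb
      omega
    · exact ⟨_, σ', .loop_false hb, hF, hI, hb, by omega⟩
  | succ k ih =>
    intro σ' hF hI hμ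
    by_cases hb : b.Holds σ'
    · obtain ⟨t, σ'', hr, hI', hle⟩ := step σ' hF hI hb
      obtain ⟨t', σ''', hr', hF', hI'', hb', hle'⟩ := ih σ'' (hF.trans hr.frame) hI' (by omega)
      exact ⟨_, σ''', .loop_true hb hr hr', hF', hI'', hb', by omega⟩
    · exact ⟨_, σ', .loop_false hb, hF, hI, hb, by omega⟩

/-- Loops whose body has no loops, with a measure that decreases. -/
theorem run_loop_den {b : Cond} {p : Com} (hp : p.LoopFree) (K : ℕ) (hK : p.cost + b.cost + 1 ≤ K)
    (Inv : State → Prop) (μ : State → ℕ) {σ : State} (h : Inv σ)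
    (step : ∀ σ', Frame p σ σ' → Inv σ' → b.Holds σ' →
      Inv (p.den σ') ∧ μ (p.den σ') < μ σ') :
    ∃ t σ', Run (.loop b p) σ t σ' ∧ Frame p σ σ' ∧ Inv σ' ∧ ¬ b.Holds σ' ∧ t ≤ K * (μ σ + 1) := by
  obtain ⟨t, σ', hr, hF, hI, hb, ht⟩ := run_loop (b := b) (p := p) Inv (fun σ => K * μ σ) h
    (fun σ' hF hI hb => by
      obtain ⟨t, hr, ht⟩ := hp.run σ'
      obtain ⟨hI', hμ⟩ := step σ' hF hI hb
      refine ⟨t, _, hr, hI', ?_⟩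
      have := Nat.mul_le_mul_left K (Nat.succ_le_of_lt hμ)
      simp only [Nat.mul_succ] at this
      omega)
  exact ⟨t, σ', hr, hF, hI, hb, by rw [Nat.mul_succ]; omega⟩

/-! ### Edge lists -/

/-- The expression `1`. -/
@[simp] abbrev Expr.one : Expr := .suc .zero

/-- The position of a pair in an `n × n` matrix. -/
@[simp] abbrev Expr.cell (e f : Expr) : Expr := .add (.mul e (.var .n)) f

/-- The adjacency bit of a pair. -/
@[simp] abbrev Expr.adj (e f : Expr) : Expr := .inp (.add (.suc .one) (.cell e f))

/-- A comparison bit. -/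
@[simp] abbrev Expr.pf (e f g : Expr) : Expr :=
  .inp (.add (.add (.suc .one) (.mul (.var .n) (.var .n))) (.cell (.cell e f) g))

/-- The adjacency relation in the input. -/
def adj (I : ℕ → ℕ) (n a b : ℕ) : Prop := I (2 + (a * n + b)) = 1

/-- The comparison bits in the input. -/
def pf (I : ℕ → ℕ) (n a b b' : ℕ) : ℕ := I (2 + n * n + ((a * n + b) * n + b'))

/-- `ea i` and `eb i`, for `i < m`, are the ends of the edges, sorted by objects; the edges at the
object `b` are those with `st b ≤ i < st (b + 1)`. -/
structure EdgeList (n m : ℕ) (adj : ℕ → ℕ → Prop) (ea eb st : ℕ → ℕ) : Prop where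
  st_zero : st 0 = 0
  st_last : st n = m
  mono : ∀ b b', b ≤ b' → b' ≤ n → st b ≤ st b'
  ea_lt : ∀ i < m, ea i < n
  eb_lt : ∀ i < m, eb i < n
  isAdj : ∀ i < m, adj (ea i) (eb i)
  st_le : ∀ i < m, st (eb i) ≤ i
  lt_st : ∀ i < m, i < st (eb i + 1)
  inj : ∀ i i', i < i' → i' < m → eb i = eb i' → ea i < ea i'
  surj : ∀ a < n, ∀ b < n, adj a b → ∃ i < m, ea i = a ∧ eb i = b

theorem EdgeList.eb_eq {n m : ℕ} {adj : ℕ → ℕ → Prop} {ea eb st : ℕ → ℕ}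
    (h : EdgeList n m adj ea eb st) {b i : ℕ} (hb : b < n) (h1 : st b ≤ i) (h2 : i < st (b + 1)) :
    i < m ∧ eb i = b := by
  have hm : i < m := by
    have := h.mono (b + 1) n (by omega) le_rfl
    rw [h.st_last] at this; omega
  refine ⟨hm, ?_⟩
  have h3 := h.st_le i hm
  have h4 := h.lt_st i hm
  have h5 := h.eb_lt i hm
  by_contra hne
  rcases Nat.lt_or_gt_of_ne hne with hlt | hlt
  · have := h.mono (eb i + 1) b (by omega) (by omega); omega
  · have := h.mono (b + 1) (eb i) (by omega) (by omega); omega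

/-- The body of the loop of `buildEdges`. -/
def buildBody : Com :=
  .ite (.lt (.var .a) (.var .n))
    (.seq (.ite (.eq (.adj (.var .a) (.var .x)) .one)
        (.seq (.put .ea (.var .i) (.var .a)) <| .seq (.put .eb (.var .i) (.var .x)) <|
          .set .i (.suc (.var .i))) .skip)
      (.set .a (.suc (.var .a))))
    (.seq (.set .a .zero) <| .seq (.set .x (.suc (.var .x))) <| .put .st (.var .x) (.var .i))

/-- Compute the edge list. -/
def buildEdges : Com :=
  .seq (.seq (.set .i .zero) <| .seq (.set .a .zero) <| .seq (.set .x .zero) <|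
    .put .st .zero .zero) <|
  .seq (.loop (.lt (.var .x) (.var .n)) buildBody) (.set .m (.var .i))

/-- The invariant of `buildEdges`. -/
structure BuildInv (n : ℕ) (adj : ℕ → ℕ → Prop) (x a k : ℕ) (ea eb st : ℕ → ℕ) : Prop where
  x_le : x ≤ n
  a_le : a ≤ n
  a_eq : x = n → a = 0
  st_zero : st 0 = 0
  st_x : st x ≤ k
  mono : ∀ b b', b ≤ b' → b' ≤ x → st b ≤ st b'
  ea_lt : ∀ i < k, ea i < n
  eb_lt : ∀ i < k, eb i < n
  eb_le : ∀ i < k, eb i ≤ x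
  ea_lt_a : ∀ i < k, eb i = x → ea i < a
  isAdj : ∀ i < k, adj (ea i) (eb i)
  st_le : ∀ i < k, st (eb i) ≤ i
  lt_st : ∀ i < k, eb i < x → i < st (eb i + 1)
  inj : ∀ i i', i < i' → i' < k → eb i = eb i' → ea i < ea i'
  surj : ∀ a' < n, ∀ b < n, adj a' b → b < x ∨ b = x ∧ a' < a → ∃ i < k, ea i = a' ∧ eb i = b
  st_eq : x = n → st x = k

theorem BuildInv.skip {n : ℕ} {adj : ℕ → ℕ → Prop} {x a k : ℕ} {ea eb st : ℕ → ℕ}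
    (h : BuildInv n adj x a k ea eb st) (hx : x < n) (ha : a < n) (hadj : ¬ adj a x) :
    BuildInv n adj x (a + 1) k ea eb st := by
  obtain ⟨h1, h2, h3, h4, h5, h6, h7, h8, h9, h10, h11, h12, h13, h14, h15, h16⟩ := h
  refine ⟨h1, ha, by omega, h4, h5, h6, h7, h8, h9, fun i hi e => ?_, h11, h12, h13, h14, ?_, h16⟩
  · have := h10 i hi e; omega
  · intro a' ha' b hb hab hc
    refine h15 a' ha' b hb hab ?_
    rcases hc with hc | ⟨rfl, hc⟩
    · exact .inl hc
    · refine .inr ⟨rfl, ?_⟩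
      rcases Nat.lt_succ_iff_lt_or_eq.1 hc with hc | rfl
      · exact hc
      · exact absurd hab hadj

theorem BuildInv.add {n : ℕ} {adj : ℕ → ℕ → Prop} {x a k : ℕ} {ea eb st : ℕ → ℕ}
    (h : BuildInv n adj x a k ea eb st) (hx : x < n) (ha : a < n) (hadj : adj a x) :
    BuildInv n adj x (a + 1) (k + 1) (Function.update ea k a) (Function.update eb k x) st := by
  obtain ⟨h1, h2, h3, h4, h5, h6, h7, h8, h9, h10, h11, h12, h13, h14, h15, h16⟩ := h
  have old {i : ℕ} (hi : i < k + 1) (hne : ¬ i = k) : i < k := by omega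
  refine ⟨h1, ha, by omega, h4, by omega, h6, ?_, ?_, ?_, ?_, ?_, ?_, ?_, ?_, ?_, by omega⟩
  all_goals simp only [Function.update_apply]
  · intro i hi; split_ifs with e
    · exact ha
    · exact h7 i (old hi e)
  · intro i hi; split_ifs with e
    · exact hx
    · exact h8 i (old hi e)
  · intro i hi; split_ifs with e
    · exact le_rfl
    · exact h9 i (old hi e)
  · intro i hi; split_ifs with e
    · omega
    · intro e'; have := h10 i (old hi e) e'; omega
  · intro i hi; split_ifs with e
    · exact hadj
    · exact h11 i (old hi e)
  · intro i hi; split_ifs with e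
    · omega
    · exact h12 i (old hi e)
  · intro i hi; split_ifs with e
    · omega
    · exact h13 i (old hi e)
  · intro i i' hii hi'
    split_ifs with e e' e'
    · omega
    · omega
    · exact h10 i (by omega)
    · exact h14 i i' hii (old hi' e')
  · intro a' ha' b hb hab hc
    by_cases hn : b = x ∧ a' = a
    · exact ⟨k, by omega, by simp [hn.1, hn.2]⟩
    · obtain ⟨i, hi, e1, e2⟩ := h15 a' ha' b hb hab (by omega)
      exact ⟨i, by omega, by rw [if_neg (by omega), if_neg (by omega)]; exact ⟨e1, e2⟩⟩

/-- All agents have been tried for the object `x`, so its block of edges ends at `k`, where the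
block of `x + 1` begins. -/
theorem BuildInv.next {n : ℕ} {adj : ℕ → ℕ → Prop} {x a k : ℕ} {ea eb st : ℕ → ℕ}
    (h : BuildInv n adj x a k ea eb st) (hx : x < n) (ha : ¬ a < n) :
    BuildInv n adj (x + 1) 0 k ea eb (Function.update st (x + 1) k) := by
  obtain ⟨h1, h2, h3, h4, h5, h6, h7, h8, h9, h10, h11, h12, h13, h14, h15, h16⟩ := h
  refine ⟨hx, by omega, fun _ => rfl, ?_, ?_, ?_, h7, h8, ?_, ?_, h11, ?_, ?_, h14, ?_, ?_⟩
  all_goals try simp only [Function.update_apply]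
  · rw [if_neg (by omega)]; exact h4
  · simp
  · intro b b' hbb hb'
    split_ifs with e1 e2 e2
    · exact le_rfl
    · omega
    · have := h6 b x (by omega) le_rfl; omega
    · exact h6 b b' hbb (by omega)
  · intro i hi; have := h9 i hi; omega
  · intro i hi e; have := h9 i hi; omega
  · intro i hi
    have := h9 i hi
    rw [if_neg (by omega)]; exact h12 i hi
  · intro i hi hlt
    split_ifs with e
    · exact hi
    · exact h13 i hi (by omega)
  · intro a' ha' b hb hab hc
    exact h15 a' ha' b hb hab (by omega)
  · simp

theorem BuildInv.edgeList {n : ℕ} {adj : ℕ → ℕ → Prop} {a k : ℕ} {ea eb st : ℕ → ℕ}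
    (h : BuildInv n adj n a k ea eb st) : EdgeList n k adj ea eb st :=
  ⟨h.st_zero, h.st_eq rfl, h.mono, h.ea_lt, h.eb_lt, h.isAdj, h.st_le,
    fun i hi => h.lt_st i hi (h.eb_lt i hi), h.inj,
    fun a' ha' b hb hab => h.surj a' ha' b hb hab (.inl hb)⟩

theorem run_buildEdges (σ : State) : ∃ t σ', Run buildEdges σ t σ' ∧ Frame buildEdges σ σ' ∧
    EdgeList (σ.v .n) (σ'.v .m) (adj σ.I (σ.v .n)) (σ'.r .ea) (σ'.r .eb) (σ'.r .st) ∧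
    t ≤ 60 * ((σ.v .n + 1) * (σ.v .n + 1) + 2) := by
  set n := σ.v .n with hn
  obtain ⟨t0, hr0, ht0⟩ := Com.LoopFree.run (p := .seq (.set .i .zero) <| .seq (.set .a .zero) <|
    .seq (.set .x .zero) <| .put .st .zero .zero) (by simp) σ
  set σ0 := Com.den _ σ with hσ0
  have hinv0 : BuildInv n (adj σ.I n) (σ0.v .x) (σ0.v .a) (σ0.v .i) (σ0.r .ea) (σ0.r .eb)
      (σ0.r .st) := by
    simp only [hσ0, Com.den, Expr.eval, State.setr_v, State.setv_v, State.setr_r, State.setv_r,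
      reduceCtorEq, if_true, if_false]
    refine ⟨?_, ?_, ?_, ?_, ?_, ?_, ?_, ?_, ?_, ?_, ?_, ?_, ?_, ?_, ?_, ?_⟩
    all_goals simp (config := { contextual := true })
    rintro b b' h rfl
    simp [Nat.le_zero.1 h]
  obtain ⟨t1, σ1, hr1, hF1, hI1, hb1, ht1⟩ := run_loop_den (b := .lt (.var .x) (.var .n))
    (p := buildBody) (by simp [buildBody]) 60 (by simp [buildBody])
    (fun σ' => BuildInv n (adj σ.I n) (σ'.v .x) (σ'.v .a) (σ'.v .i) (σ'.r .ea) (σ'.r .eb)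
      (σ'.r .st))
    (fun σ' => (n - σ'.v .x) * (n + 1) + (n - σ'.v .a)) hinv0 (by
      intro σ' hF hI hb
      have hn' : σ'.v .n = n := hF.v .n (by simp [buildBody])
      have hI' : σ'.I = σ.I := hF.I
      simp only [Cond.Holds, Expr.eval, hn'] at hb
      simp only [buildBody, Com.den, Cond.Holds, Expr.eval, hn', hI']
      split_ifs with h1 h2
      · refine ⟨?_, ?_⟩
        · simpa using hI.add hb h1 (by simpa [adj] using h2)
        · simp; omega
      · refine ⟨?_, ?_⟩
        · simpa using hI.skip hb h1 (by simpa [adj] using h2)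
        · simp; omega
      · refine ⟨?_, ?_⟩
        · simpa using hI.next hb h1
        · simp
          have : n - σ'.v .x = (n - (σ'.v .x + 1)) + 1 := by omega
          rw [this, Nat.succ_mul]
          omega)
  have hnx : σ1.v .x = n := by
    have := hI1.x_le
    have hn' : σ1.v .n = n := hF1.v .n (by simp [buildBody])
    simp only [Cond.Holds, Expr.eval, hn'] at hb1
    omega
  have hr := Run.seq hr0 (.seq hr1 (.set (x := .m) (e := .var .i)))
  refine ⟨_, _, hr, hr.frame, ?_, ?_⟩
  · rw [hnx] at hI1
    simpa using hI1.edgeList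
  · have hx0 : σ0.v .x = 0 := by simp [hσ0]
    have ha0 : σ0.v .a = 0 := by simp [hσ0]
    simp only [hx0, ha0, Nat.sub_zero] at ht1
    simp at ht0 ⊢
    nlinarith

/-- Compute `⌈√n⌉`. -/
def sqrtLoop : Com := .loop (.lt (.mul (.var .D) (.var .D)) (.var .n)) (.set .D (.suc (.var .D)))

theorem run_sqrtLoop (σ : State) (h0 : σ.v .D = 0) : ∃ t σ', Run sqrtLoop σ t σ' ∧
    Frame sqrtLoop σ σ' ∧ σ.v .n ≤ σ'.v .D * σ'.v .D ∧
    (σ'.v .D = 0 ∨ (σ'.v .D - 1) * (σ'.v .D - 1) < σ.v .n) ∧ t ≤ 10 * (σ.v .n + 1) := by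
  obtain ⟨t1, σ1, hr1, hF1, hI1, hb1, ht1⟩ := run_loop_den
    (b := .lt (.mul (.var .D) (.var .D)) (.var .n))
    (p := .set .D (.suc (.var .D))) (by simp) 10 (by simp)
    (fun σ' => σ'.v .D = 0 ∨ (σ'.v .D - 1) * (σ'.v .D - 1) < σ.v .n)
    (fun σ' => σ.v .n - σ'.v .D) (.inl h0) (by
      intro σ' hF hI hb
      have hn' : σ'.v .n = σ.v .n := hF.v .n (by simp)
      simp only [Cond.Holds, Expr.eval, hn'] at hb
      simp only [Com.den, Expr.eval, State.setv_v, if_true]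
      refine ⟨.inr (by simpa using hb), ?_⟩
      have := Nat.le_mul_self (σ'.v .D)
      omega)
  refine ⟨_, _, hr1, hr1.frame, ?_, hI1, by simpa [h0] using ht1⟩
  have hn' : σ1.v .n = σ.v .n := hF1.v .n (by simp)
  simpa [hn'] using hb1

/-! ### The auction phase of the matching algorithm -/

theorem sum_range_lt {n x : ℕ} {f g : ℕ → ℕ} (hx : x < n) (h : ∀ b < n, b ≠ x → f b ≤ g b)
    (hlt : f x < g x) : ∑ b ∈ Finset.range n, f b < ∑ b ∈ Finset.range n, g b := by
  refine Finset.sum_lt_sum (fun b hb => ?_) ⟨x, Finset.mem_range.2 hx, hlt⟩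
  by_cases e : b = x
  · subst e; exact hlt.le
  · exact h b (Finset.mem_range.1 hb) e

theorem EdgeList.sum_degree {n m : ℕ} {adj : ℕ → ℕ → Prop} {ea eb st : ℕ → ℕ}
    (h : EdgeList n m adj ea eb st) : ∑ b ∈ Finset.range n, (st (b + 1) - st b) = m := by
  suffices H : ∀ k ≤ n, ∑ b ∈ Finset.range k, (st (b + 1) - st b) = st k by
    rw [H n le_rfl, h.st_last]
  intro k hk
  induction k with
  | zero => simp [h.st_zero]
  | succ k ih =>
    rw [Finset.sum_range_succ, ih (by omega)]
    have := h.mono k (k + 1) (by omega) hk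
    omega

/-- The invariant of the auction: `pr` holds prices of agents, `dl` labels of objects, `cur` the
next edge to be tried at an object, `x` is the active object if `act = 1`. -/
structure AuctionInv (n D : ℕ) (adj ok : ℕ → ℕ → Prop) (ea st ma mb pr dl cur : ℕ → ℕ)
    (x c act : ℕ) : Prop where
  matching : IsMatching n (fun a b => adj a b ∧ ok a b) ma mb
  price : ∀ b < n, ∀ i, st b ≤ i → i < st (b + 1) → ok (ea i) b → dl b ≤ pr (ea i)
  price_lt : ∀ b < n, ∀ i, st b ≤ i → i < cur b → ok (ea i) b → dl b < pr (ea i)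
  cur_ge : ∀ b < n, st b ≤ cur b
  cur_le : ∀ b < n, cur b ≤ st (b + 1)
  mate : ∀ a < n, ∀ b < n, mb b = a + 1 → pr a = dl b + 1
  free : ∀ a < n, ma a = 0 → pr a = 0
  dl_le : ∀ b < n, dl b ≤ D
  pr_le : ∀ a < n, pr a ≤ D
  c_le : c ≤ n
  act_le : act ≤ 1
  active : act = 1 → x < c ∧ mb x = 0
  done : ∀ b < c, mb b = 0 → dl b = D ∨ act = 1 ∧ b = x
  todo : ∀ b < n, c ≤ b → mb b = 0

/-- The potential of the auction. -/
def auctionPot (n D : ℕ) (st pr dl cur : ℕ → ℕ) (c act : ℕ) : ℕ :=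
  2 * (n - c) + act +
    ∑ b ∈ Finset.range n, ((D - dl b) * (st (b + 1) - st b + 1) + (st (b + 1) - cur b)) +
    ∑ a ∈ Finset.range n, (D - pr a)

namespace AuctionInv

variable {n m D : ℕ} {adj ok : ℕ → ℕ → Prop} {ea eb st ma mb pr dl cur : ℕ → ℕ} {x c act : ℕ}

/-- Every untreated object contributes `2` to the potential: one unit pays for its activation, the
other is kept as `act` until the activity ends. -/
theorem start (h : AuctionInv n D adj ok ea st ma mb pr dl cur x c act) (hact : act = 0)
    (hc : c < n) : AuctionInv n D adj ok ea st ma mb pr dl cur c (c + 1) 1 ∧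
      auctionPot n D st pr dl cur (c + 1) 1 < auctionPot n D st pr dl cur c act := by
  refine ⟨{ h with
    c_le := hc
    act_le := le_rfl
    active := fun _ => ⟨by omega, h.todo c hc le_rfl⟩
    done := fun b hb h0 => ?_
    todo := fun b hb hcb => h.todo b hb (by omega) }, by unfold auctionPot; omega⟩
  rcases Nat.lt_succ_iff_lt_or_eq.1 hb with hb | rfl
  · rcases h.done b hb h0 with h1 | h1
    · exact .inl h1
    · omega
  · exact .inr ⟨rfl, rfl⟩

theorem giveUp (h : AuctionInv n D adj ok ea st ma mb pr dl cur x c act) (hact : act ≠ 0)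
    (hx : dl x = D) : AuctionInv n D adj ok ea st ma mb pr dl cur x c 0 ∧
      auctionPot n D st pr dl cur c 0 < auctionPot n D st pr dl cur c act := by
  refine ⟨{ h with
    act_le := by omega
    active := by omega
    done := fun b hb h0 => ?_ }, by unfold auctionPot; omega⟩
  rcases h.done b hb h0 with h1 | ⟨-, rfl⟩
  · exact .inl h1
  · exact .inl hx

theorem x_lt (h : AuctionInv n D adj ok ea st ma mb pr dl cur x c act) (hact : act ≠ 0) :
    x < n ∧ mb x = 0 := by
  have h1 := h.act_le
  have h2 := h.c_le
  have h3 := h.active (by omega)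
  exact ⟨by omega, h3.2⟩

/-- When the pointer has passed all edges at `x`, their allowed agents have prices above the label,
so the label may rise by one. One unit of label is worth the degree plus one in the potential, which
pays for scanning the edges of `x` again. -/
theorem relabel (h : AuctionInv n D adj ok ea st ma mb pr dl cur x c act) (hact : act ≠ 0)
    (hx : dl x ≠ D) (hcur : cur x = st (x + 1)) :
    AuctionInv n D adj ok ea st ma mb pr (Function.update dl x (dl x + 1))
      (Function.update cur x (st x)) x c act ∧
    auctionPot n D st pr (Function.update dl x (dl x + 1)) (Function.update cur x (st x)) c act <
      auctionPot n D st pr dl cur c act := by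
  obtain ⟨hxn, hx0⟩ := h.x_lt hact
  have hD := h.dl_le x hxn
  have hge := h.cur_ge x hxn
  constructor
  · refine { h with
      price := ?_
      price_lt := ?_
      cur_ge := ?_
      cur_le := ?_
      mate := ?_
      dl_le := ?_
      done := ?_ }
    all_goals simp only [Function.update_apply]
    · intro b hb i h1 h2 h3
      split_ifs with e
      · subst e; exact h.price_lt b hb i h1 (by omega) h3
      · exact h.price b hb i h1 h2 h3
    · intro b hb i h1 h2 h3
      split_ifs at h2 ⊢ with e
      · subst e; omega
      · exact h.price_lt b hb i h1 h2 h3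
    · intro b hb
      split_ifs with e
      · subst e; rfl
      · exact h.cur_ge b hb
    · intro b hb
      split_ifs with e
      · subst e; omega
      · exact h.cur_le b hb
    · intro a ha b hb h1
      split_ifs with e
      · subst e; omega
      · exact h.mate a ha b hb h1
    · intro b hb
      split_ifs with e
      · omega
      · exact h.dl_le b hb
    · intro b hb h0
      split_ifs with e
      · exact .inr ⟨by have := h.act_le; omega, e⟩
      · exact h.done b hb h0
  · unfold auctionPot
    refine Nat.add_lt_add_right (Nat.add_lt_add_left (sum_range_lt hxn (fun b _ e => ?_) ?_) _) _
    · simp [e]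
    · simp only [Function.update_self, hcur]
      have : D - dl x = D - (dl x + 1) + 1 := by omega
      rw [this, Nat.succ_mul]
      omega

/-- Prices never fall, so an edge passed over as too expensive stays so until the next change of the
label. -/
theorem advance (h : AuctionInv n D adj ok ea st ma mb pr dl cur x c act) (hact : act ≠ 0)
    (hcur : cur x ≠ st (x + 1)) (hno : ¬ (ok (ea (cur x)) x ∧ pr (ea (cur x)) ≤ dl x)) :
    AuctionInv n D adj ok ea st ma mb pr dl (Function.update cur x (cur x + 1)) x c act ∧
    auctionPot n D st pr dl (Function.update cur x (cur x + 1)) c act <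
      auctionPot n D st pr dl cur c act := by
  obtain ⟨hxn, hx0⟩ := h.x_lt hact
  have hle := h.cur_le x hxn
  have hge := h.cur_ge x hxn
  constructor
  · refine { h with
      price_lt := ?_
      cur_ge := ?_
      cur_le := ?_ }
    all_goals simp only [Function.update_apply]
    · intro b hb i h1 h2 h3
      split_ifs at h2 with e
      · subst e
        rcases Nat.lt_succ_iff_lt_or_eq.1 h2 with h2 | rfl
        · exact h.price_lt b hb i h1 h2 h3
        · exact not_le.1 fun h4 => hno ⟨h3, h4⟩
      · exact h.price_lt b hb i h1 h2 h3
    · intro b hb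
      split_ifs with e
      · subst e; omega
      · exact h.cur_ge b hb
    · intro b hb
      split_ifs with e
      · subst e; omega
      · exact h.cur_le b hb
  · unfold auctionPot
    refine Nat.add_lt_add_right (Nat.add_lt_add_left (sum_range_lt hxn (fun b _ e => ?_) ?_) _) _
    · simp [e]
    · simp only [Function.update_self]
      omega

end AuctionInv

/-! ### Bids for free and for matched agents -/

theorem _root_.IsMatching.take {n a x : ℕ} {E : ℕ → ℕ → Prop} {ma mb : ℕ → ℕ} (h : IsMatching n E ma mb)
    (ha : a < n) (hx : x < n) (hx0 : mb x = 0) (hE : E a x) (ha0 : ma a = 0) :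
    IsMatching n E (Function.update ma a (x + 1)) (Function.update mb x (a + 1)) := by
  constructor
  all_goals simp only [Function.update_apply]
  · intro a' ha'
    split_ifs
    · grind
    · exact h.ma_le a' ha'
  · intro b hb
    split_ifs
    · grind
    · exact h.mb_le b hb
  · intro a' ha' b hb
    have h1 := h.iff a' ha' b hb
    split_ifs with e1 e2 e2
    · grind
    · grind
    · grind
    · exact h1
  · intro a' ha' b hb
    split_ifs with e1
    · grind
    · exact h.edge a' ha' b hb

theorem _root_.IsMatching.kick {n a x y : ℕ} {E : ℕ → ℕ → Prop} {ma mb : ℕ → ℕ} (h : IsMatching n E ma mb)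
    (ha : a < n) (hx : x < n) (hx0 : mb x = 0) (hE : E a x) (hay : ma a = y + 1) :
    IsMatching n E (Function.update ma a (x + 1))
      (Function.update (Function.update mb x (a + 1)) y 0) := by
  have hy : y < n := by have := h.ma_le a ha; omega
  have hyx : mb y = a + 1 := (h.iff a ha y hy).1 hay
  have hne : x ≠ y := by rintro rfl; omega
  constructor
  all_goals simp only [Function.update_apply]
  · intro a' ha'
    split_ifs
    · grind
    · exact h.ma_le a' ha'
  · intro b hb
    split_ifs
    · grind
    · grind
    · exact h.mb_le b hb
  · intro a' ha' b hb
    have h1 := h.iff a' ha' b hb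
    split_ifs with e1 e2 e3 e2 e3
    · grind
    · grind
    · grind
    · grind
    · grind
    · exact h1
  · intro a' ha' b hb
    split_ifs with e1 e2
    · grind
    · grind
    · exact h.edge a' ha' b hb

namespace AuctionInv

variable {n m D : ℕ} {adj ok : ℕ → ℕ → Prop} {ea eb st ma mb pr dl cur : ℕ → ℕ} {x c act : ℕ}

/-- The price of `a` rises from at most `dl x` to `dl x + 1`, which keeps all price inequalities and
pays for the step. It stays within `D` because the label of `x` is not yet `D`. -/
theorem take (h : AuctionInv n D adj ok ea st ma mb pr dl cur x c act)
    (hact : act ≠ 0) (hx : dl x ≠ D) {a : ℕ} (ha : a < n) (hadj : adj a x) (hok : ok a x)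
    (hle : pr a ≤ dl x) (ha0 : ma a = 0) :
    AuctionInv n D adj ok ea st (Function.update ma a (x + 1)) (Function.update mb x (a + 1))
      (Function.update pr a (dl x + 1)) dl cur x c 0 ∧
    auctionPot n D st (Function.update pr a (dl x + 1)) dl cur c 0 <
      auctionPot n D st pr dl cur c act := by
  obtain ⟨hxn, hx0⟩ := h.x_lt hact
  have hD := h.dl_le x hxn
  constructor
  · refine { h with
      matching := h.matching.take ha hxn hx0 ⟨hadj, hok⟩ ha0
      price := ?_
      price_lt := ?_
      mate := ?_
      free := ?_
      pr_le := ?_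
      act_le := by omega
      active := by omega
      done := ?_
      todo := ?_ }
    all_goals simp only [Function.update_apply]
    · intro b hb i h1 h2 h3
      have := h.price b hb i h1 h2 h3
      split_ifs with e
      · rw [e] at this; omega
      · exact this
    · intro b hb i h1 h2 h3
      have := h.price_lt b hb i h1 h2 h3
      split_ifs with e
      · rw [e] at this; omega
      · exact this
    · intro a' ha' b hb
      have h1 := h.matching.iff a' ha' b hb
      have h2 := h.mate a' ha' b hb
      split_ifs with e1 e2 e2
      · grind
      · grind
      · grind
      · exact h2
    · intro a' ha'
      split_ifs with e1
      · grind
      · exact h.free a' ha'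
    · intro a' ha'
      split_ifs with e1
      · grind
      · exact h.pr_le a' ha'
    · intro b hb
      split_ifs with e1
      · grind
      · intro h0
        rcases h.done b hb h0 with h1 | h1
        · exact .inl h1
        · grind
    · intro b hb hcb
      have := (h.active (by have := h.act_le; omega)).1
      rw [if_neg (by omega)]
      exact h.todo b hb hcb
  · unfold auctionPot
    have : ∑ a' ∈ Finset.range n, (D - Function.update pr a (dl x + 1) a') <
        ∑ a ∈ Finset.range n, (D - pr a) := by
      refine sum_range_lt ha (fun b _ e => ?_) ?_
      · simp [e]
      · simp only [Function.update_self]; omega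
    omega

/-- The displaced object `y` becomes active in place of `x`. It was matched, hence already treated,
so the counter `c` need not go back. The higher price of `a` pays for the step. -/
theorem kick (h : AuctionInv n D adj ok ea st ma mb pr dl cur x c act)
    (hact : act ≠ 0) (hx : dl x ≠ D) {a y : ℕ} (ha : a < n) (hadj : adj a x) (hok : ok a x)
    (hle : pr a ≤ dl x) (hay : ma a = y + 1) :
    AuctionInv n D adj ok ea st (Function.update ma a (x + 1))
      (Function.update (Function.update mb x (a + 1)) y 0)
      (Function.update pr a (dl x + 1)) dl cur y c act ∧
    auctionPot n D st (Function.update pr a (dl x + 1)) dl cur c act <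
      auctionPot n D st pr dl cur c act := by
  obtain ⟨hxn, hx0⟩ := h.x_lt hact
  have hD := h.dl_le x hxn
  have hy : y < n := by have := h.matching.ma_le a ha; omega
  have hya : mb y = a + 1 := (h.matching.iff a ha y hy).1 hay
  have hyc : y < c := by
    by_contra hyc
    have := h.todo y hy (by omega)
    omega
  constructor
  · refine { h with
      matching := h.matching.kick ha hxn hx0 ⟨hadj, hok⟩ hay
      price := ?_
      price_lt := ?_
      mate := ?_
      free := ?_
      pr_le := ?_
      active := fun _ => ⟨hyc, by simp⟩
      done := ?_
      todo := ?_ }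
    all_goals simp only [Function.update_apply]
    · intro b hb i h1 h2 h3
      have := h.price b hb i h1 h2 h3
      split_ifs with e
      · rw [e] at this; omega
      · exact this
    · intro b hb i h1 h2 h3
      have := h.price_lt b hb i h1 h2 h3
      split_ifs with e
      · rw [e] at this; omega
      · exact this
    · intro a' ha' b hb
      have h1 := h.matching.iff a' ha' b hb
      have h2 := h.mate a' ha' b hb
      split_ifs with e1 e2 e3 e2 e3
      · grind
      · grind
      · grind
      · grind
      · grind
      · exact h2
    · intro a' ha'
      split_ifs with e1
      · grind
      · exact h.free a' ha'
    · intro a' ha'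
      split_ifs with e1
      · grind
      · exact h.pr_le a' ha'
    · intro b hb
      have h1 := h.act_le
      split_ifs with e1 e2
      · intro _; exact .inr ⟨by omega, e1⟩
      · grind
      · intro h0
        rcases h.done b hb h0 with h2 | h2
        · exact .inl h2
        · exact absurd h2.2 e2
    · intro b hb hcb
      have := (h.active (by have := h.act_le; omega)).1
      rw [if_neg (by omega), if_neg (by omega)]
      exact h.todo b hb hcb
  · unfold auctionPot
    have : ∑ a' ∈ Finset.range n, (D - Function.update pr a (dl x + 1) a') <
        ∑ a ∈ Finset.range n, (D - pr a) := by
      refine sum_range_lt ha (fun b _ e => ?_) ?_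
      · simp [e]
      · simp only [Function.update_self]; omega
    omega

end AuctionInv

/-- An expression that is `0` if and only if the edge of `e` and `f` is accepted. -/
@[simp] abbrev Expr.reject (e f : Expr) : Expr :=
  .add (.get .cnt (.cell e f)) (.sub (.get .fa e) (.get .ld (.cell e f)))

/-- The counter and the loads allow the edge of `a` and `b`. -/
def State.Ok (σ : State) (n a b : ℕ) : Prop :=
  σ.r .cnt (a * n + b) + (σ.r .fa a - σ.r .ld (a * n + b)) = 0

/-- The edges that are accepted according to the counters. -/
def State.Acc (σ : State) (n a b : ℕ) : Prop := adj σ.I n a b ∧ σ.Ok n a b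

/-- Assign the agent of the current edge to the active object. -/
def takeEdge : Com :=
  .seq (.put .pr (.var .a) (.suc (.get .dl (.var .x)))) <|
  .seq (.set .y (.get .ma (.var .a))) <|
  .seq (.put .ma (.var .a) (.suc (.var .x))) <|
  .seq (.put .mb (.var .x) (.suc (.var .a))) <|
  .ite (.eq (.var .y) .zero) (.set .act .zero)
    (.seq (.set .x (.sub (.var .y) .one)) (.put .mb (.var .x) .zero))

/-- One step of the auction. -/
def auctionBody : Com :=
  .ite (.eq (.var .act) .zero)
    (.seq (.set .x (.var .c)) <| .seq (.set .c (.suc (.var .c))) (.set .act .one)) <|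
  .ite (.eq (.get .dl (.var .x)) (.var .D)) (.set .act .zero) <|
  .ite (.eq (.get .cur (.var .x)) (.get .st (.suc (.var .x))))
    (.seq (.put .dl (.var .x) (.suc (.get .dl (.var .x))))
      (.put .cur (.var .x) (.get .st (.var .x)))) <|
  .seq (.set .a (.get .ea (.get .cur (.var .x)))) <|
  .ite (.eq (.add (.reject (.var .a) (.var .x)) (.sub (.get .pr (.var .a)) (.get .dl (.var .x))))
      .zero)
    takeEdge (.put .cur (.var .x) (.suc (.get .cur (.var .x))))

/-- The auction. -/
def auctionLoop : Com := .loop (.lt (.var .c) (.add (.var .n) (.var .act))) auctionBody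

/-- Prepare the auction. -/
def resetBody : Com :=
  .seq (.put .dl (.var .c) .zero) <| .seq (.put .pr (.var .c) .zero) <|
  .seq (.put .cur (.var .c) (.get .st (.var .c))) <| .seq (.put .ma (.var .c) .zero) <|
  .seq (.put .mb (.var .c) .zero) (.set .c (.suc (.var .c)))

/-- Compute a matching of accepted edges whose size is within `√n` of the maximum. -/
def auction : Com :=
  .seq (.set .c .zero) <| .seq (.loop (.lt (.var .c) (.var .n)) resetBody) <|
  .seq (.set .c .zero) <| .seq (.set .act .zero) auctionLoop

/-- The loop condition `c < n + act` fails exactly when all objects have been started and none is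
active, because `c ≤ n` and `act ≤ 1`. -/
theorem run_auctionLoop {n m D : ℕ} {σ : State} (hn : σ.v .n = n) (hD : σ.v .D = D)
    (hE : EdgeList n m (adj σ.I n) (σ.r .ea) (σ.r .eb) (σ.r .st))
    (hI : AuctionInv n D (adj σ.I n) (σ.Ok n) (σ.r .ea) (σ.r .st) (σ.r .ma) (σ.r .mb) (σ.r .pr)
      (σ.r .dl) (σ.r .cur) (σ.v .x) (σ.v .c) (σ.v .act)) :
    ∃ t σ', Run auctionLoop σ t σ' ∧
      AuctionInv n D (adj σ.I n) (σ.Ok n) (σ.r .ea) (σ.r .st) (σ'.r .ma) (σ'.r .mb) (σ'.r .pr)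
        (σ'.r .dl) (σ'.r .cur) (σ'.v .x) n 0 ∧
      t ≤ 200 * (auctionPot n D (σ.r .st) (σ.r .pr) (σ.r .dl) (σ.r .cur) (σ.v .c) (σ.v .act) + 1) := by
  obtain ⟨t1, σ1, hr1, hF1, hI1, hb1, ht1⟩ := run_loop_den
    (b := .lt (.var .c) (.add (.var .n) (.var .act))) (p := auctionBody)
    (by simp [auctionBody, takeEdge]) 200 (by simp [auctionBody, takeEdge])
    (fun σ' => AuctionInv n D (adj σ.I n) (σ.Ok n) (σ.r .ea) (σ.r .st) (σ'.r .ma) (σ'.r .mb)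
      (σ'.r .pr) (σ'.r .dl) (σ'.r .cur) (σ'.v .x) (σ'.v .c) (σ'.v .act))
    (fun σ' => auctionPot n D (σ.r .st) (σ'.r .pr) (σ'.r .dl) (σ'.r .cur) (σ'.v .c) (σ'.v .act))
    hI (by
      intro σ' hF hI hb
      have hn' : σ'.v .n = n := (hF.v .n (by simp [auctionBody, takeEdge])).trans hn
      have hD' : σ'.v .D = D := (hF.v .D (by simp [auctionBody, takeEdge])).trans hD
      have hea : σ'.r .ea = σ.r .ea := hF.r .ea (by simp [auctionBody, takeEdge])
      have hst : σ'.r .st = σ.r .st := hF.r .st (by simp [auctionBody, takeEdge])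
      have hcnt : σ'.r .cnt = σ.r .cnt := hF.r .cnt (by simp [auctionBody, takeEdge])
      have hfa : σ'.r .fa = σ.r .fa := hF.r .fa (by simp [auctionBody, takeEdge])
      have hld : σ'.r .ld = σ.r .ld := hF.r .ld (by simp [auctionBody, takeEdge])
      simp only [Cond.Holds, Expr.eval, hn'] at hb
      simp only [auctionBody, takeEdge, Com.den, Cond.Holds, Expr.eval, hn', hD', hea, hst, hcnt,
        hfa, hld, State.setv_v, State.setv_r, State.setr_v, State.setr_r, reduceCtorEq, if_true,
        if_false]
      by_cases h1 : σ'.v .act = 0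
      · rw [if_pos h1]
        have := hI.start h1 (by omega)
        simpa using this
      rw [if_neg h1]
      by_cases h2 : σ'.r .dl (σ'.v .x) = D
      · rw [if_pos h2]
        have := hI.giveUp h1 h2
        simpa using this
      rw [if_neg h2]
      by_cases h3 : σ'.r .cur (σ'.v .x) = σ.r .st (σ'.v .x + 1)
      · rw [if_pos h3]
        have := hI.relabel h1 h2 h3
        simpa using this
      rw [if_neg h3]
      obtain ⟨hxn, hx0⟩ := hI.x_lt h1
      have hcg := hI.cur_ge _ hxn
      have hcl := hI.cur_le _ hxn
      obtain ⟨him, hib⟩ := hE.eb_eq hxn hcg (by omega)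
      have han := hE.ea_lt _ him
      have hadj := hE.isAdj _ him
      rw [hib] at hadj
      set a := σ.r .ea (σ'.r .cur (σ'.v .x)) with hadef
      -- A sum of truncated differences vanishes if and only if all its terms do, so one test covers
      -- acceptance of the edge and affordability of the agent.
      by_cases h4 : σ.r .cnt (a * n + σ'.v .x) + (σ.r .fa a - σ.r .ld (a * n + σ'.v .x)) +
          (σ'.r .pr a - σ'.r .dl (σ'.v .x)) = 0
      · rw [if_pos h4]
        have hok : σ.Ok n a (σ'.v .x) := by unfold State.Ok; omega
        by_cases h5 : σ'.r .ma a = 0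
        · rw [if_pos h5]
          have := hI.take h1 h2 han hadj hok (by omega) h5
          simpa using this
        · rw [if_neg h5]
          have := hI.kick h1 h2 han hadj hok (by omega)
            (show σ'.r .ma a = (σ'.r .ma a - 1) + 1 by omega)
          simpa using this
      · rw [if_neg h4]
        have := hI.advance h1 h3 (by
          rintro ⟨h5, h6⟩
          rw [← hadef] at h5 h6
          unfold State.Ok at h5
          omega)
        simpa using this)
  have hc : σ1.v .c = n ∧ σ1.v .act = 0 := by
    have hn' : σ1.v .n = n := (hF1.v .n (by simp [auctionBody, takeEdge])).trans hn
    simp only [Cond.Holds, Expr.eval, hn'] at hb1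
    have := hI1.c_le
    omega
  rw [hc.1, hc.2] at hI1
  exact ⟨t1, σ1, hr1, hI1, ht1⟩

/-- At the end no object is active, so the free objects have label `D` and `freeCount_le_add`
applies. The degrees add up to `m`, which turns the initial potential into the time bound. -/
theorem run_auction {n m D : ℕ} {σ : State} (hn : σ.v .n = n) (hD : σ.v .D = D)
    (hDn : n ≤ D * D) (hE : EdgeList n m (adj σ.I n) (σ.r .ea) (σ.r .eb) (σ.r .st)) :
    ∃ t σ', Run auction σ t σ' ∧ IsMatching n (σ.Acc n) (σ'.r .ma) (σ'.r .mb) ∧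
      (∀ ma mb, IsMatching n (σ.Acc n) ma mb →
        freeCount n (σ'.r .mb) ≤ freeCount n mb + D) ∧
      t ≤ 200 * (D * (m + 2 * n) + m + 3 * n + 3) := by
  have hr0 : Run (.set .c .zero) σ _ (σ.setv .c 0) := Run.set
  obtain ⟨t1, σ1, hr1, hF1, hI1, hb1, ht1⟩ := run_loop_den (σ := σ.setv .c 0)
    (b := .lt (.var .c) (.var .n)) (p := resetBody)
    (by simp [resetBody]) 200 (by simp [resetBody])
    (fun σ' => σ'.v .c ≤ n ∧ ∀ b < σ'.v .c, σ'.r .dl b = 0 ∧ σ'.r .pr b = 0 ∧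
      σ'.r .cur b = σ.r .st b ∧ σ'.r .ma b = 0 ∧ σ'.r .mb b = 0)
    (fun σ' => n - σ'.v .c) (by simp) (by
      intro σ' hF hI hb
      have hn' : σ'.v .n = n := (hF.v .n (by simp [resetBody])).trans (by simpa using hn)
      have hst : σ'.r .st = σ.r .st := hF.r .st (by simp [resetBody])
      simp only [Cond.Holds, Expr.eval, hn'] at hb
      simp only [resetBody, Com.den, Expr.eval, State.setv_v, State.setv_r, State.setr_v,
        State.setr_r, reduceCtorEq, if_true, if_false, hst]
      refine ⟨⟨by omega, fun b hb' => ?_⟩, by omega⟩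
      simp only [Function.update_apply]
      split_ifs with e
      · subst e; simp
      · exact hI.2 b (by omega))
  have hn1 : σ1.v .n = n := (hF1.v .n (by simp [resetBody])).trans (by simpa using hn)
  have hc1 : σ1.v .c = n := by
    simp only [Cond.Holds, Expr.eval, hn1] at hb1
    omega
  have hr2 : Run (.set .c .zero) σ1 _ (σ1.setv .c 0) := Run.set
  have hr3 : Run (.set .act .zero) (σ1.setv .c 0) _ ((σ1.setv .c 0).setv .act 0) := Run.set
  set σ3 := (σ1.setv .c 0).setv .act 0 with hσ3
  have hea : σ3.r .ea = σ.r .ea := hF1.r .ea (by simp [resetBody])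
  have heb : σ3.r .eb = σ.r .eb := hF1.r .eb (by simp [resetBody])
  have hst : σ3.r .st = σ.r .st := hF1.r .st (by simp [resetBody])
  have hcnt : σ3.r .cnt = σ.r .cnt := hF1.r .cnt (by simp [resetBody])
  have hfa : σ3.r .fa = σ.r .fa := hF1.r .fa (by simp [resetBody])
  have hld : σ3.r .ld = σ.r .ld := hF1.r .ld (by simp [resetBody])
  have hI3 : σ3.I = σ.I := hF1.I
  have hn3 : σ3.v .n = n := by simpa [hσ3] using hn1
  have hD3 : σ3.v .D = D := by
    have := hF1.v .D (by simp [resetBody])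
    simpa [hσ3, hD] using this
  have hOk : σ3.Ok n = σ.Ok n := by funext a b; simp only [State.Ok, hcnt, hfa, hld]
  obtain ⟨-, hz⟩ := hI1
  rw [hc1] at hz
  have hr_eq : σ3.r = σ1.r := rfl
  obtain ⟨t4, σ4, hr4, hI4, ht4⟩ := run_auctionLoop (σ := σ3) (m := m) hn3 hD3
    (by rw [hea, heb, hst, hI3]; exact hE) (by
      have hc3 : σ3.v .c = 0 := by simp [hσ3]
      have hact3 : σ3.v .act = 0 := by simp [hσ3]
      rw [hc3, hact3, hst, hr_eq]
      refine ⟨⟨?_, ?_, ?_, ?_⟩, ?_, ?_, ?_, ?_, ?_, ?_, ?_, ?_, by omega, by omega, by omega,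
        by omega, ?_⟩
      · intro a ha; rw [(hz a ha).2.2.2.1]; omega
      · intro a ha; rw [(hz a ha).2.2.2.2]; omega
      · intro a ha b hb; rw [(hz a ha).2.2.2.1, (hz b hb).2.2.2.2]; omega
      · intro a ha b hb; rw [(hz b hb).2.2.2.2]; omega
      · intro b hb; rw [(hz b hb).1]; intros; omega
      · intro b hb i h1 h2; rw [(hz b hb).2.2.1] at h2; omega
      · intro b hb; rw [(hz b hb).2.2.1]
      · intro b hb; rw [(hz b hb).2.2.1]; exact hE.mono _ _ (by omega) (by omega)
      · intro a ha b hb; rw [(hz b hb).2.2.2.2]; omega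
      · intro a ha _; exact (hz a ha).2.1
      · intro b hb; rw [(hz b hb).1]; omega
      · intro b hb; rw [(hz b hb).2.1]; omega
      · intro b hb _; exact (hz b hb).2.2.2.2)
  have hr := Run.seq hr0 (.seq hr1 (.seq hr2 (.seq hr3 hr4)))
  rw [hOk, hI3, hea, hst] at hI4
  refine ⟨_, σ4, hr, hI4.matching, fun ma mb hM => ?_, ?_⟩
  · refine freeCount_le_add hDn hI4.matching hM (p := σ4.r .pr) (d := σ4.r .dl) ?_ hI4.mate hI4.free
      fun b hb h0 => ?_
    · intro a ha b hb hab
      obtain ⟨i, him, rfl, rfl⟩ := hE.surj a ha b hb hab.1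
      exact hI4.price _ hb i (hE.st_le i him) (hE.lt_st i him) hab.2
    · rcases hI4.done b hb h0 with h1 | h1
      · exact h1
      · omega
  · have hpot : auctionPot n D (σ3.r .st) (σ3.r .pr) (σ3.r .dl) (σ3.r .cur) (σ3.v .c) (σ3.v .act) =
        2 * n + (D * (m + n) + m) + n * D := by
      have hc3 : σ3.v .c = 0 := by simp [hσ3]
      have hact3 : σ3.v .act = 0 := by simp [hσ3]
      rw [hc3, hact3, hst, hr_eq]
      have e1 : ∑ b ∈ Finset.range n, ((D - σ1.r .dl b) * (σ.r .st (b + 1) - σ.r .st b + 1) +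
          (σ.r .st (b + 1) - σ1.r .cur b)) = ∑ b ∈ Finset.range n,
          (D * (σ.r .st (b + 1) - σ.r .st b + 1) + (σ.r .st (b + 1) - σ.r .st b)) :=
        Finset.sum_congr rfl fun b hb => by
          obtain ⟨h1, -, h2, -⟩ := hz b (Finset.mem_range.1 hb)
          rw [h1, h2, Nat.sub_zero]
      have e2 : ∑ a ∈ Finset.range n, (D - σ1.r .pr a) = ∑ a ∈ Finset.range n, D :=
        Finset.sum_congr rfl fun b hb => by
          rw [(hz b (Finset.mem_range.1 hb)).2.1, Nat.sub_zero]
      rw [auctionPot, e1, e2, Finset.sum_add_distrib, ← Finset.mul_sum, Finset.sum_add_distrib,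
        hE.sum_degree]
      simp
    rw [hpot] at ht4
    simp only [State.setv_v, if_true, Nat.sub_zero] at ht1
    simp only [Expr.cost] at *
    nlinarith

/-! ### The augmentation phase of the matching algorithm -/

/-- The invariant of the search for an augmenting path from the free object `r`: the reached
objects are `qu 0, …, qu (tl - 1)`, the agent `a` with `vis a ≠ 0` was reached from `par a` and is
matched to `qu (vis a)`; if a free agent was reached, it is `fnd - 1`. -/
structure SearchInv (n r : ℕ) (adj ok : ℕ → ℕ → Prop) (ea st ma vis par qu : ℕ → ℕ)
    (hd tl i fnd : ℕ) : Prop where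
  tl_pos : 1 ≤ tl
  hd_le : hd ≤ tl
  qu_zero : qu 0 = r
  qu_lt : ∀ j < tl, qu j < n
  vis_le : ∀ a < n, vis a ≤ tl
  vis_mate : ∀ a < n, vis a ≠ 0 → fnd = a + 1 ∨ vis a < tl ∧ ma a = qu (vis a) + 1
  par_adj : ∀ a < n, vis a ≠ 0 → adj a (par a) ∧ ok a (par a)
  par_qu : ∀ a < n, vis a ≠ 0 → ∃ j < vis a, qu j = par a
  mates : ∀ j, 1 ≤ j → j < tl → ∃ a < n, vis a = j ∧ ma a = qu j + 1
  explored : fnd = 0 → ∀ j < hd, ∀ i', st (qu j) ≤ i' → i' < st (qu j + 1) → ok (ea i') (qu j) →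
    vis (ea i') ≠ 0
  st_le : fnd = 0 → hd < tl → st (qu hd) ≤ i
  le_st : fnd = 0 → hd < tl → i ≤ st (qu hd + 1)
  exploring : fnd = 0 → hd < tl → ∀ i', st (qu hd) ≤ i' → i' < i → ok (ea i') (qu hd) →
    vis (ea i') ≠ 0
  found : fnd ≠ 0 → fnd - 1 < n ∧ vis (fnd - 1) ≠ 0 ∧ ma (fnd - 1) = 0 ∧ hd = tl

namespace SearchInv

variable {n r : ℕ} {adj ok : ℕ → ℕ → Prop} {ea st ma mb vis par qu : ℕ → ℕ} {hd tl i fnd : ℕ}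

/-- Each entry after the root is matched to an agent whose mark `vis` is the position of that entry,
so the object determines its position. The root is free and hence differs from all of them. -/
theorem qu_inj (h : SearchInv n r adj ok ea st ma vis par qu hd tl i fnd)
    (hM : IsMatching n (fun a b => adj a b ∧ ok a b) ma mb) (hr : mb r = 0) {j j' : ℕ}
    (hj : j < tl) (hj' : j' < tl) (e : qu j = qu j') : j = j' := by
  have h0 (k : ℕ) (hk : 1 ≤ k) (hk' : k < tl) : qu k ≠ r := by
    intro e
    obtain ⟨a, ha, -, h2⟩ := h.mates k hk hk'
    have := (hM.iff a ha (qu k) (h.qu_lt k hk')).1 h2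
    rw [e] at this; omega
  have hq := h.qu_zero
  rcases Nat.eq_zero_or_pos j with rfl | h1
  · by_contra hne
    exact h0 j' (by omega) hj' (by rw [← e, hq])
  rcases Nat.eq_zero_or_pos j' with rfl | h1'
  · exact absurd (by rw [e, hq]) (h0 j h1 hj)
  obtain ⟨a, ha, e1, e2⟩ := h.mates j h1 hj
  obtain ⟨a', ha', e1', e2'⟩ := h.mates j' h1' hj'
  have h3 := (hM.iff a ha (qu j) (h.qu_lt j hj)).1 e2
  have h4 := (hM.iff a' ha' (qu j') (h.qu_lt j' hj')).1 e2'
  rw [e] at h3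
  obtain rfl : a = a' := by omega
  omega

theorem tl_le (h : SearchInv n r adj ok ea st ma vis par qu hd tl i fnd)
    (hM : IsMatching n (fun a b => adj a b ∧ ok a b) ma mb) (hr : mb r = 0) : tl ≤ n := by
  have := Finset.card_le_card_of_injOn (s := Finset.range tl) (t := Finset.range n) qu
    (fun j hj => by simpa using h.qu_lt j (by simpa using hj))
    (fun j hj j' hj' e => h.qu_inj hM hr (by simpa using hj) (by simpa using hj') e)
  simpa using this

/-- Since queue entries are distinct, each object is explored at most once. This keeps the truncated
subtraction in the potential from being cut off at zero. -/
theorem sum_le (h : SearchInv n r adj ok ea st ma vis par qu hd tl i fnd)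
    (hM : IsMatching n (fun a b => adj a b ∧ ok a b) ma mb) (hr : mb r = 0) (hlt : hd < tl)
    (f : ℕ → ℕ) : ∑ j ∈ Finset.range hd, f (qu j) + f (qu hd) ≤ ∑ b ∈ Finset.range n, f b := by
  rw [← Finset.sum_range_succ (fun j => f (qu j)), ← Finset.sum_image (g := qu) (f := f)]
  · refine Finset.sum_le_sum_of_subset fun b hb => ?_
    obtain ⟨j, hj, rfl⟩ := Finset.mem_image.1 hb
    rw [Finset.mem_range] at hj
    exact Finset.mem_range.2 (h.qu_lt j (by omega))
  · intro j hj j' hj' e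
    simp only [Finset.coe_range, Set.mem_Iio] at hj hj'
    exact h.qu_inj hM hr (by omega) (by omega) e

/-- The potential of the search. -/
def pot (n : ℕ) (st qu : ℕ → ℕ) (hd i fnd : ℕ) : ℕ :=
  if fnd = 0 then
    ∑ b ∈ Finset.range n, (st (b + 1) - st b + 1) -
      (∑ j ∈ Finset.range hd, (st (qu j + 1) - st (qu j) + 1) + (i - st (qu hd))) + 1
  else 0

theorem fnd_eq (h : SearchInv n r adj ok ea st ma vis par qu hd tl i fnd) (hlt : hd < tl) :
    fnd = 0 := by
  by_contra h0
  have := (h.found h0).2.2.2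
  omega

theorem next (h : SearchInv n r adj ok ea st ma vis par qu hd tl i fnd)
    (hM : IsMatching n (fun a b => adj a b ∧ ok a b) ma mb) (hr : mb r = 0)
    (hmono : ∀ b < n, st b ≤ st (b + 1)) (hlt : hd < tl) (hi : i = st (qu hd + 1)) :
    SearchInv n r adj ok ea st ma vis par qu (hd + 1) tl (st (qu (hd + 1))) fnd ∧
      pot n st qu (hd + 1) (st (qu (hd + 1))) fnd < pot n st qu hd i fnd := by
  have hf := h.fnd_eq hlt
  constructor
  · refine { h with
      hd_le := hlt
      explored := fun _ j hj i' h1 h2 h3 => ?_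
      st_le := fun _ _ => le_rfl
      le_st := fun _ hlt => hmono _ (h.qu_lt _ hlt)
      exploring := fun _ _ i' h1 h2 => by omega
      found := fun h0 => absurd hf h0 }
    rcases Nat.lt_succ_iff_lt_or_eq.1 hj with hj | rfl
    · exact h.explored hf j hj i' h1 h2 h3
    · exact h.exploring hf hlt i' h1 (by omega) h3
  · have := h.sum_le hM hr hlt fun b => st (b + 1) - st b + 1
    unfold pot
    rw [if_pos hf, if_pos hf, Finset.sum_range_succ]
    omega

theorem pot_succ (h : SearchInv n r adj ok ea st ma vis par qu hd tl i fnd)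
    (hM : IsMatching n (fun a b => adj a b ∧ ok a b) ma mb) (hr : mb r = 0)
    (hlt : hd < tl) : pot n st qu hd (i + 1) fnd < pot n st qu hd i fnd := by
  have hf := h.fnd_eq hlt
  have h1 := h.sum_le hM hr hlt fun b => st (b + 1) - st b + 1
  have h2 := h.st_le hf hlt
  have h3 := h.le_st hf hlt
  unfold pot
  rw [if_pos hf, if_pos hf]
  omega

theorem skip (h : SearchInv n r adj ok ea st ma vis par qu hd tl i fnd) (hlt : hd < tl)
    (hi : i ≠ st (qu hd + 1)) (hno : ok (ea i) (qu hd) → vis (ea i) ≠ 0) :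
    SearchInv n r adj ok ea st ma vis par qu hd tl (i + 1) fnd := by
  have hf := h.fnd_eq hlt
  have h2 := h.st_le hf hlt
  have h3 := h.le_st hf hlt
  refine { h with
    st_le := fun _ _ => by omega
    le_st := fun _ _ => by omega
    exploring := fun _ _ i' h4 h5 h6 => ?_ }
  rcases Nat.lt_succ_iff_lt_or_eq.1 h5 with h5 | rfl
  · exact h.exploring hf hlt i' h4 h5 h6
  · exact hno h6

/-- A free agent ends the search: setting `hd` to `tl` makes the loop condition fail. Her mark `tl`
is larger than the position of her parent, which is what the walk back needs. -/
theorem finish (h : SearchInv n r adj ok ea st ma vis par qu hd tl i fnd) (hlt : hd < tl)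
    {a i' : ℕ} (ha : a < n) (hadj : adj a (qu hd)) (hok : ok a (qu hd)) (hvis : vis a = 0)
    (hma : ma a = 0) :
    SearchInv n r adj ok ea st ma (Function.update vis a tl) (Function.update par a (qu hd)) qu
      tl tl i' (a + 1) := by
  have hf := h.fnd_eq hlt
  have ht := h.tl_pos
  refine { h with
    hd_le := le_rfl
    vis_le := ?_
    vis_mate := ?_
    par_adj := ?_
    par_qu := ?_
    mates := ?_
    explored := by omega
    st_le := by omega
    le_st := by omega
    exploring := by omega
    found := fun _ => ⟨by simpa using ha, by simp; omega, by simpa using hma, rfl⟩ }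
  all_goals simp only [Function.update_apply]
  · intro a' ha'
    have := h.vis_le a' ha'
    split_ifs <;> omega
  · intro a' ha'
    have := h.vis_mate a' ha'
    split_ifs with e
    · intro _; exact .inl (by omega)
    · intro h0
      rcases this h0 with h1 | h1
      · omega
      · exact .inr h1
  · intro a' ha'
    split_ifs with e
    · intro _; rw [e]; exact ⟨hadj, hok⟩
    · exact h.par_adj a' ha'
  · intro a' ha'
    split_ifs with e
    · intro _; exact ⟨hd, hlt, rfl⟩
    · exact h.par_qu a' ha'
  · intro j hj hj'
    obtain ⟨a', ha', e1, e2⟩ := h.mates j hj hj'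
    refine ⟨a', ha', ?_, e2⟩
    rw [if_neg (by rintro rfl; omega)]
    exact e1

/-- The mark of a matched agent is the queue position of her partner. It is nonzero because position
`0` belongs to the root, so zero can mean "not reached". -/
theorem push (h : SearchInv n r adj ok ea st ma vis par qu hd tl i fnd)
    (hM : IsMatching n (fun a b => adj a b ∧ ok a b) ma mb) (hlt : hd < tl)
    (hi : i ≠ st (qu hd + 1)) (ha : ea i < n) (hadj : adj (ea i) (qu hd)) (hok : ok (ea i) (qu hd))
    (hvis : vis (ea i) = 0) (hma : ma (ea i) ≠ 0) :
    SearchInv n r adj ok ea st ma (Function.update vis (ea i) tl)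
      (Function.update par (ea i) (qu hd)) (Function.update qu tl (ma (ea i) - 1)) hd (tl + 1)
      (i + 1) fnd := by
  have hf := h.fnd_eq hlt
  have ht := h.tl_pos
  have h2 := h.st_le hf hlt
  have h3 := h.le_st hf hlt
  have hml := hM.ma_le _ ha
  have hq {j : ℕ} (hj : j < tl) : (if j = tl then ma (ea i) - 1 else qu j) = qu j :=
    if_neg (by omega)
  have hv {a : ℕ} (hj : vis a ≠ 0) : (if a = ea i then tl else vis a) = vis a :=
    if_neg (by rintro rfl; omega)
  have hv' {a : ℕ} (hj : vis a ≠ 0) : (if a = ea i then tl else vis a) ≠ 0 := by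
    rw [hv hj]; exact hj
  constructor
  all_goals try simp only [Function.update_apply]
  · omega
  · omega
  · rw [hq (by omega)]; exact h.qu_zero
  · intro j hj
    split_ifs with e
    · omega
    · exact h.qu_lt j (by omega)
  · intro a' ha'
    have := h.vis_le a' ha'
    split_ifs <;> omega
  · intro a' ha'
    split_ifs with e e'
    · intro _; refine .inr ⟨by omega, ?_⟩; rw [e]; omega
    · simp at e'
    · have := h.vis_mate a' ha'; omega
    · intro h0
      rcases h.vis_mate a' ha' h0 with h4 | h4
      · exact .inl h4
      · exact .inr ⟨by omega, h4.2⟩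
  · intro a' ha'
    split_ifs with e
    · intro _; rw [e]; exact ⟨hadj, hok⟩
    · exact h.par_adj a' ha'
  · intro a' ha'
    have hvl := h.vis_le a' ha'
    split_ifs with e
    · intro _; exact ⟨hd, hlt, hq hlt⟩
    · intro h0
      obtain ⟨j, hj, e⟩ := h.par_qu a' ha' h0
      exact ⟨j, hj, by rw [hq (by omega)]; exact e⟩
  · intro j hj hj'
    by_cases e : j = tl
    · exact ⟨ea i, ha, by simp [e], by rw [if_pos e]; omega⟩
    · obtain ⟨a', ha', e1, e2⟩ := h.mates j hj (by omega)
      exact ⟨a', ha', by rw [hv (by omega)]; exact e1, by rw [if_neg e]; exact e2⟩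
  · intro _ j hj i' h4 h5 h6
    rw [hq (by omega)] at h4 h5 h6
    exact hv' (h.explored hf j hj i' h4 h5 h6)
  · intro _ _; rw [hq hlt]; omega
  · intro _ _; rw [hq hlt]; omega
  · intro _ _ i' h4 h5 h6
    rw [hq hlt] at h4 h6
    rcases Nat.lt_succ_iff_lt_or_eq.1 h5 with h5 | rfl
    · exact hv' (h.exploring hf hlt i' h4 h5 h6)
    · rw [if_pos rfl]; omega
  · intro h0; exact absurd hf h0

theorem pot_push (h : SearchInv n r adj ok ea st ma vis par qu hd tl i fnd)
    (hM : IsMatching n (fun a b => adj a b ∧ ok a b) ma mb) (hr : mb r = 0)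
    (hlt : hd < tl) (k : ℕ) :
    pot n st (Function.update qu tl k) hd (i + 1) fnd < pot n st qu hd i fnd := by
  have : pot n st (Function.update qu tl k) hd (i + 1) fnd = pot n st qu hd (i + 1) fnd := by
    have e : ∑ j ∈ Finset.range hd, (st (Function.update qu tl k j + 1) -
        st (Function.update qu tl k j) + 1) =
        ∑ j ∈ Finset.range hd, (st (qu j + 1) - st (qu j) + 1) :=
      Finset.sum_congr rfl fun j hj => by
        rw [Finset.mem_range] at hj
        rw [Function.update_of_ne (by omega)]
    unfold pot
    rw [Function.update_of_ne (by omega), e]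
  rw [this]
  exact h.pot_succ hM hr hlt

end SearchInv

/-- No augmenting path starts at the object `r`. -/
def Stuck (n : ℕ) (E : ℕ → ℕ → Prop) (r : ℕ) : Prop :=
  ∃ (R : Finset ℕ) (mate : ℕ → ℕ), r ∈ R ∧ (∀ x ∈ R, x < n) ∧
    (∀ x ∈ R, ∀ a < n, E a x → mate a ∈ R ∧ mate a ≠ r ∧ E a (mate a)) ∧
    ∀ a < n, ∀ a' < n, mate a ∈ R → mate a = mate a' → a = a'

/-- The witness `R` is the set of all queue entries. Every entry has been explored and no free agent
was found, so each agent with an accepted edge into `R` is matched inside `R`, to an object other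
than the free root. -/
theorem SearchInv.stuck {n m r : ℕ} {adj ok : ℕ → ℕ → Prop} {ea eb st ma mb vis par qu : ℕ → ℕ}
    {hd tl i : ℕ} (h : SearchInv n r adj ok ea st ma vis par qu hd tl i 0)
    (hE : EdgeList n m adj ea eb st)
    (hM : IsMatching n (fun a b => adj a b ∧ ok a b) ma mb) (hr : mb r = 0) (hlt : ¬ hd < tl) :
    Stuck n (fun a b => adj a b ∧ ok a b) r := by
  classical
  have hhd : hd = tl := by have := h.hd_le; omega
  have key : ∀ x ∈ (Finset.range tl).image qu, ∀ a < n, (adj a x ∧ ok a x) →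
      ma a - 1 ∈ (Finset.range tl).image qu ∧ ma a - 1 ≠ r ∧
        (adj a (ma a - 1) ∧ ok a (ma a - 1)) := by
    intro x hx a ha hax
    obtain ⟨j, hj, rfl⟩ := Finset.mem_image.1 hx
    rw [Finset.mem_range] at hj
    obtain ⟨k, hk, rfl, ek⟩ := hE.surj a ha _ (h.qu_lt j hj) hax.1
    have hv := h.explored rfl j (by omega) k (ek ▸ hE.st_le k hk) (ek ▸ hE.lt_st k hk) hax.2
    rcases h.vis_mate _ ha hv with h1 | ⟨h1, h2⟩
    · omega
    · have h3 : ma (ea k) - 1 = qu (vis (ea k)) := by omega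
      have hq := h.qu_lt _ h1
      have h4 := (hM.iff _ ha _ hq).1 h2
      rw [h3]
      refine ⟨Finset.mem_image_of_mem _ (Finset.mem_range.2 h1), ?_, hM.edge _ ha _ hq h4⟩
      intro e; rw [e] at h4; omega
  -- agents that are free or matched outside of the reached objects are sent out of the way
  refine ⟨(Finset.range tl).image qu, fun a => if ma a = 0 then n else ma a - 1, ?_, ?_, ?_, ?_⟩
  · exact Finset.mem_image.2 ⟨0, Finset.mem_range.2 h.tl_pos, h.qu_zero⟩
  · intro x hx
    obtain ⟨j, hj, rfl⟩ := Finset.mem_image.1 hx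
    exact h.qu_lt j (Finset.mem_range.1 hj)
  · intro x hx a ha hax
    have h1 := key x hx a ha hax
    have h0 : ma a ≠ 0 := by
      obtain ⟨j, hj, rfl⟩ := Finset.mem_image.1 hx
      rw [Finset.mem_range] at hj
      obtain ⟨k, hk, rfl, ek⟩ := hE.surj a ha _ (h.qu_lt j hj) hax.1
      have hv := h.explored rfl j (by omega) k (ek ▸ hE.st_le k hk) (ek ▸ hE.lt_st k hk) hax.2
      rcases h.vis_mate _ ha hv with h1 | ⟨h1, h2⟩ <;> omega
    simp only [if_neg h0]
    exact h1
  · intro a ha a' ha' hR e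
    have h1 := hM.ma_le a ha
    have h2 := hM.ma_le a' ha'
    have h0 : ma a ≠ 0 := by
      intro h0
      simp only [if_pos h0] at hR
      obtain ⟨j, hj, e⟩ := Finset.mem_image.1 hR
      have := h.qu_lt j (Finset.mem_range.1 hj)
      omega
    have h0' : ma a' = ma a - 1 + 1 := by
      simp only [if_neg h0] at e
      split_ifs at e <;> omega
    have h3 := (hM.iff a ha (ma a - 1) (by omega)).1 (by omega)
    have h4 := (hM.iff a' ha' (ma a - 1) (by omega)).1 h0'
    omega

/-- The invariant of the augmentation: the agent `fnd - 1` is to be matched to `par (fnd - 1)`. -/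
structure AugmentInv (n r : ℕ) (E : ℕ → ℕ → Prop) (mb₀ vis par ma mb : ℕ → ℕ) (fnd : ℕ) : Prop where
  fnd_le : fnd ≤ n
  ma_le : ∀ a < n, fnd ≠ a + 1 → ma a ≤ n
  mb_le : ∀ b < n, mb b ≤ n
  iff : ∀ a < n, fnd ≠ a + 1 → ∀ b < n, ma a = b + 1 ↔ mb b = a + 1
  edge : ∀ a < n, ∀ b < n, mb b = a + 1 → E a b
  ne : fnd ≠ 0 → ∀ b < n, mb b ≠ fnd
  vis_ne : fnd ≠ 0 → vis (fnd - 1) ≠ 0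
  par_lt : ∀ a < n, vis a ≠ 0 → par a < n
  par_edge : ∀ a < n, vis a ≠ 0 → E a (par a)
  chain : fnd ≠ 0 → ∀ a < n, vis a ≠ 0 → vis a ≤ vis (fnd - 1) →
    par a = r ∨ ∃ a' < n, mb (par a) = a' + 1 ∧ vis a' ≠ 0 ∧ vis a' < vis a
  free : ∀ b < n, b ≠ r → (mb b = 0 ↔ mb₀ b = 0)
  root : mb r = 0 ↔ fnd ≠ 0

/-- The pending agent takes over her parent object and its former partner becomes pending; if the
object was free, it is the root and the path is complete. The marks strictly decrease along the
path, so no agent recurs and the walk ends. -/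
theorem AugmentInv.step {n r : ℕ} {E : ℕ → ℕ → Prop} {mb₀ vis par ma mb : ℕ → ℕ} {fnd : ℕ}
    (h : AugmentInv n r E mb₀ vis par ma mb fnd) (hf : fnd ≠ 0) {x : ℕ}
    (hx : x = par (fnd - 1)) :
    AugmentInv n r E mb₀ vis par (Function.update ma (fnd - 1) (x + 1))
      (Function.update mb x (fnd - 1 + 1)) (mb x) ∧
    (mb x ≠ 0 → vis (mb x - 1) < vis (fnd - 1)) := by
  obtain ⟨a, rfl⟩ : ∃ a, fnd = a + 1 := ⟨fnd - 1, by omega⟩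
  simp only [Nat.add_sub_cancel] at *
  have ha : a < n := h.fnd_le
  have hva := h.vis_ne hf
  simp only [Nat.add_sub_cancel] at hva
  have hxn : x < n := hx ▸ h.par_lt a ha hva
  have hroot := h.root.2 hf
  have hEx := h.par_edge a ha hva
  rw [← hx] at hEx
  have hch := h.chain hf
  simp only [Nat.add_sub_cancel] at hch
  -- A matched parent object cannot be the root, which is free as long as an agent is pending.
  have hcase : mb x ≠ 0 → ∃ a' < n, mb x = a' + 1 ∧ vis a' ≠ 0 ∧ vis a' < vis a := by
    intro h0
    rcases hch a ha hva le_rfl with h1 | h1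
    · rw [← hx] at h1; rw [h1] at h0; exact absurd hroot h0
    · rw [← hx] at h1; exact h1
  have hne := h.ne hf
  refine ⟨?_, fun h0 => ?_⟩
  · constructor
    all_goals try simp only [Function.update_apply]
    · exact h.mb_le x hxn
    · intro a' ha'
      have := h.ma_le a' ha'
      grind
    · intro b hb
      have := h.mb_le b hb
      grind
    · intro a' ha' h1 b hb
      have h2 := h.iff a' ha'
      have h3 := hne b hb
      grind
    · intro a' ha' b hb
      have := h.edge a' ha' b hb
      split_ifs with e
      · intro e'
        obtain rfl : a = a' := by omega
        rwa [e]
      · exact this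
    · intro h0 b hb
      obtain ⟨a', ha', e, -, h2⟩ := hcase h0
      have h3 := h.iff a' ha' (by rintro e'; obtain rfl : a = a' := by omega
                                  omega)
      have h4 := h3 b hb
      have h5 := h3 x hxn
      split_ifs with e'
      · rintro e''
        obtain rfl : a = a' := by omega
        omega
      · omega
    · intro h0
      obtain ⟨a', ha', e, h1, h2⟩ := hcase h0
      rw [e]; exact h1
    · exact h.par_lt
    · exact h.par_edge
    · intro h0 a'' ha'' h1 h2
      obtain ⟨a', ha', e, h3, h4⟩ := hcase h0
      rw [e, Nat.add_sub_cancel] at h2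
      rcases hch a'' ha'' h1 (by omega) with h5 | ⟨k, hk, h5, h6, h7⟩
      · exact .inl h5
      · refine .inr ⟨k, hk, ?_, h6, h7⟩
        rw [if_neg]
        · exact h5
        · intro e'
          rw [e'] at h5
          obtain rfl : k = a' := by omega
          omega
    · intro b hb hbr
      have h1 := h.free b hb hbr
      split_ifs with e
      · subst e
        constructor
        · intro h2; grind
        · intro h2
          have h3 := h1.2 h2
          rcases hch a ha hva le_rfl with h4 | ⟨k, hk, h4, -⟩
          · rw [← hx] at h4; exact absurd h4 hbr
          · rw [← hx] at h4; omega
      · exact h1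
    · split_ifs with e
      · grind
      · simp only [hroot, true_iff]
        rcases hch a ha hva le_rfl with h4 | ⟨k, hk, h4, -⟩
        · rw [← hx] at h4; exact absurd h4.symm e
        · rw [← hx] at h4; omega
  · obtain ⟨a', ha', e, h1, h2⟩ := hcase h0
    rw [e]; exact h2

theorem AugmentInv.isMatching {n r : ℕ} {E : ℕ → ℕ → Prop} {mb₀ vis par ma mb : ℕ → ℕ}
    (h : AugmentInv n r E mb₀ vis par ma mb 0) : IsMatching n E ma mb :=
  ⟨fun a ha => h.ma_le a ha (by omega), h.mb_le, fun a ha => h.iff a ha (by omega), h.edge⟩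

/-- A parent object is a queue entry before the mark of its child: position `0` is the root, and any
other position is the mark of the agent matched to that entry. -/
theorem SearchInv.augmentInv {n r : ℕ} {adj ok : ℕ → ℕ → Prop} {ea st ma mb vis par qu : ℕ → ℕ}
    {hd tl i fnd : ℕ} (h : SearchInv n r adj ok ea st ma vis par qu hd tl i fnd)
    (hM : IsMatching n (fun a b => adj a b ∧ ok a b) ma mb) (hr : mb r = 0) (hf : fnd ≠ 0) :
    AugmentInv n r (fun a b => adj a b ∧ ok a b) mb vis par ma mb fnd := by
  obtain ⟨h1, h2, h3, h4⟩ := h.found hf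
  have hpl : ∀ a < n, vis a ≠ 0 → par a < n := by
    intro a ha hv
    obtain ⟨j, hj, e⟩ := h.par_qu a ha hv
    have := h.vis_le a ha
    exact e ▸ h.qu_lt j (by omega)
  refine ⟨by omega, fun a ha _ => hM.ma_le a ha, hM.mb_le, fun a ha _ => hM.iff a ha, hM.edge,
    fun _ b hb e => ?_, fun _ => h2, hpl, h.par_adj, fun _ a ha hv _ => ?_, fun _ _ _ => Iff.rfl, ?_⟩
  · have := (hM.iff (fnd - 1) h1 b hb).2 (by omega)
    omega
  · obtain ⟨j, hj, e⟩ := h.par_qu a ha hv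
    have hvl := h.vis_le a ha
    rcases Nat.eq_zero_or_pos j with rfl | hj0
    · exact .inl (by rw [← e, h.qu_zero])
    · obtain ⟨a', ha', e1, e2⟩ := h.mates j hj0 (by omega)
      refine .inr ⟨a', ha', ?_, by omega, by omega⟩
      rw [← e]
      exact (hM.iff a' ha' _ (h.qu_lt j (by omega))).1 e2
  · simp [hr, hf]

theorem freeCount_eq_succ {n r : ℕ} {mb mb' : ℕ → ℕ} (hr : r < n) (h0 : mb r = 0) (h1 : mb' r ≠ 0)
    (h : ∀ b < n, b ≠ r → (mb' b = 0 ↔ mb b = 0)) : freeCount n mb = freeCount n mb' + 1 := by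
  classical
  unfold freeCount
  have : (Finset.range n).filter (fun b => mb b = 0) =
      insert r ((Finset.range n).filter fun b => mb' b = 0) := by
    ext b
    simp only [Finset.mem_insert, Finset.mem_filter, Finset.mem_range]
    by_cases e : b = r
    · subst e; simp [hr, h0]
    · constructor
      · rintro ⟨h2, h3⟩; exact .inr ⟨h2, (h b h2 e).2 h3⟩
      · rintro (h2 | ⟨h2, h3⟩)
        · exact absurd h2 e
        · exact ⟨h2, (h b h2 e).1 h3⟩
  rw [this, Finset.card_insert_of_notMem (by simp [h1])]

/-- One step of the search for an augmenting path. -/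
def searchBody : Com :=
  .seq (.set .x (.get .qu (.var .hd))) <|
  .ite (.eq (.var .i) (.get .st (.suc (.var .x))))
    (.seq (.set .hd (.suc (.var .hd))) (.set .i (.get .st (.get .qu (.var .hd))))) <|
  .seq (.set .a (.get .ea (.var .i))) <| .seq (.set .i (.suc (.var .i))) <|
  .ite (.eq (.add (.reject (.var .a) (.var .x)) (.get .vis (.var .a))) .zero)
    (.seq (.put .vis (.var .a) (.var .tl)) <| .seq (.put .par (.var .a) (.var .x)) <|
      .ite (.eq (.get .ma (.var .a)) .zero)
        (.seq (.set .fnd (.suc (.var .a))) (.set .hd (.var .tl)))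
        (.seq (.put .qu (.var .tl) (.sub (.get .ma (.var .a)) .one))
          (.set .tl (.suc (.var .tl)))))
    .skip

/-- Erase the marks of the agents. -/
def clearBody : Com := .seq (.put .vis (.var .i) .zero) (.set .i (.suc (.var .i)))

/-- Prepare the search. -/
def searchInit : Com :=
  .seq (.put .qu .zero (.var .c)) <| .seq (.set .hd .zero) <| .seq (.set .tl .one) <|
    .seq (.set .fnd .zero) (.set .i (.get .st (.var .c)))

/-- Search for an augmenting path from the object `c`. -/
def search : Com :=
  .seq (.set .i .zero) <| .seq (.loop (.lt (.var .i) (.var .n)) clearBody) <|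
  .seq searchInit (.loop (.lt (.var .hd) (.var .tl)) searchBody)

/-- One step of the augmentation. -/
def augmentBody : Com :=
  .seq (.set .a (.sub (.var .fnd) .one)) <| .seq (.set .x (.get .par (.var .a))) <|
  .seq (.set .fnd (.get .mb (.var .x))) <| .seq (.put .ma (.var .a) (.suc (.var .x)))
    (.put .mb (.var .x) (.suc (.var .a)))

/-- Augment the matching. -/
def augment : Com := .loop (.lt .zero (.var .fnd)) augmentBody

/-! ### Searches, augmentations and their cost -/

theorem run_search {n m : ℕ} {σ : State} (hn : σ.v .n = n) (hc : σ.v .c < n)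
    (hE : EdgeList n m (adj σ.I n) (σ.r .ea) (σ.r .eb) (σ.r .st))
    (hM : IsMatching n (σ.Acc n) (σ.r .ma) (σ.r .mb)) (h0 : σ.r .mb (σ.v .c) = 0) :
    ∃ t σ', Run search σ t σ' ∧ (σ'.v .fnd = 0 → Stuck n (σ.Acc n) (σ.v .c)) ∧
      (σ'.v .fnd ≠ 0 → AugmentInv n (σ.v .c) (σ.Acc n) (σ.r .mb) (σ'.r .vis) (σ'.r .par) (σ.r .ma)
        (σ.r .mb) (σ'.v .fnd) ∧ σ'.r .vis (σ'.v .fnd - 1) ≤ n) ∧ t ≤ 200 * (m + 2 * n + 4) := by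
  have hr0 : Run (.set .i .zero) σ _ (σ.setv .i 0) := Run.set
  obtain ⟨t1, σ1, hr1, hF1, hI1, hb1, ht1⟩ := run_loop_den (σ := σ.setv .i 0)
    (b := .lt (.var .i) (.var .n)) (p := clearBody) (by simp [clearBody]) 200 (by simp [clearBody])
    (fun σ' => σ'.v .i ≤ n ∧ ∀ a < σ'.v .i, σ'.r .vis a = 0) (fun σ' => n - σ'.v .i) (by simp) (by
      intro σ' hF hI hb
      have hn' : σ'.v .n = n := (hF.v .n (by simp [clearBody])).trans (by simpa using hn)
      simp only [Cond.Holds, Expr.eval, hn'] at hb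
      simp only [clearBody, Com.den, Expr.eval, State.setv_v, State.setv_r, State.setr_v,
        State.setr_r, if_true]
      refine ⟨⟨by omega, fun a ha => ?_⟩, by omega⟩
      simp only [Function.update_apply]
      split_ifs with e
      · rfl
      · exact hI.2 a (by omega))
  have hn1 : σ1.v .n = n := (hF1.v .n (by simp [clearBody])).trans (by simpa using hn)
  have hi1 : σ1.v .i = n := by
    simp only [Cond.Holds, Expr.eval, hn1] at hb1
    omega
  have hc1 : σ1.v .c = σ.v .c := (hF1.v .c (by simp [clearBody])).trans (by simp)
  have hvis := hI1.2
  rw [hi1] at hvis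
  obtain ⟨t2, hr2, ht2⟩ := Com.LoopFree.run (p := searchInit) (by simp [searchInit]) σ1
  have hF2 := hr2.frame
  set σ2 := searchInit.den σ1 with hσ2
  set r := σ.v .c with hrdef
  have key (j : Arr) (h1 : clearBody.KeepsArr j) (h2 : searchInit.KeepsArr j) : σ2.r j = σ.r j :=
    (hF2.r j h2).trans (hF1.r j h1)
  have hea := key .ea (by simp [clearBody]) (by simp [searchInit])
  have heb := key .eb (by simp [clearBody]) (by simp [searchInit])
  have hst := key .st (by simp [clearBody]) (by simp [searchInit])
  have hcnt := key .cnt (by simp [clearBody]) (by simp [searchInit])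
  have hfa := key .fa (by simp [clearBody]) (by simp [searchInit])
  have hld := key .ld (by simp [clearBody]) (by simp [searchInit])
  have hma := key .ma (by simp [clearBody]) (by simp [searchInit])
  have hmb := key .mb (by simp [clearBody]) (by simp [searchInit])
  have hI2 : σ2.I = σ.I := hF2.I.trans hF1.I
  have hn2 : σ2.v .n = n := (hF2.v .n (by simp [searchInit])).trans hn1
  have hvis2 : ∀ a < n, σ2.r .vis a = 0 := fun a ha => by
    rw [hF2.r .vis (by simp [searchInit])]; exact hvis a ha
  have hst1 : σ1.r .st = σ.r .st := hF1.r .st (by simp [clearBody])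
  have hhd : σ2.v .hd = 0 := by simp [hσ2, searchInit]
  have htl : σ2.v .tl = 1 := by simp [hσ2, searchInit]
  have hfnd : σ2.v .fnd = 0 := by simp [hσ2, searchInit]
  have hi2 : σ2.v .i = σ.r .st r := by simp [hσ2, searchInit, hc1, hst1]
  have hqu : σ2.r .qu 0 = r := by simp [hσ2, searchInit, hc1]
  have hmono : ∀ b < n, σ.r .st b ≤ σ.r .st (b + 1) := fun b hb => hE.mono _ _ (by omega) hb
  obtain ⟨t3, σ3, hr3, hF3, hI3, hb3, ht3⟩ := run_loop_den (σ := σ2)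
    (b := .lt (.var .hd) (.var .tl)) (p := searchBody) (by simp [searchBody]) 200
    (by simp [searchBody])
    (fun σ' => SearchInv n r (adj σ.I n) (σ.Ok n) (σ.r .ea) (σ.r .st) (σ.r .ma) (σ'.r .vis)
      (σ'.r .par) (σ'.r .qu) (σ'.v .hd) (σ'.v .tl) (σ'.v .i) (σ'.v .fnd))
    (fun σ' => SearchInv.pot n (σ.r .st) (σ'.r .qu) (σ'.v .hd) (σ'.v .i) (σ'.v .fnd)) (by
      rw [hhd, htl, hfnd, hi2]
      constructor
      · omega
      · omega
      · exact hqu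
      · intro j hj; obtain rfl : j = 0 := by omega
        rw [hqu]; exact hc
      · intro a ha; rw [hvis2 a ha]; omega
      · intro a ha h; exact absurd (hvis2 a ha) h
      · intro a ha h; exact absurd (hvis2 a ha) h
      · intro a ha h; exact absurd (hvis2 a ha) h
      · intro j h1 h2; omega
      · intro _ j hj; omega
      · intro _ _; rw [hqu]
      · intro _ _; rw [hqu]; exact hmono _ hc
      · intro _ _ i' h1 h2; rw [hqu] at h1; omega
      · intro h; exact absurd rfl h) (by
      intro σ' hF hI hb
      have hn' : σ'.v .n = n := (hF.v .n (by simp [searchBody])).trans hn2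
      have hea' : σ'.r .ea = σ.r .ea := (hF.r .ea (by simp [searchBody])).trans hea
      have hst' : σ'.r .st = σ.r .st := (hF.r .st (by simp [searchBody])).trans hst
      have hcnt' : σ'.r .cnt = σ.r .cnt := (hF.r .cnt (by simp [searchBody])).trans hcnt
      have hfa' : σ'.r .fa = σ.r .fa := (hF.r .fa (by simp [searchBody])).trans hfa
      have hld' : σ'.r .ld = σ.r .ld := (hF.r .ld (by simp [searchBody])).trans hld
      have hma' : σ'.r .ma = σ.r .ma := (hF.r .ma (by simp [searchBody])).trans hma
      simp only [Cond.Holds, Expr.eval] at hb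
      simp only [searchBody, Com.den, Cond.Holds, Expr.eval, hn', hea', hst', hcnt', hfa', hld',
        hma', State.setv_v, State.setv_r, State.setr_v, State.setr_r, reduceCtorEq, if_true,
        if_false]
      by_cases h1 : σ'.v .i = σ.r .st (σ'.r .qu (σ'.v .hd) + 1)
      · rw [if_pos h1]
        simpa using hI.next hM h0 hmono hb h1
      rw [if_neg h1]
      have hf := hI.fnd_eq hb
      have h2 := hI.st_le hf hb
      have h3 := hI.le_st hf hb
      obtain ⟨him, hib⟩ := hE.eb_eq (hI.qu_lt _ hb) h2 (by omega)
      have han := hE.ea_lt _ him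
      have hadj := hE.isAdj _ him
      rw [hib] at hadj
      by_cases h4 : σ.r .cnt (σ.r .ea (σ'.v .i) * n + σ'.r .qu (σ'.v .hd)) +
          (σ.r .fa (σ.r .ea (σ'.v .i)) - σ.r .ld (σ.r .ea (σ'.v .i) * n + σ'.r .qu (σ'.v .hd))) +
          σ'.r .vis (σ.r .ea (σ'.v .i)) = 0
      · rw [if_pos h4]
        have hok : σ.Ok n (σ.r .ea (σ'.v .i)) (σ'.r .qu (σ'.v .hd)) := by unfold State.Ok; omega
        have hvz : σ'.r .vis (σ.r .ea (σ'.v .i)) = 0 := by omega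
        by_cases h5 : σ.r .ma (σ.r .ea (σ'.v .i)) = 0
        · rw [if_pos h5]
          refine ⟨by simpa using hI.finish hb han hadj hok hvz h5, ?_⟩
          simp [SearchInv.pot, hf]
        · rw [if_neg h5]
          refine ⟨by simpa using hI.push hM hb h1 han hadj hok hvz h5, ?_⟩
          simpa using hI.pot_push hM h0 hb _
      · rw [if_neg h4]
        refine ⟨by simpa using hI.skip hb h1 (fun h5 h6 => h4 (by unfold State.Ok at h5; omega)), ?_⟩
        simpa using hI.pot_succ hM h0 hb)
  have hb3' : ¬ σ3.v .hd < σ3.v .tl := by simpa using hb3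
  -- Every edge and every object is paid for once; the extra unit lets the potential drop to `0`
  -- when a free agent is found.
  have hpot : SearchInv.pot n (σ.r .st) (σ2.r .qu) (σ2.v .hd) (σ2.v .i) (σ2.v .fnd) =
      m + n + 1 := by
    rw [hhd, hfnd, hi2, SearchInv.pot, if_pos rfl, hqu, Finset.sum_add_distrib, hE.sum_degree]
    simp
  rw [hpot] at ht3
  refine ⟨_, σ3, .seq hr0 (.seq hr1 (.seq hr2 hr3)), fun hf => ?_, fun hf => ⟨?_, ?_⟩, ?_⟩
  · rw [hf] at hI3
    exact hI3.stuck hE hM h0 hb3'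
  · exact hI3.augmentInv hM h0 hf
  · have h1 := hI3.vis_le _ (hI3.found hf).1
    have h2 := hI3.tl_le hM h0
    omega
  · simp only [State.setv_v, if_true, Nat.sub_zero] at ht1
    simp only [searchInit, Com.cost, Expr.cost] at ht2
    simp only [Expr.cost]
    omega

theorem run_augment {n r : ℕ} {E : ℕ → ℕ → Prop} {mb₀ : ℕ → ℕ} {σ : State}
    (h : AugmentInv n r E mb₀ (σ.r .vis) (σ.r .par) (σ.r .ma) (σ.r .mb) (σ.v .fnd))
    (hv : σ.r .vis (σ.v .fnd - 1) ≤ n) :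
    ∃ t σ', Run augment σ t σ' ∧ IsMatching n E (σ'.r .ma) (σ'.r .mb) ∧ σ'.r .mb r ≠ 0 ∧
      (∀ b < n, b ≠ r → (σ'.r .mb b = 0 ↔ mb₀ b = 0)) ∧ t ≤ 200 * (n + 1) := by
  obtain ⟨t1, σ1, hr1, hF1, hI1, hb1, ht1⟩ := run_loop_den (σ := σ)
    (b := .lt .zero (.var .fnd)) (p := augmentBody) (by simp [augmentBody]) 200
    (by simp [augmentBody])
    (fun σ' => AugmentInv n r E mb₀ (σ.r .vis) (σ.r .par) (σ'.r .ma) (σ'.r .mb) (σ'.v .fnd))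
    (fun σ' => if σ'.v .fnd = 0 then 0 else σ.r .vis (σ'.v .fnd - 1)) h (by
      intro σ' hF hI hb
      have hpar : σ'.r .par = σ.r .par := hF.r .par (by simp [augmentBody])
      simp only [Cond.Holds, Expr.eval] at hb
      obtain ⟨h1, h2⟩ := hI.step (by omega) rfl
      have h3 := hI.vis_ne (by omega)
      simp only [augmentBody, Com.den, Expr.eval, State.setv_v, State.setv_r, State.setr_v,
        State.setr_r, reduceCtorEq, if_true, if_false, hpar, Nat.zero_add]
      refine ⟨h1, ?_⟩
      rw [if_neg (show ¬ σ'.v .fnd = 0 by omega)]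
      split_ifs with h4
      · omega
      · exact h2 h4)
  have hf : σ1.v .fnd = 0 := by simpa using hb1
  have hI' := hI1
  rw [hf] at hI'
  refine ⟨t1, σ1, hr1, hI'.isMatching, fun h0 => ?_, hI'.free, ?_⟩
  · exact hI'.root.1 h0 rfl
  · have : (if σ.v .fnd = 0 then 0 else σ.r .vis (σ.v .fnd - 1)) ≤ n := by split_ifs <;> omega
    exact ht1.trans (Nat.mul_le_mul_left _ (by omega))

/-- Either move to the next object, or search for an augmenting path from a free object. -/
def phaseBody : Com :=
  .ite (.lt .zero (.get .mb (.var .c))) (.set .c (.suc (.var .c))) <|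
  .seq search <|
  .ite (.eq (.var .fnd) .zero)
    (.seq (.set .flag .zero) <| .seq (.set .y (.var .c)) (.set .c (.var .n)))
    (.seq augment (.set .c (.suc (.var .c))))

/-- Complete the matching (`flag = 1`) or find an object from which no augmenting path starts. -/
def phase : Com :=
  .seq (.seq (.set .c .zero) (.set .flag .one)) (.loop (.lt (.var .c) (.var .n)) phaseBody)

/-- Each successful search reduces the number of free objects, which can happen at most `D` times,
and the first failed search ends the phase. -/
theorem run_phase {n m D : ℕ} {σ : State} (hn : σ.v .n = n)
    (hE : EdgeList n m (adj σ.I n) (σ.r .ea) (σ.r .eb) (σ.r .st))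
    (hM : IsMatching n (σ.Acc n) (σ.r .ma) (σ.r .mb))
    (hD : ∀ ma mb, IsMatching n (σ.Acc n) ma mb → freeCount n (σ.r .mb) ≤ freeCount n mb + D) :
    ∃ t σ', Run phase σ t σ' ∧
      (σ'.v .flag = 1 → IsMatching n (σ.Acc n) (σ'.r .ma) (σ'.r .mb) ∧
        ∀ b < n, σ'.r .mb b ≠ 0) ∧
      (σ'.v .flag ≠ 1 → σ'.v .flag = 0 ∧ σ'.v .y < n ∧ Stuck n (σ.Acc n) (σ'.v .y)) ∧
      t ≤ 500 * ((m + 2 * n + 4) * (D + 2)) := by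
  set S := 200 * (m + 2 * n + 4) + 200 * (n + 1) + 50 with hS
  -- `F` is a lower bound for the number of free objects in every matching of accepted edges, so the
  -- difference in the potential below is never truncated.
  set F := freeCount n (σ.r .mb) - D with hFdef
  have hFle : ∀ ma mb, IsMatching n (σ.Acc n) ma mb → F ≤ freeCount n mb := fun ma mb h => by
    have := hD ma mb h; omega
  have hr0 : Run (.seq (.set .c .zero) (.set .flag .one)) σ _
    ((σ.setv .c 0).setv .flag 1) := .seq .set .set
  set σ0 := (σ.setv .c 0).setv .flag 1 with hσ0
  have hn0 : σ0.v .n = n := by simpa [hσ0] using hn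
  obtain ⟨t1, σ1, hr1, hF1, hI1, hb1, ht1⟩ := run_loop (σ := σ0)
    (b := .lt (.var .c) (.var .n)) (p := phaseBody)
    (fun σ' => σ'.v .c ≤ n ∧ IsMatching n (σ.Acc n) (σ'.r .ma) (σ'.r .mb) ∧
      (σ'.v .flag = 1 ∧ (∀ b < σ'.v .c, σ'.r .mb b ≠ 0) ∨
        σ'.v .flag = 0 ∧ σ'.v .c = n ∧ σ'.v .y < n ∧ Stuck n (σ.Acc n) (σ'.v .y)))
    -- `S` bounds one search with its augmentation. An augmentation is paid for by the drop in the
    -- number of free objects, the single failed search by `flag` falling from `1` to `0`.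
    (fun σ' => 30 * (n - σ'.v .c) + S * (freeCount n (σ'.r .mb) - F + σ'.v .flag))
    ⟨by simp [hσ0], hM, .inl ⟨by simp [hσ0], by simp [hσ0]⟩⟩ (by
      intro σ' hF hI hb
      obtain ⟨hcn, hM', hfl⟩ := hI
      have hn' : σ'.v .n = n := (hF.v .n (by simp [phaseBody, search, searchInit, searchBody,
        clearBody, augment, augmentBody])).trans hn0
      have key (j : Arr) (h1 : phaseBody.KeepsArr j) : σ'.r j = σ.r j := hF.r j h1
      have hea := key .ea (by simp [phaseBody, search, searchInit, searchBody,
        clearBody, augment, augmentBody])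
      have heb := key .eb (by simp [phaseBody, search, searchInit, searchBody,
        clearBody, augment, augmentBody])
      have hst := key .st (by simp [phaseBody, search, searchInit, searchBody,
        clearBody, augment, augmentBody])
      have hcnt := key .cnt (by simp [phaseBody, search, searchInit, searchBody,
        clearBody, augment, augmentBody])
      have hfa := key .fa (by simp [phaseBody, search, searchInit, searchBody,
        clearBody, augment, augmentBody])
      have hld := key .ld (by simp [phaseBody, search, searchInit, searchBody,
        clearBody, augment, augmentBody])
      have hIn : σ'.I = σ.I := hF.I
      have hAcc : σ'.Acc n = σ.Acc n := by
        funext a b; simp only [State.Acc, State.Ok, hcnt, hfa, hld, hIn]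
      simp only [Cond.Holds, Expr.eval, hn'] at hb
      obtain ⟨hf1, hfree⟩ : σ'.v .flag = 1 ∧ (∀ b < σ'.v .c, σ'.r .mb b ≠ 0) := by
        rcases hfl with h | h
        · exact h
        · omega
      by_cases h1 : 0 < σ'.r .mb (σ'.v .c)
      · refine ⟨_, _, .ite_true (by simpa using h1) .set, ⟨?_, ?_, ?_⟩, ?_⟩
        · simp; omega
        · simpa using hM'
        · refine .inl ⟨by simpa using hf1, fun b hb' => ?_⟩
          simp only [Expr.eval, State.setv_v, if_true, State.setv_r] at hb' ⊢
          rcases Nat.lt_succ_iff_lt_or_eq.1 hb' with hb' | rfl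
          · exact hfree b hb'
          · omega
        · simp
          omega
      · have h0 : σ'.r .mb (σ'.v .c) = 0 := by omega
        obtain ⟨t2, σ2, hr2, hs2, hg2, ht2⟩ := run_search hn' hb (by rw [hIn, hea, heb, hst]; exact hE)
          (by rw [hAcc]; exact hM') h0
        have hF2 := hr2.frame
        rw [hAcc] at hs2 hg2
        have hma2 : σ2.r .ma = σ'.r .ma := hF2.r .ma (by simp [search, searchInit, searchBody,
          clearBody])
        have hmb2 : σ2.r .mb = σ'.r .mb := hF2.r .mb (by simp [search, searchInit, searchBody,
          clearBody])
        have hc2 : σ2.v .c = σ'.v .c := hF2.v .c (by simp [search, searchInit, searchBody,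
          clearBody])
        have hn2 : σ2.v .n = n := (hF2.v .n (by simp [search, searchInit, searchBody,
          clearBody])).trans hn'
        have hfl2 : σ2.v .flag = 1 := (hF2.v .flag (by simp [search, searchInit, searchBody,
          clearBody])).trans hf1
        have h1' : ¬ (Cond.lt .zero (.get .mb (.var .c))).Holds σ' := by simpa using h1
        by_cases h2 : σ2.v .fnd = 0
        · refine ⟨_, _, .ite_false h1' (.seq hr2 (.ite_true (by simpa using h2)
            (.seq .set (.seq .set .set)))), ⟨?_, ?_, ?_⟩, ?_⟩
          · simp [hn2]
          · simpa [hma2, hmb2] using hM'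
          · refine .inr ⟨by simp, by simp [hn2], ?_, ?_⟩
            · simpa [hc2] using hb
            · simpa [hc2] using hs2 h2
          · simp [hmb2, hn2, hf1]
            rw [Nat.mul_add]
            omega
        · obtain ⟨hg, hgv⟩ := hg2 h2
          obtain ⟨t3, σ3, hr3, hM3, hmbr, hfr, ht3⟩ := run_augment (σ := σ2)
            (by rw [hma2, hmb2]; exact hg) hgv
          have hF3 := hr3.frame
          have hc3 : σ3.v .c = σ'.v .c := (hF3.v .c (by simp [augment, augmentBody])).trans hc2
          have hfl3 : σ3.v .flag = 1 := (hF3.v .flag (by simp [augment, augmentBody])).trans hfl2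
          have hcount := freeCount_eq_succ hb h0 hmbr hfr
          have hFle3 := hFle _ _ hM3
          refine ⟨_, _, .ite_false h1' (.seq hr2 (.ite_false (by simpa using h2)
            (.seq hr3 .set))), ⟨?_, ?_, ?_⟩, ?_⟩
          · simp [hc3]; omega
          · simpa using hM3
          · refine .inl ⟨by simpa using hfl3, fun b hb' => ?_⟩
            simp only [Expr.eval, State.setv_v, if_true, State.setv_r, hc3] at hb' ⊢
            rcases Nat.lt_succ_iff_lt_or_eq.1 hb' with hb' | rfl
            · rw [Ne, hfr b (by omega) (by omega)]
              exact hfree b hb'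
            · exact hmbr
          · simp [hc3, hfl3, hf1]
            have : freeCount n (σ'.r .mb) - F + 1 = (freeCount n (σ3.r .mb) - F + 1) + 1 := by omega
            have hmul : S * (freeCount n (σ3.r .mb) - F + 1 + 1) =
                S * (freeCount n (σ3.r .mb) - F + 1) + S := Nat.mul_succ _ _
            rw [this, hmul]
            omega)
  have hn1 : σ1.v .n = n := (hF1.v .n (by simp [phaseBody, search, searchInit, searchBody,
    clearBody, augment, augmentBody])).trans hn0
  have hc1 : σ1.v .c = n := by
    simp only [Cond.Holds, Expr.eval, hn1] at hb1
    omega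
  obtain ⟨-, hM1, hfl⟩ := hI1
  refine ⟨_, σ1, .seq hr0 hr1, fun h => ⟨hM1, ?_⟩, fun h => ?_, ?_⟩
  · rcases hfl with h1 | h1
    · rw [hc1] at h1; exact h1.2
    · omega
  · rcases hfl with h1 | h1
    · exact absurd h1.1 h
    · exact ⟨h1.1, h1.2.2⟩
  · have h1 : freeCount n (σ0.r .mb) - F + σ0.v .flag ≤ D + 1 := by
      have : σ0.v .flag = 1 := by simp [hσ0]
      have : σ0.r .mb = σ.r .mb := rfl
      rw [this]; omega
    have h2 : σ0.v .c = 0 := by simp [hσ0]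
    have h3 := Nat.mul_le_mul_left S h1
    rw [h2] at ht1
    have h4 : S ≤ 400 * (m + 2 * n + 4) := by omega
    have h5 := Nat.mul_le_mul_right (D + 1) h4
    rw [mul_assoc] at h5
    have h6 : (m + 2 * n + 4) * (D + 2) = (m + 2 * n + 4) * (D + 1) + (m + 2 * n + 4) := by ring
    simp only [Expr.cost, Cond.cost] at ht1 ⊢
    rw [h6]
    omega

/-! ### Counting violations -/

open Classical in
/-- The number of `b < n` with a property. -/
noncomputable def count (n : ℕ) (P : ℕ → Prop) : ℕ := ((Finset.range n).filter P).card

theorem count_congr {n : ℕ} {P Q : ℕ → Prop} (h : ∀ b < n, (P b ↔ Q b)) : count n P = count n Q := by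
  classical
  unfold count
  congr 1
  ext b
  simp only [Finset.mem_filter, Finset.mem_range]
  constructor
  · rintro ⟨h1, h2⟩; exact ⟨h1, (h b h1).1 h2⟩
  · rintro ⟨h1, h2⟩; exact ⟨h1, (h b h1).2 h2⟩

theorem count_succ {n b₀ : ℕ} {P Q : ℕ → Prop} (hb₀ : b₀ < n) (hP : ¬ P b₀) (hQ : Q b₀)
    (h : ∀ b < n, b ≠ b₀ → (P b ↔ Q b)) : count n Q = count n P + 1 := by
  classical
  unfold count
  have : (Finset.range n).filter Q = insert b₀ ((Finset.range n).filter P) := by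
    ext b
    simp only [Finset.mem_insert, Finset.mem_filter, Finset.mem_range]
    by_cases e : b = b₀
    · subst e; simp [hb₀, hQ]
    · constructor
      · rintro ⟨h2, h3⟩; exact .inr ⟨h2, (h b h2 e).2 h3⟩
      · rintro (h2 | ⟨h2, h3⟩)
        · exact absurd h2 e
        · exact ⟨h2, (h b h2 e).1 h3⟩
  rw [this, Finset.card_insert_of_notMem (by simp [hP])]

theorem count_eq_zero {n : ℕ} {P : ℕ → Prop} : count n P = 0 ↔ ∀ b < n, ¬ P b := by
  classical
  unfold count
  rw [Finset.card_eq_zero, Finset.filter_eq_empty_iff]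
  simp

theorem count_range_succ (P : ℕ → Prop) [DecidablePred P] (k : ℕ) :
    count (k + 1) P = count k P + if P k then 1 else 0 := by
  classical
  unfold count
  rw [Finset.range_add_one, Finset.filter_insert]
  split_ifs with h
  · rw [Finset.card_insert_of_notMem (by simp)]
  · rfl

/-! ### Counters under a change of one level -/

theorem cell_inj {n a x a' x' : ℕ} (hx : x < n) (hx' : x' < n) :
    a * n + x = a' * n + x' ↔ a = a' ∧ x = x' := by
  constructor
  · intro h
    have h1 : (a * n + x) / n = a := by
      rw [mul_comm, Nat.mul_add_div (by omega), Nat.div_eq_of_lt hx, add_zero]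
    have h2 : (a' * n + x') / n = a' := by
      rw [mul_comm, Nat.mul_add_div (by omega), Nat.div_eq_of_lt hx', add_zero]
    have : a = a' := by rw [← h1, ← h2, h]
    subst this
    omega
  · rintro ⟨rfl, rfl⟩; rfl

/-- The instance with loads that is stored in a state. -/
def State.loaded (σ : State) (n : ℕ) : Loaded where
  n := n
  adj := Imp.adj σ.I n
  pf := Imp.pf σ.I n
  ld a x := σ.r .ld (a * n + x)
  fa := σ.r .fa

/-- The counters hold the numbers of violations at levels `l`. -/
def CountOk (G : Loaded) (l cnt : ℕ → ℕ) : Prop :=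
  ∀ a < G.n, ∀ x < G.n, G.adj a x →
    cnt (a * G.n + x) = count G.n fun b => G.adj a b ∧ G.Viol l a x b

/-- One of the edges before position `i` in the edge list joins `a` and `x`. -/
def Seen (ea eb : ℕ → ℕ) (i a x : ℕ) : Prop := ∃ j < i, ea j = a ∧ eb j = x

theorem seen_succ {ea eb : ℕ → ℕ} {i a x : ℕ} :
    Seen ea eb (i + 1) a x ↔ Seen ea eb i a x ∨ ea i = a ∧ eb i = x := by
  constructor
  · rintro ⟨j, hj, h⟩
    rcases Nat.lt_succ_iff_lt_or_eq.1 hj with hj | rfl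
    · exact .inl ⟨j, hj, h⟩
    · exact .inr h
  · rintro (⟨j, hj, h⟩ | h)
    · exact ⟨j, by omega, h⟩
    · exact ⟨i, by omega, h⟩

/-- The violations that are counted when the level of `y` is being raised and the edges before
position `i` have been treated. -/
def RaiseViol (G : Loaded) (l ea eb : ℕ → ℕ) (y i a x b : ℕ) : Prop :=
  (b = y ∧ Seen ea eb i a x ∨ x = y ∧ Seen ea eb i a b) ∧
      G.Viol (Function.update l y (l y + 1)) a x b ∨
    ¬ (b = y ∧ Seen ea eb i a x ∨ x = y ∧ Seen ea eb i a b) ∧ G.Viol l a x b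

/-- The invariant of the update of the counters. -/
def RaiseInv (G : Loaded) (l ea eb : ℕ → ℕ) (y i : ℕ) (cnt : ℕ → ℕ) : Prop :=
  ∀ a < G.n, ∀ x < G.n, G.adj a x →
    cnt (a * G.n + x) = count G.n fun b => G.adj a b ∧ RaiseViol G l ea eb y i a x b

theorem CountOk.raiseInv {G : Loaded} {l cnt ea eb : ℕ → ℕ} (h : CountOk G l cnt) (y : ℕ) :
    RaiseInv G l ea eb y 0 cnt := by
  intro a ha x hx hax
  rw [h a ha x hx hax]
  exact count_congr fun b _ => by simp [RaiseViol, Seen]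

theorem not_viol_self (G : Loaded) (l : ℕ → ℕ) (a x : ℕ) : ¬ G.Viol l a x x := by
  unfold Loaded.Viol; omega

/-- Once all edges have been treated, every pair that involves `y` is evaluated at the new level;
the other pairs do not depend on it. -/
theorem RaiseInv.countOk {G : Loaded} {m y : ℕ} {l cnt ea eb st : ℕ → ℕ}
    (hE : EdgeList G.n m G.adj ea eb st) (h : RaiseInv G l ea eb y m cnt) :
    CountOk G (Function.update l y (l y + 1)) cnt := by
  intro a ha x hx hax
  rw [h a ha x hx hax]
  refine count_congr fun b hb => and_congr_right fun hab => ?_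
  have s1 : Seen ea eb m a x := hE.surj a ha x hx hax
  have s2 : Seen ea eb m a b := hE.surj a ha b hb hab
  simp only [RaiseViol, s1, s2, and_true]
  by_cases e : b = y ∨ x = y
  · simp [e]
  · have e1 : b ≠ y := fun h => e (.inl h)
    have e2 : x ≠ y := fun h => e (.inr h)
    simp [e1, e2, Loaded.Viol]

theorem EdgeList.not_seen {n m : ℕ} {adj : ℕ → ℕ → Prop} {ea eb st : ℕ → ℕ}
    (hE : EdgeList n m adj ea eb st) {i : ℕ} (hi : i < m) : ¬ Seen ea eb i (ea i) (eb i) := by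
  rintro ⟨j, hj, e1, e2⟩
  have := hE.inj j i hj hi e2
  omega

/-- Nothing changes at an edge of `y` itself, since no object makes an agent reject that same
object, nor at an edge of an agent who is not adjacent to `y`. -/
theorem RaiseInv.skip {G : Loaded} {y i : ℕ} {l cnt ea eb : ℕ → ℕ}
    (h : RaiseInv G l ea eb y i cnt) (hy : eb i = y ∨ ¬ G.adj (ea i) y) :
    RaiseInv G l ea eb y (i + 1) cnt := by
  intro a ha x hx hax
  rw [h a ha x hx hax]
  refine count_congr fun b hb => and_congr_right fun hab => ?_
  have v1 := not_viol_self G l a x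
  have v2 := not_viol_self G (Function.update l y (l y + 1)) a x
  unfold RaiseViol
  rw [seen_succ, seen_succ]
  by_cases e : b = y ∧ (ea i = a ∧ eb i = x) ∨ x = y ∧ (ea i = a ∧ eb i = b)
  · have hbx : b = x := by
      rcases e with ⟨rfl, rfl, rfl⟩ | ⟨rfl, rfl, rfl⟩
      · rcases hy with hy | hy
        · exact hy.symm
        · exact absurd hab hy
      · rcases hy with hy | hy
        · exact hy
        · exact absurd hax hy
    subst hbx
    simp [v1, v2]
  · have : (b = y ∧ (Seen ea eb i a x ∨ ea i = a ∧ eb i = x) ∨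
        x = y ∧ (Seen ea eb i a b ∨ ea i = a ∧ eb i = b)) ↔
        (b = y ∧ Seen ea eb i a x ∨ x = y ∧ Seen ea eb i a b) := by tauto
    rw [this]

/-- The level of `y` rises by exactly one. So `y` starts to violate the edge to `eb i` only if the
two sides were equal, and `eb i` ceases to violate the edge to `y` only if it did so by exactly one.
At most two counters change for each treated edge. -/
theorem RaiseInv.step {G : Loaded} {m y i : ℕ} {l cnt cnt' ea eb st : ℕ → ℕ}
    (hE : EdgeList G.n m G.adj ea eb st) (h : RaiseInv G l ea eb y i cnt) (hi : i < m)
    (hyn : y < G.n) (hy : eb i ≠ y) (hadj : G.adj (ea i) y)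
    (h1 : cnt' (ea i * G.n + eb i) = cnt (ea i * G.n + eb i) +
      if l (eb i) + G.ld (ea i) (eb i) + G.pf (ea i) (eb i) y = l y + G.pf (ea i) y (eb i)
        then 1 else 0)
    (h2 : cnt' (ea i * G.n + y) = cnt (ea i * G.n + y) -
      if l y + G.ld (ea i) y + G.pf (ea i) y (eb i) + 1 = l (eb i) + G.pf (ea i) (eb i) y
        then 1 else 0)
    (h3 : ∀ a < G.n, ∀ x < G.n, ¬ (a = ea i ∧ (x = eb i ∨ x = y)) →
      cnt' (a * G.n + x) = cnt (a * G.n + x)) :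
    RaiseInv G l ea eb y (i + 1) cnt' := by
  have hns := hE.not_seen hi
  have hea := hE.ea_lt i hi
  have heb := hE.eb_lt i hi
  have hadj' := hE.isAdj i hi
  intro a ha x hx hax
  -- the status of a pair `(x, b)` changes only if `{x, b} = {eb i, y}` and `a = ea i`
  have same (b : ℕ) (hb : ¬ (ea i = a ∧ (b = y ∧ eb i = x ∨ x = y ∧ eb i = b))) :
      RaiseViol G l ea eb y i a x b ↔ RaiseViol G l ea eb y (i + 1) a x b := by
    unfold RaiseViol
    rw [seen_succ, seen_succ]
    have : (b = y ∧ (Seen ea eb i a x ∨ ea i = a ∧ eb i = x) ∨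
        x = y ∧ (Seen ea eb i a b ∨ ea i = a ∧ eb i = b)) ↔
        (b = y ∧ Seen ea eb i a x ∨ x = y ∧ Seen ea eb i a b) := by tauto
    rw [this]
  by_cases c1 : a = ea i ∧ x = eb i
  · obtain ⟨rfl, rfl⟩ := c1
    rw [h1, h _ ha _ hx hax]
    have old : RaiseViol G l ea eb y i (ea i) (eb i) y ↔ G.Viol l (ea i) (eb i) y := by
      simp [RaiseViol, hns, hy]
    have new : RaiseViol G l ea eb y (i + 1) (ea i) (eb i) y ↔
        G.Viol (Function.update l y (l y + 1)) (ea i) (eb i) y := by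
      simp [RaiseViol, seen_succ]
    simp only [Loaded.Viol, Function.update_self, Function.update_of_ne hy] at old new
    split_ifs with hc
    · refine (count_succ hyn ?_ ?_ fun b hb hby => and_congr_right fun _ => same b ?_).symm
      · rw [old]; omega
      · rw [new]; exact ⟨hadj, by omega⟩
      · rintro ⟨-, ⟨h, -⟩ | ⟨h, -⟩⟩
        exacts [hby h, hy h]
    · refine count_congr fun b hb => and_congr_right fun _ => ?_
      by_cases hby : b = y
      · subst hby; rw [old, new]; omega
      · refine same b ?_
        rintro ⟨-, ⟨h, -⟩ | ⟨h, -⟩⟩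
        exacts [hby h, hy h]
  by_cases c2 : a = ea i ∧ x = y
  · obtain ⟨rfl, rfl⟩ := c2
    rw [h2, h _ ha _ hx hax]
    have hy' := hy.symm
    have old : RaiseViol G l ea eb x i (ea i) x (eb i) ↔ G.Viol l (ea i) x (eb i) := by
      simp [RaiseViol, hns, hy]
    have new : RaiseViol G l ea eb x (i + 1) (ea i) x (eb i) ↔
        G.Viol (Function.update l x (l x + 1)) (ea i) x (eb i) := by
      simp [RaiseViol, seen_succ]
    simp only [Loaded.Viol, Function.update_self, Function.update_of_ne hy] at old new
    split_ifs with hc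
    · have := count_succ (P := fun b => G.adj (ea i) b ∧ RaiseViol G l ea eb x (i + 1) (ea i) x b)
        (Q := fun b => G.adj (ea i) b ∧ RaiseViol G l ea eb x i (ea i) x b) heb (by rw [new]; omega)
        ⟨hadj', by rw [old]; omega⟩
        (fun b hb hby => and_congr_right fun _ => (same b (by
          rintro ⟨-, ⟨-, h⟩ | ⟨-, h⟩⟩
          exacts [hy h, hby h.symm])).symm)
      omega
    · refine count_congr fun b hb => and_congr_right fun _ => ?_
      by_cases hby : b = eb i
      · subst hby; rw [old, new]; omega
      · refine same b ?_
        rintro ⟨-, ⟨-, h⟩ | ⟨-, h⟩⟩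
        exacts [hy h, hby h.symm]
  · have c3 : ¬ (a = ea i ∧ (x = eb i ∨ x = y)) := by
      rintro ⟨e, e' | e'⟩
      exacts [c1 ⟨e, e'⟩, c2 ⟨e, e'⟩]
    rw [h3 a ha x hx c3, h a ha x hx hax]
    refine count_congr fun b hb => and_congr_right fun _ => same b ?_
    rintro ⟨rfl, ⟨-, rfl⟩ | ⟨rfl, -⟩⟩
    · exact c1 ⟨rfl, rfl⟩
    · exact c2 ⟨rfl, rfl⟩

/-- Update the counters at the edge `i` when the level of `y` is raised. -/
def raiseBody : Com :=
  .seq (.set .a (.get .ea (.var .i))) <| .seq (.set .x (.get .eb (.var .i))) <|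
  .seq (.ite (.eq (.var .x) (.var .y)) .skip <|
    .ite (.eq (.adj (.var .a) (.var .y)) .one)
      (.seq
        (.ite (.eq (.add (.add (.get .lv (.var .x)) (.get .ld (.cell (.var .a) (.var .x))))
            (.pf (.var .a) (.var .x) (.var .y)))
          (.add (.get .lv (.var .y)) (.pf (.var .a) (.var .y) (.var .x))))
          (.put .cnt (.cell (.var .a) (.var .x)) (.suc (.get .cnt (.cell (.var .a) (.var .x)))))
          .skip)
        (.ite (.eq (.suc (.add (.add (.get .lv (.var .y)) (.get .ld (.cell (.var .a) (.var .y))))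
            (.pf (.var .a) (.var .y) (.var .x))))
          (.add (.get .lv (.var .x)) (.pf (.var .a) (.var .x) (.var .y))))
          (.put .cnt (.cell (.var .a) (.var .y))
            (.sub (.get .cnt (.cell (.var .a) (.var .y))) .one))
          .skip))
      .skip)
  (.set .i (.suc (.var .i)))

/-- Raise the level of the object `y`. -/
def raise : Com :=
  .seq (.set .i .zero) <| .seq (.loop (.lt (.var .i) (.var .m)) raiseBody) <|
    .put .lv (.var .y) (.suc (.get .lv (.var .y)))

/-- The level itself is stored only after the pass over the edges, so all comparisons in the pass
use the old level. -/
theorem run_raise {n m y : ℕ} {σ : State} (hn : σ.v .n = n) (hm : σ.v .m = m) (hy : σ.v .y = y)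
    (hyn : y < n) (hE : EdgeList n m (adj σ.I n) (σ.r .ea) (σ.r .eb) (σ.r .st))
    (hC : CountOk (σ.loaded n) (σ.r .lv) (σ.r .cnt)) :
    ∃ t σ', Run raise σ t σ' ∧
      σ'.r .lv = Function.update (σ.r .lv) y (σ.r .lv y + 1) ∧
      CountOk (σ.loaded n) (σ'.r .lv) (σ'.r .cnt) ∧ t ≤ 300 * (m + 2) := by
  have hr0 : Run (.set .i .zero) σ _ (σ.setv .i 0) := Run.set
  set G := σ.loaded n with hG
  have hGn : G.n = n := rfl
  have hE' : EdgeList G.n m G.adj (σ.r .ea) (σ.r .eb) (σ.r .st) := hE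
  obtain ⟨t1, σ1, hr1, hF1, hI1, hb1, ht1⟩ := run_loop_den (σ := σ.setv .i 0)
    (b := .lt (.var .i) (.var .m)) (p := raiseBody) (by simp [raiseBody]) 300 (by simp [raiseBody])
    (fun σ' => σ'.v .i ≤ m ∧ RaiseInv G (σ.r .lv) (σ.r .ea) (σ.r .eb) y (σ'.v .i) (σ'.r .cnt))
    (fun σ' => m - σ'.v .i) ⟨by simp, by simpa using hC.raiseInv y⟩ (by
      intro σ' hF hI hb
      obtain ⟨hle, hI⟩ := hI
      have hn' : σ'.v .n = n := (hF.v .n (by simp [raiseBody])).trans (by simpa using hn)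
      have hm' : σ'.v .m = m := (hF.v .m (by simp [raiseBody])).trans (by simpa using hm)
      have hy' : σ'.v .y = y := (hF.v .y (by simp [raiseBody])).trans (by simpa using hy)
      have hea : σ'.r .ea = σ.r .ea := hF.r .ea (by simp [raiseBody])
      have heb : σ'.r .eb = σ.r .eb := hF.r .eb (by simp [raiseBody])
      have hlv : σ'.r .lv = σ.r .lv := hF.r .lv (by simp [raiseBody])
      have hld : σ'.r .ld = σ.r .ld := hF.r .ld (by simp [raiseBody])
      have hIn : σ'.I = σ.I := hF.I
      simp only [Cond.Holds, Expr.eval, hm'] at hb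
      simp only [raiseBody, Com.den, Cond.Holds, Expr.eval, hn', hy', hea, heb, hlv, hld, hIn,
        State.setv_v, State.setv_r, State.setv_I, reduceCtorEq, if_true, if_false]
      set i := σ'.v .i with hi
      set a := σ.r .ea i with ha
      set x := σ.r .eb i with hx
      have hxn : x < n := hE.eb_lt i hb
      by_cases h1 : x = y
      · rw [if_pos h1]
        refine ⟨⟨by simp; omega, by simpa using hI.skip (.inl h1)⟩, by simp; omega⟩
      rw [if_neg h1]
      by_cases h2 : σ.I (0 + 1 + 1 + (a * n + y)) = 0 + 1
      · rw [if_pos h2]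
        have hady : G.adj a y := by simpa [hG, State.loaded, adj, add_comm] using h2
        have hinv := fun cnt' => hI.step hE' hb hyn h1 hady (cnt' := cnt')
        simp only [← ha, ← hx] at hinv
        have e1 : (σ.r .lv x + σ.r .ld (a * n + x) +
            σ.I (0 + 1 + 1 + n * n + ((a * n + x) * n + y)) =
            σ.r .lv y + σ.I (0 + 1 + 1 + n * n + ((a * n + y) * n + x))) ↔
            (σ.r .lv x + G.ld a x + G.pf a x y = σ.r .lv y + G.pf a y x) := by
          simp [hG, State.loaded, pf]
        have e2 : (σ.r .lv y + σ.r .ld (a * n + y) +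
            σ.I (0 + 1 + 1 + n * n + ((a * n + y) * n + x)) + 1 =
            σ.r .lv x + σ.I (0 + 1 + 1 + n * n + ((a * n + x) * n + y))) ↔
            (σ.r .lv y + G.ld a y + G.pf a y x + 1 = σ.r .lv x + G.pf a x y) := by
          simp [hG, State.loaded, pf]
        have hne {a' x' z : ℕ} (hx' : x' < n) (hz : z < n) (h : ¬ (a' = a ∧ (x' = x ∨ x' = y)))
            (hzz : z = x ∨ z = y) : a' * n + x' ≠ a * n + z := by
          rw [Ne, cell_inj hx' hz]; rintro ⟨h1, h2⟩; exact h ⟨h1, by rcases hzz with h | h <;> omega⟩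
        by_cases h3 : σ.r .lv x + σ.r .ld (a * n + x) +
            σ.I (0 + 1 + 1 + n * n + ((a * n + x) * n + y)) =
            σ.r .lv y + σ.I (0 + 1 + 1 + n * n + ((a * n + y) * n + x))
        · rw [if_pos h3]
          simp only [State.setr_v, State.setr_r, State.setr_I, State.setv_v, State.setv_r,
            State.setv_I, reduceCtorEq, if_true, if_false, hn', hy', hlv, hld, hIn]
          split_ifs with h4
          · refine ⟨⟨by simp; omega, ?_⟩, by simp; omega⟩
            simp only [State.setr_r, State.setv_r, if_true]
            refine hinv _ ?_ ?_ ?_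
            · rw [if_pos (e1.1 h3)]; simp [hGn, h1, Ne.symm h1]
            · rw [if_pos (e2.1 h4)]; simp [hGn, Ne.symm h1]
            · intro a' ha' x' hx' hne'
              simp [hGn, Function.update_apply, hne hx' hyn hne' (.inr rfl), hne hx' hxn hne' (.inl rfl)]
          · refine ⟨⟨by simp; omega, ?_⟩, by simp; omega⟩
            simp only [State.setr_r, State.setv_r, if_true]
            refine hinv _ ?_ ?_ ?_
            · rw [if_pos (e1.1 h3)]; simp [hGn]
            · rw [if_neg (fun h => h4 (e2.2 h))]; simp [hGn, Ne.symm h1]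
            · intro a' ha' x' hx' hne'
              simp [hGn, hne hx' hxn hne' (.inl rfl)]
        · rw [if_neg h3]
          simp only [State.setv_v, State.setv_r,
            State.setv_I, reduceCtorEq, if_true, if_false, hn', hy', hlv, hld, hIn]
          split_ifs with h4
          · refine ⟨⟨by simp; omega, ?_⟩, by simp; omega⟩
            simp only [State.setr_r, State.setv_r, if_true]
            refine hinv _ ?_ ?_ ?_
            · rw [if_neg (fun h => h3 (e1.2 h))]; simp [hGn, h1]
            · rw [if_pos (e2.1 h4)]; simp [hGn]
            · intro a' ha' x' hx' hne'
              simp [hGn, hne hx' hyn hne' (.inr rfl)]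
          · refine ⟨⟨by simp; omega, ?_⟩, by simp; omega⟩
            simp only [State.setv_r, State.setv_v]
            refine hinv _ ?_ ?_ ?_
            · rw [if_neg (fun h => h3 (e1.2 h))]; rfl
            · rw [if_neg (fun h => h4 (e2.2 h))]; rfl
            · intro a' ha' x' hx' hne'; rfl
      · rw [if_neg h2]
        refine ⟨⟨by simp; omega, ?_⟩, by simp; omega⟩
        simpa using hI.skip (.inr (by simpa [hG, State.loaded, adj, add_comm] using h2)))
  have hm1 : σ1.v .m = m := (hF1.v .m (by simp [raiseBody])).trans (by simpa using hm)
  have hy1 : σ1.v .y = y := (hF1.v .y (by simp [raiseBody])).trans (by simpa using hy)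
  have hlv : σ1.r .lv = σ.r .lv := hF1.r .lv (by simp [raiseBody])
  obtain ⟨hle, hI⟩ := hI1
  have hi : σ1.v .i = m := by
    simp only [Cond.Holds, Expr.eval, hm1] at hb1
    omega
  rw [hi] at hI
  refine ⟨_, _, .seq hr0 (.seq hr1 .put), ?_, ?_, ?_⟩
  · simp [hy1, hlv]
  · simpa [hy1, hlv] using hI.countOk hE'
  · simp only [State.setv_v, if_true, Nat.sub_zero] at ht1
    simp only [Expr.cost]
    omega

/-! ### The decision procedure for given loads -/

/-- Reset all levels. -/
def initLv : Com :=
  .seq (.set .c .zero) <| .loop (.lt (.var .c) (.var .n))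
    (.seq (.put .lv (.var .c) .zero) (.set .c (.suc (.var .c))))

theorem run_initLv {n : ℕ} {σ : State} (hn : σ.v .n = n) :
    ∃ t σ', Run initLv σ t σ' ∧ (∀ b < n, σ'.r .lv b = 0) ∧ t ≤ 30 * (n + 2) := by
  obtain ⟨t1, σ1, hr1, hF1, hI1, hb1, ht1⟩ := run_loop_den (σ := σ.setv .c 0)
    (b := .lt (.var .c) (.var .n))
    (p := .seq (.put .lv (.var .c) .zero) (.set .c (.suc (.var .c)))) (by simp) 30 (by simp)
    (fun σ' => ∀ b < σ'.v .c, σ'.r .lv b = 0) (fun σ' => n - σ'.v .c) (by simp) (by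
      intro σ' hF hI hb
      have hn' : σ'.v .n = n := (hF.v .n (by simp)).trans (by simpa using hn)
      simp only [Cond.Holds, Expr.eval, hn'] at hb
      simp only [Com.den, Expr.eval, State.setv_v, State.setv_r, State.setr_v, State.setr_r,
        if_true]
      refine ⟨fun b hb' => ?_, by omega⟩
      simp only [Function.update_apply]
      split_ifs with e
      · rfl
      · exact hI b (by omega))
  have hn1 : σ1.v .n = n := (hF1.v .n (by simp)).trans (by simpa using hn)
  simp only [Cond.Holds, Expr.eval, hn1] at hb1
  refine ⟨_, _, .seq .set hr1, fun b hb => hI1 b (by omega), ?_⟩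
  simp only [State.setv_v, if_true, Nat.sub_zero] at ht1
  simp only [Expr.cost]
  omega

/-- Test whether `c` makes `a` reject `x`. -/
def countBody : Com :=
  .seq (.ite (.eq (.adj (.var .a) (.var .c)) .one)
      (.ite (.lt (.add (.add (.get .lv (.var .x)) (.get .ld (.cell (.var .a) (.var .x))))
            (.pf (.var .a) (.var .x) (.var .c)))
          (.add (.get .lv (.var .c)) (.pf (.var .a) (.var .c) (.var .x))))
        (.put .cnt (.cell (.var .a) (.var .x)) (.suc (.get .cnt (.cell (.var .a) (.var .x)))))
        .skip)
      .skip)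
    (.set .c (.suc (.var .c)))

/-- Count the objects that make `a` reject `x`. -/
def countLoop : Com := .loop (.lt (.var .c) (.var .n)) countBody

theorem run_countLoop {n a x : ℕ} {σ : State} (hn : σ.v .n = n) (ha : σ.v .a = a) (hx : σ.v .x = x)
    (hc : σ.v .c = 0) (h0 : σ.r .cnt (a * n + x) = 0) :
    ∃ t σ', Run countLoop σ t σ' ∧
      σ'.r .cnt = Function.update (σ.r .cnt) (a * n + x)
        (count n fun b => (σ.loaded n).adj a b ∧ (σ.loaded n).Viol (σ.r .lv) a x b) ∧
      t ≤ 200 * (n + 1) := by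
  classical
  set G := σ.loaded n with hG
  set P := fun b => G.adj a b ∧ G.Viol (σ.r .lv) a x b with hP
  obtain ⟨t1, σ1, hr1, hF1, hI1, hb1, ht1⟩ := run_loop_den (σ := σ)
    (b := .lt (.var .c) (.var .n)) (p := countBody) (by simp [countBody]) 200
    (by simp [countBody])
    (fun σ' => σ'.v .c ≤ n ∧
      σ'.r .cnt = Function.update (σ.r .cnt) (a * n + x) (count (σ'.v .c) P))
    (fun σ' => n - σ'.v .c)
    ⟨by omega, by
      have : count 0 P = 0 := count_eq_zero.2 fun b hb => absurd hb (Nat.not_lt_zero b)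
      rw [hc, this, ← h0, Function.update_eq_self]⟩ (by
      intro σ' hF hI hb
      obtain ⟨hle, hI⟩ := hI
      have hn' : σ'.v .n = n := (hF.v .n (by simp [countBody])).trans hn
      have ha' : σ'.v .a = a := (hF.v .a (by simp [countBody])).trans ha
      have hx' : σ'.v .x = x := (hF.v .x (by simp [countBody])).trans hx
      have hlv : σ'.r .lv = σ.r .lv := hF.r .lv (by simp [countBody])
      have hld : σ'.r .ld = σ.r .ld := hF.r .ld (by simp [countBody])
      have hIn : σ'.I = σ.I := hF.I
      simp only [Cond.Holds, Expr.eval, hn'] at hb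
      simp only [countBody, Com.den, Cond.Holds, Expr.eval, hn', ha', hx', hlv, hld, hIn]
      set c := σ'.v .c with hcdef
      have e1 : σ.I (0 + 1 + 1 + (a * n + c)) = 0 + 1 ↔ G.adj a c := by
        simp [hG, State.loaded, adj]
      have e2 : (σ.r .lv x + σ.r .ld (a * n + x) +
          σ.I (0 + 1 + 1 + n * n + ((a * n + x) * n + c)) <
          σ.r .lv c + σ.I (0 + 1 + 1 + n * n + ((a * n + c) * n + x))) ↔
          G.Viol (σ.r .lv) a x c := by
        simp [hG, State.loaded, pf, Loaded.Viol]
      split_ifs with h1 h2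
      · have hPc : P c := ⟨e1.1 h1, e2.1 h2⟩
        refine ⟨⟨by simp; omega, ?_⟩, by simp; omega⟩
        simp [← hcdef, hI, count_range_succ, hPc]
      · have hPc : ¬ P c := fun h => h2 (e2.2 h.2)
        refine ⟨⟨by simp; omega, ?_⟩, by simp; omega⟩
        simp [← hcdef, hI, count_range_succ, hPc]
      · have hPc : ¬ P c := fun h => h1 (e1.2 h.1)
        refine ⟨⟨by simp; omega, ?_⟩, by simp; omega⟩
        simp [← hcdef, hI, count_range_succ, hPc])
  have hn1 : σ1.v .n = n := (hF1.v .n (by simp [countBody])).trans hn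
  simp only [Cond.Holds, Expr.eval, hn1] at hb1
  obtain ⟨hle, hI⟩ := hI1
  have : σ1.v .c = n := by omega
  rw [this] at hI
  exact ⟨t1, σ1, hr1, hI, by rw [hc] at ht1; simpa using ht1⟩

/-- Count the violations of the edge `i`. -/
def initCntBody : Com :=
  .seq (.seq (.set .a (.get .ea (.var .i))) <| .seq (.set .x (.get .eb (.var .i))) <|
    .seq (.put .cnt (.cell (.var .a) (.var .x)) .zero) (.set .c .zero)) <|
  .seq countLoop (.set .i (.suc (.var .i)))

/-- Count the violations of every edge. -/
def initCnt : Com := .seq (.set .i .zero) <| .loop (.lt (.var .i) (.var .m)) initCntBody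

theorem run_initCnt {n m : ℕ} {σ : State} (hn : σ.v .n = n) (hm : σ.v .m = m)
    (hE : EdgeList n m (adj σ.I n) (σ.r .ea) (σ.r .eb) (σ.r .st)) :
    ∃ t σ', Run initCnt σ t σ' ∧ CountOk (σ.loaded n) (σ.r .lv) (σ'.r .cnt) ∧
      t ≤ 300 * ((m + 1) * (n + 1)) := by
  set G := σ.loaded n with hG
  set P := fun a x => count n fun b => G.adj a b ∧ G.Viol (σ.r .lv) a x b with hP
  obtain ⟨t1, σ1, hr1, hF1, hI1, hb1, ht1⟩ := run_loop (σ := σ.setv .i 0)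
    (b := .lt (.var .i) (.var .m)) (p := initCntBody)
    (fun σ' => σ'.v .i ≤ m ∧ ∀ j < σ'.v .i, σ'.r .cnt (σ.r .ea j * n + σ.r .eb j) =
      P (σ.r .ea j) (σ.r .eb j))
    (fun σ' => (200 * (n + 1) + 50) * (m - σ'.v .i)) (by simp) (by
      intro σ' hF hI hb
      obtain ⟨hle, hI⟩ := hI
      have hn' : σ'.v .n = n :=
        (hF.v .n (by simp [initCntBody, countLoop, countBody])).trans (by simpa using hn)
      have hm' : σ'.v .m = m :=
        (hF.v .m (by simp [initCntBody, countLoop, countBody])).trans (by simpa using hm)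
      have hea : σ'.r .ea = σ.r .ea := hF.r .ea (by simp [initCntBody, countLoop, countBody])
      have heb : σ'.r .eb = σ.r .eb := hF.r .eb (by simp [initCntBody, countLoop, countBody])
      have hlv : σ'.r .lv = σ.r .lv := hF.r .lv (by simp [initCntBody, countLoop, countBody])
      have hld : σ'.r .ld = σ.r .ld := hF.r .ld (by simp [initCntBody, countLoop, countBody])
      have hfa : σ'.r .fa = σ.r .fa := hF.r .fa (by simp [initCntBody, countLoop, countBody])
      have hIn : σ'.I = σ.I := hF.I
      simp only [Cond.Holds, Expr.eval, hm'] at hb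
      obtain ⟨t0, hr0, ht0⟩ := Com.LoopFree.run (p := .seq (.set .a (.get .ea (.var .i))) <|
        .seq (.set .x (.get .eb (.var .i))) <|
        .seq (.put .cnt (.cell (.var .a) (.var .x)) .zero) (.set .c .zero)) (by simp) σ'
      set σ0 := Com.den _ σ' with hσ0
      set i := σ'.v .i with hi
      set a := σ.r .ea i with ha
      set x := σ.r .eb i with hx
      have ha0 : σ0.v .a = a := by simp [hσ0, hea, ← hi, ← ha]
      have hx0 : σ0.v .x = x := by simp [hσ0, heb, ← hi, ← hx]
      have hi0 : σ0.v .i = i := by simp [hσ0, ← hi]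
      have hcnt0 : σ0.r .cnt = Function.update (σ'.r .cnt) (a * n + x) 0 := by
        simp [hσ0, hea, heb, ← hi, ← ha, ← hx, hn']
      have hG0 : σ0.loaded n = G := by
        simp [hσ0, hG, State.loaded, hIn, hld, hfa]
      have hlv0 : σ0.r .lv = σ.r .lv := by simp [hσ0, hlv]
      obtain ⟨t2, σ2, hr2, hc2, ht2⟩ := run_countLoop (σ := σ0) (n := n) (by simp [hσ0, hn']) ha0
        hx0 (by simp [hσ0]) (by simp [hcnt0])
      rw [hG0, hlv0, hcnt0] at hc2
      have hi2 : σ2.v .i = i := (hr2.frame.v .i (by simp [countLoop, countBody])).trans hi0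
      refine ⟨_, _, .seq hr0 (.seq hr2 .set), ⟨by simp [hi2]; omega, ?_⟩, ?_⟩
      · intro j hj
        simp only [State.setv_v, if_true, Expr.eval, hi2] at hj
        simp only [State.setv_r, hc2, Function.update_apply]
        split_ifs with e
        · rw [cell_inj (hE.eb_lt j (by omega)) (hE.eb_lt i hb)] at e
          rw [e.1, e.2]
        · exact hI j (by
            rcases Nat.lt_succ_iff_lt_or_eq.1 hj with h | rfl
            · exact h
            · exact absurd rfl e)
      · simp only [State.setv_v, if_true, Expr.eval, hi2]
        have : m - i = (m - (i + 1)) + 1 := by omega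
        rw [this, Nat.mul_succ (200 * (n + 1) + 50)]
        simp at ht0 ⊢
        omega)
  have hm1 : σ1.v .m = m :=
    (hF1.v .m (by simp [initCntBody, countLoop, countBody])).trans (by simpa using hm)
  simp only [Cond.Holds, Expr.eval, hm1] at hb1
  obtain ⟨hle, hI⟩ := hI1
  refine ⟨_, _, .seq .set hr1, ?_, ?_⟩
  · intro a ha x hx hax
    obtain ⟨j, hj, rfl, rfl⟩ := hE.surj a ha x hx hax
    exact hI j (by omega)
  · simp at ht1 ⊢
    nlinarith

/-- Two states agree on the instance, its edge list and the loads. -/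
structure SameData (σ σ' : State) : Prop where
  n : σ'.v .n = σ.v .n
  m : σ'.v .m = σ.v .m
  D : σ'.v .D = σ.v .D
  ea : σ'.r .ea = σ.r .ea
  eb : σ'.r .eb = σ.r .eb
  st : σ'.r .st = σ.r .st
  ld : σ'.r .ld = σ.r .ld
  fa : σ'.r .fa = σ.r .fa
  I : σ'.I = σ.I

theorem SameData.trans {σ σ' σ'' : State} (h : SameData σ σ') (h' : SameData σ' σ'') :
    SameData σ σ'' :=
  ⟨h'.n.trans h.n, h'.m.trans h.m, h'.D.trans h.D, h'.ea.trans h.ea, h'.eb.trans h.eb,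
    h'.st.trans h.st, h'.ld.trans h.ld, h'.fa.trans h.fa, h'.I.trans h.I⟩

theorem SameData.loaded_eq {σ σ' : State} (h : SameData σ σ') (n : ℕ) :
    σ'.loaded n = σ.loaded n := by
  simp only [State.loaded, h.I, h.ld, h.fa]

/-- The command does not write to the instance, its edge list and the loads. -/
@[simp] def Com.KeepsData (p : Com) : Prop :=
  p.KeepsVar .n ∧ p.KeepsVar .m ∧ p.KeepsVar .D ∧ p.KeepsArr .ea ∧ p.KeepsArr .eb ∧
    p.KeepsArr .st ∧ p.KeepsArr .ld ∧ p.KeepsArr .fa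

theorem Frame.sameData {p : Com} {σ σ' : State} (h : Frame p σ σ') (hp : p.KeepsData) :
    SameData σ σ' :=
  ⟨h.v _ hp.1, h.v _ hp.2.1, h.v _ hp.2.2.1, h.r _ hp.2.2.2.1, h.r _ hp.2.2.2.2.1,
    h.r _ hp.2.2.2.2.2.1, h.r _ hp.2.2.2.2.2.2.1, h.r _ hp.2.2.2.2.2.2.2, h.I⟩

/-- The state holds an instance with loads: its size, edge list and a bound for `√n`. -/
structure State.Ready (σ : State) (n m D : ℕ) : Prop where
  n_eq : σ.v .n = n
  m_eq : σ.v .m = m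
  D_eq : σ.v .D = D
  le_sq : n ≤ D * D
  edges : EdgeList n m (adj σ.I n) (σ.r .ea) (σ.r .eb) (σ.r .st)

theorem State.Ready.of_same {σ σ' : State} {n m D : ℕ} (h : σ.Ready n m D) (hs : SameData σ σ') :
    σ'.Ready n m D :=
  ⟨hs.n.trans h.n_eq, hs.m.trans h.m_eq, hs.D.trans h.D_eq, h.le_sq, by
    rw [hs.I, hs.ea, hs.eb, hs.st]; exact h.edges⟩

theorem auction_keepsData : auction.KeepsData := by
  simp [auction, resetBody, auctionLoop, auctionBody, takeEdge]

theorem phase_keepsData : phase.KeepsData := by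
  simp [phase, phaseBody, search, searchInit, searchBody, clearBody, augment, augmentBody]

/-- Find a matching of accepted edges that is perfect (`flag = 1`) or leaves an object `y` free from
which no augmenting path starts. -/
def matchObjects : Com := .seq auction phase

theorem matchObjects_keepsData : matchObjects.KeepsData := by
  obtain ⟨a1, a2, a3, a4, a5, a6, a7, a8⟩ := auction_keepsData
  obtain ⟨b1, b2, b3, b4, b5, b6, b7, b8⟩ := phase_keepsData
  exact ⟨⟨a1, b1⟩, ⟨a2, b2⟩, ⟨a3, b3⟩, ⟨a4, b4⟩, ⟨a5, b5⟩, ⟨a6, b6⟩, ⟨a7, b7⟩, ⟨a8, b8⟩⟩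

theorem matchObjects_keeps : matchObjects.KeepsArr .lv ∧ matchObjects.KeepsArr .cnt ∧
    matchObjects.KeepsVar .res ∧ matchObjects.KeepsVar .done ∧ ∀ j, matchObjects.KeepsVar (.g j) := by
  simp [matchObjects, auction, resetBody, auctionLoop, auctionBody, takeEdge, phase, phaseBody,
    search, searchInit, searchBody, clearBody, augment, augmentBody]

/-- The counter vanishes when no object violates the edge, and the truncated difference vanishes
when the edge carries the required load. -/
theorem State.acc_iff {σ : State} {n a b : ℕ} (hC : CountOk (σ.loaded n) (σ.r .lv) (σ.r .cnt))
    (ha : a < n) (hb : b < n) : σ.Acc n a b ↔ (σ.loaded n).Acc (σ.r .lv) a b := by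
  unfold State.Acc State.Ok Loaded.Acc
  refine and_congr_right fun hab => ?_
  have h1 : σ.r .cnt (a * n + b) = _ := hC a ha b hb hab
  rw [Nat.add_eq_zero_iff, h1, count_eq_zero, Nat.sub_eq_zero_iff_le, and_comm]
  exact and_congr_right fun _ => forall₂_congr fun c _ => not_and

/-- If all objects are matched, then so are all agents, because both sides have the same size and
partners of distinct objects are distinct. -/
theorem _root_.IsMatching.solution {G : Loaded} {l ma mb : ℕ → ℕ} {E : ℕ → ℕ → Prop}
    (hE : ∀ a < G.n, ∀ b < G.n, E a b → G.Acc l a b) (h : IsMatching G.n E ma mb)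
    (hb : ∀ b < G.n, mb b ≠ 0) : G.Solution l fun a => ma a - 1 := by
  have hsurj : ∀ b < G.n, ∃ a < G.n, ma a = b + 1 := fun b hbn => by
    have h1 := hb b hbn
    have h2 := h.mb_le b hbn
    exact ⟨mb b - 1, by omega, (h.iff _ (by omega) b hbn).2 (by omega)⟩
  choose! g hg hg' using hsurj
  have hginj : ∀ b < G.n, ∀ b' < G.n, g b = g b' → b = b' := fun b hbn b' hbn' e => by
    have h1 := hg' b hbn
    have h2 := hg' b' hbn'
    rw [e] at h1; omega
  have key : ∀ a < G.n, ∃ b < G.n, ma a = b + 1 := by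
    intro a ha
    have := Finset.surj_on_of_inj_on_of_card_le (s := Finset.range G.n) (t := Finset.range G.n)
      (fun b _ => g b) (fun b hbn => Finset.mem_range.2 (hg b (Finset.mem_range.1 hbn)))
      (fun b b' hbn hbn' e => hginj b (Finset.mem_range.1 hbn) b' (Finset.mem_range.1 hbn') e) le_rfl
      a (Finset.mem_range.2 ha)
    obtain ⟨b, hbn, rfl⟩ := this
    have hbn := Finset.mem_range.1 hbn
    exact ⟨b, hbn, hg' b hbn⟩
  refine ⟨fun a ha => ?_, fun a ha a' ha' e => ?_, fun a ha => ?_⟩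
  · obtain ⟨b, hbn, e⟩ := key a ha
    simpa [e] using hbn
  · obtain ⟨b, hbn, e1⟩ := key a ha
    obtain ⟨b', hbn', e2⟩ := key a' ha'
    simp only [e1, e2, Nat.add_sub_cancel] at e
    subst e
    have h1 := (h.iff a ha b hbn).1 e1
    have h2 := (h.iff a' ha' b hbn).1 e2
    omega
  · obtain ⟨b, hbn, e1⟩ := key a ha
    simp only [e1, Nat.add_sub_cancel]
    exact hE a ha b hbn (h.edge a ha b hbn ((h.iff a ha b hbn).1 e1))

theorem run_matchObjects {n m D : ℕ} {σ : State} (hR : σ.Ready n m D)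
    (hC : CountOk (σ.loaded n) (σ.r .lv) (σ.r .cnt)) (hL : (σ.loaded n).LoadsLe) :
    ∃ t σ', Run matchObjects σ t σ' ∧
      (σ'.v .flag = 1 → ∃ M, (σ.loaded n).Solution (σ.r .lv) M) ∧
      (σ'.v .flag ≠ 1 → σ'.v .y < n ∧ ∀ l M, (σ.loaded n).Solution l M →
        (∀ b < n, σ.r .lv b ≤ l b) → σ.r .lv (σ'.v .y) < l (σ'.v .y)) ∧
      t ≤ 800 * ((m + 2 * n + 4) * (D + 2)) := by
  obtain ⟨t1, σ1, hr1, hM1, hD1, ht1⟩ := run_auction (m := m) hR.n_eq hR.D_eq hR.le_sq hR.edges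
  have hs := hr1.frame.sameData auction_keepsData
  have hR1 := hR.of_same hs
  have hcnt : σ1.r .cnt = σ.r .cnt := hr1.frame.r .cnt (by
    simp [auction, resetBody, auctionLoop, auctionBody, takeEdge])
  have hAcc : σ1.Acc n = σ.Acc n := by
    funext a b
    simp only [State.Acc, State.Ok, hcnt, hs.I, hs.fa, hs.ld]
  obtain ⟨t2, σ2, hr2, h1, h2, ht2⟩ := run_phase hR1.n_eq hR1.edges (by rw [hAcc]; exact hM1)
    (by rw [hAcc]; exact hD1)
  rw [hAcc] at h1 h2
  refine ⟨_, σ2, .seq hr1 hr2, fun hf => ?_, fun hf => ?_, ?_⟩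
  · obtain ⟨hM, hb⟩ := h1 hf
    exact ⟨_, hM.solution (G := σ.loaded n) (fun a ha b hb h => (State.acc_iff hC ha hb).1 h) hb⟩
  · obtain ⟨-, hy, R, mate, hyR, hRn, hmate, hinj⟩ := h2 hf
    refine ⟨hy, fun l M hS hle => ?_⟩
    refine hS.lt_of_stuck hL hle hyR hRn (fun a => if a < n then mate a else 0) ?_ ?_
    · intro x hx a ha hacc
      have ha : a < n := ha
      obtain ⟨k1, k2, k3⟩ := hmate x hx a ha ((State.acc_iff hC ha (hRn x hx)).2 hacc)
      rw [if_pos ha]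
      exact ⟨k1, k2, (State.acc_iff hC ha (hRn _ k1)).1 k3⟩
    · intro a ha a' ha'
      have ha : a < n := ha
      have ha' : a' < n := ha'
      simp only [if_pos ha, if_pos ha']
      exact hinj a ha a' ha'
  · have : D * (m + 2 * n) + m + 3 * n + 3 ≤ (m + 2 * n + 4) * (D + 2) := by nlinarith
    omega

/-- One round: accept, reject or raise a level. -/
def decideBody : Com :=
  .seq matchObjects <|
  .ite (.eq (.var .flag) .one) (.seq (.set .res .one) (.set .done .one)) <|
  .ite (.eq (.suc (.get .lv (.var .y))) (.var .n)) (.set .done .one) raise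

/-- Decide whether there is a solution for the given loads. -/
def decide : Com :=
  .seq initLv <| .seq initCnt <| .seq (.set .done .zero) <|
    .loop (.eq (.var .done) .zero) decideBody

theorem decideBody_keepsData : decideBody.KeepsData := by
  obtain ⟨b1, b2, b3, b4, b5, b6, b7, b8⟩ := matchObjects_keepsData
  simp only [Com.KeepsData, decideBody, Com.KeepsVar, Com.KeepsArr, *]
  simp [raise, raiseBody]

theorem decide_keepsData : decide.KeepsData := by
  obtain ⟨b1, b2, b3, b4, b5, b6, b7, b8⟩ := decideBody_keepsData
  simp only [Com.KeepsData, decide, Com.KeepsVar, Com.KeepsArr, *]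
  simp [initLv, initCnt, initCntBody, countLoop, countBody]

theorem decide_keepsVar_g (j : ℕ) : decide.KeepsVar (.g j) := by
  have := matchObjects_keeps.2.2.2.2 j
  simp only [decide, decideBody, Com.KeepsVar, this]
  simp [initLv, initCnt, initCntBody, countLoop, countBody, raise, raiseBody]

/-- The invariant of the rounds. -/
structure DecideInv (G : Loaded) (res₀ : ℕ) (lv cnt : ℕ → ℕ) (res done : ℕ) : Prop where
  count : CountOk G lv cnt
  lt : ∀ b < G.n, lv b < G.n
  le : ∀ l M, G.Solution l M → (∀ b < G.n, l b < G.n) → ∀ b < G.n, lv b ≤ l b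
  res_eq : done = 0 → res = res₀
  of_done : done ≠ 0 → done = 1 ∧ (res = 1 ∧ (∃ l M, G.Solution l M) ∨
    res = res₀ ∧ ¬ ∃ l M, G.Solution l M ∧ ∀ b < G.n, l b < G.n)

/-- The levels remain below those of all solutions with levels smaller than `n`: a level is raised
only where every such solution is strictly above it. -/
theorem run_decideBody {n m D res₀ : ℕ} {σ : State} (hR : σ.Ready n m D)
    (hL : (σ.loaded n).LoadsLe)
    (hI : DecideInv (σ.loaded n) res₀ (σ.r .lv) (σ.r .cnt) (σ.v .res) (σ.v .done))
    (hd : σ.v .done = 0) :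
    ∃ t σ', Run decideBody σ t σ' ∧
      DecideInv (σ.loaded n) res₀ (σ'.r .lv) (σ'.r .cnt) (σ'.v .res) (σ'.v .done) ∧
      (∑ b ∈ Finset.range n, (n - σ'.r .lv b) + (1 - σ'.v .done) <
        ∑ b ∈ Finset.range n, (n - σ.r .lv b) + (1 - σ.v .done)) ∧
      t ≤ 1200 * ((m + 2 * n + 4) * (D + 2)) := by
  obtain ⟨t1, σ1, hr1, hacc, hrej, ht1⟩ := run_matchObjects hR hI.count hL
  have hs := hr1.frame.sameData matchObjects_keepsData
  have hR1 := hR.of_same hs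
  have hlv : σ1.r .lv = σ.r .lv := hr1.frame.r _ matchObjects_keeps.1
  have hcnt : σ1.r .cnt = σ.r .cnt := hr1.frame.r _ matchObjects_keeps.2.1
  have hres : σ1.v .res = σ.v .res := hr1.frame.v _ matchObjects_keeps.2.2.1
  have hdone : σ1.v .done = 0 := (hr1.frame.v _ matchObjects_keeps.2.2.2.1).trans hd
  have hbig : m + 2 * n + 4 + 4 ≤ (m + 2 * n + 4) * (D + 2) := by nlinarith
  by_cases hf : σ1.v .flag = 1
  · refine ⟨_, _, .seq hr1 (.ite_true (by simpa using hf) (.seq .set .set)), ?_, ?_, ?_⟩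
    · obtain ⟨M, hM⟩ := hacc hf
      simp only [State.setv_v, State.setv_r, hlv, hcnt]
      exact ⟨hI.count, hI.lt, hI.le, by simp, by simpa using .inl ⟨_, M, hM⟩⟩
    · simp [hlv, hd]
    · simp; omega
  obtain ⟨hyn, hy⟩ := hrej hf
  set y := σ1.v .y with hydef
  -- Every solution with small levels would need a level of at least `n` at `y`, so there is none.
  by_cases he : σ.r .lv y + 1 = n
  · refine ⟨_, _, .seq hr1 (.ite_false (by simpa using hf)
      (.ite_true (by simpa [hlv, hR1.n_eq, ← hydef] using he) .set)), ?_, ?_, ?_⟩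
    · simp only [State.setv_v, State.setv_r, hlv, hcnt]
      refine ⟨hI.count, hI.lt, hI.le, by simp, fun _ => ⟨by simp, .inr ⟨?_, ?_⟩⟩⟩
      · simpa [hres] using hI.res_eq hd
      · rintro ⟨l, M, hS, hl⟩
        have h1 := hy l M hS (hI.le l M hS hl)
        have h2 : l y < n := hl y hyn
        omega
    · simp [hlv, hd]
    · simp; omega
  · obtain ⟨t2, σ2, hr2, hlv2, hC2, ht2⟩ := run_raise hR1.n_eq hR1.m_eq hydef.symm hyn hR1.edges
      (by rw [hs.loaded_eq, hlv, hcnt]; exact hI.count)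
    rw [hs.loaded_eq] at hC2
    rw [hlv] at hlv2
    have hres2 : σ2.v .res = σ1.v .res := hr2.frame.v _ (by simp [raise, raiseBody])
    have hdone2 : σ2.v .done = σ1.v .done := hr2.frame.v _ (by simp [raise, raiseBody])
    have hlty : σ.r .lv y < n := hI.lt y hyn
    refine ⟨_, _, .seq hr1 (.ite_false (by simpa using hf)
      (.ite_false (by simpa [hlv, hR1.n_eq, ← hydef] using he) hr2)), ?_, ?_, ?_⟩
    · refine ⟨hC2, fun b hb => ?_, fun l M hS hl b hb => ?_, fun _ => ?_, fun h => ?_⟩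
      · rw [hlv2, Function.update_apply]
        split_ifs with e
        · show _ < n
          omega
        · exact hI.lt b hb
      · rw [hlv2, Function.update_apply]
        split_ifs with e
        · subst e
          exact hy l M hS (hI.le l M hS hl)
        · exact hI.le l M hS hl b hb
      · rw [hres2, hres]; exact hI.res_eq hd
      · exact absurd (hdone2.trans hdone) h
    · rw [hdone2, hdone, hd, Nat.add_lt_add_iff_right, hlv2]
      refine Finset.sum_lt_sum (fun b _ => ?_) ⟨y, Finset.mem_range.2 hyn, ?_⟩
      · rw [Function.update_apply]
        split_ifs with e
        · subst e; omega
        · exact le_rfl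
      · rw [Function.update_self]; omega
    · simp only [Cond.cost, Expr.cost]
      nlinarith

/-- All levels stay below `n` and each round raises one of them or finishes, so there are at most `n
* n + 1` rounds. The hypothesis `hlev` allows the conclusion that no solution exists from the
absence of solutions with small levels. -/
theorem run_decide {n m D : ℕ} {σ : State} (hR : σ.Ready n m D) (hL : (σ.loaded n).LoadsLe)
    (hlev : (∃ l M, (σ.loaded n).Solution l M) →
      ∃ l M, (σ.loaded n).Solution l M ∧ ∀ b < n, l b < n) :
    ∃ t σ', Run decide σ t σ' ∧
      ((∃ l M, (σ.loaded n).Solution l M) → σ'.v .res = 1) ∧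
      ((¬ ∃ l M, (σ.loaded n).Solution l M) → σ'.v .res = σ.v .res) ∧
      t ≤ 3000 * ((n * n + 2) * ((m + 2 * n + 4) * (D + 2))) := by
  obtain ⟨t1, σ1, hr1, h1, ht1⟩ := run_initLv hR.n_eq
  have hs1 : SameData σ σ1 := hr1.frame.sameData (by simp [initLv])
  have hR1 := hR.of_same hs1
  obtain ⟨t2, σ2, hr2, h2, ht2⟩ := run_initCnt hR1.n_eq hR1.m_eq hR1.edges
  have hs2 : SameData σ σ2 :=
    hs1.trans (hr2.frame.sameData (by simp [initCnt, initCntBody, countLoop, countBody]))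
  have hlv2 : σ2.r .lv = σ1.r .lv :=
    hr2.frame.r _ (by simp [initCnt, initCntBody, countLoop, countBody])
  have hres2 : σ2.v .res = σ.v .res :=
    (hr2.frame.v _ (by simp [initCnt, initCntBody, countLoop, countBody])).trans
      (hr1.frame.v _ (by simp [initLv]))
  rw [hs1.loaded_eq] at h2
  set σ3 := σ2.setv .done 0 with hσ3
  have hs3 : SameData σ σ3 := by
    refine hs2.trans ⟨?_, ?_, ?_, ?_, ?_, ?_, ?_, ?_, ?_⟩ <;> simp [hσ3]
  have hR3 := hR.of_same hs3
  set G := σ.loaded n with hG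
  set K := (m + 2 * n + 4) * (D + 2) with hK
  obtain ⟨t4, σ4, hr4, hF4, hI4, hb4, ht4⟩ := run_loop (σ := σ3) (b := .eq (.var .done) .zero)
    (p := decideBody)
    (fun σ' => DecideInv G (σ.v .res) (σ'.r .lv) (σ'.r .cnt) (σ'.v .res) (σ'.v .done))
    (fun σ' => (1200 * K + 10) * (∑ b ∈ Finset.range n, (n - σ'.r .lv b) + (1 - σ'.v .done)))
    (by
      refine ⟨?_, fun b hb => ?_, fun l M _ _ b hb => ?_, fun _ => ?_, fun h => ?_⟩
      · simpa [hσ3, hlv2] using h2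
      · have : σ3.r .lv b = 0 := by simpa [hσ3, hlv2] using h1 b hb
        rw [this]; exact Nat.zero_lt_of_lt hb
      · have : σ3.r .lv b = 0 := by simpa [hσ3, hlv2] using h1 b hb
        rw [this]; exact Nat.zero_le _
      · simpa [hσ3] using hres2
      · simp [hσ3] at h)
    (by
      intro σ' hF hI hb
      have hs' : SameData σ σ' := hs3.trans (hF.sameData decideBody_keepsData)
      have hb : σ'.v .done = 0 := hb
      obtain ⟨t, σ'', hr, hI', hlt, ht⟩ := run_decideBody (res₀ := σ.v .res) (hR.of_same hs')
        (by rw [hs'.loaded_eq]; exact hL) (by rw [hs'.loaded_eq]; exact hI) hb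
      rw [hs'.loaded_eq] at hI'
      refine ⟨t, σ'', hr, hI', ?_⟩
      have := Nat.mul_le_mul_left (1200 * K + 10) (Nat.succ_le_of_lt hlt)
      rw [Nat.mul_succ] at this
      simp only [Cond.cost, Expr.cost]
      omega)
  have hb4 : σ4.v .done ≠ 0 := hb4
  have hd := (hI4.of_done hb4).2
  refine ⟨_, _, .seq hr1 (.seq hr2 (.seq .set hr4)), fun h => ?_, fun h => ?_, ?_⟩
  · rcases hd with hd | hd
    · exact hd.1
    · exact absurd (hlev h) hd.2
  · rcases hd with hd | hd
    · exact absurd hd.2 h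
    · exact hd.1
  · have hsum : ∑ b ∈ Finset.range n, (n - σ3.r .lv b) + (1 - σ3.v .done) ≤ n * n + 1 := by
      refine Nat.add_le_add ?_ (Nat.sub_le _ _)
      calc ∑ b ∈ Finset.range n, (n - σ3.r .lv b) ≤ ∑ _b ∈ Finset.range n, n :=
            Finset.sum_le_sum fun b _ => Nat.sub_le _ _
        _ = n * n := by simp
    have h5 := Nat.mul_le_mul_left (1200 * K + 10) hsum
    have h6 : (m + 1) * (n + 1) ≤ (n * n + 2) * K := by
      have a1 : n + 1 ≤ n * n + 2 := by nlinarith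
      have a2 : m + 1 ≤ K := by rw [hK]; nlinarith
      rw [mul_comm]
      exact Nat.mul_le_mul a1 a2
    have h7 : n + 8 ≤ 2 * K := by rw [hK]; nlinarith
    have h8 : 2 * K ≤ (n * n + 2) * K := Nat.mul_le_mul_right _ (by omega)
    simp only [Cond.cost, Expr.cost] at ht4 ⊢
    nlinarith

/-! ### Guessing the loads -/

/-- The instance with loads that is given by an input and arrays of loads. -/
def loadedOf (I : ℕ → ℕ) (n : ℕ) (ld fa : ℕ → ℕ) : Loaded where
  n := n
  adj := adj I n
  pf := pf I n
  ld a x := ld (a * n + x)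
  fa := fa

/-- There is a solution after distributing at most `j` further units of load to the edges. -/
def Success (I : ℕ → ℕ) (n : ℕ) : ℕ → (ℕ → ℕ) → (ℕ → ℕ) → Prop
  | 0, ld, fa => ∃ l M, (loadedOf I n ld fa).Solution l M
  | j + 1, ld, fa => Success I n j ld fa ∨ ∃ a < n, ∃ x < n, adj I n a x ∧
      Success I n j (Function.update ld (a * n + x) (ld (a * n + x) + 1))
        (Function.update fa a (fa a + 1))

/-- `fa a` is the sum of the loads at the agent `a`. -/
def FaSum (n : ℕ) (ld fa : ℕ → ℕ) : Prop := ∀ a < n, fa a = ∑ x ∈ Finset.range n, ld (a * n + x)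

/-- The loads of two different edges at an agent are two separate terms of her total. This is the
property that `Solution.lt_of_stuck` relies on. -/
theorem FaSum.loadsLe {n : ℕ} {ld fa : ℕ → ℕ} (h : FaSum n ld fa) (I : ℕ → ℕ) :
    (loadedOf I n ld fa).LoadsLe := by
  intro a ha b hb c hc hbc
  have : fa a = _ := h a ha
  show ld (a * n + b) + ld (a * n + c) ≤ fa a
  rw [this, ← Finset.sum_pair (f := fun x => ld (a * n + x)) hbc]
  refine Finset.sum_le_sum_of_subset fun x hx => ?_
  simp only [Finset.mem_insert, Finset.mem_singleton] at hx
  rcases hx with rfl | rfl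
  · exact Finset.mem_range.2 hb
  · exact Finset.mem_range.2 hc

theorem FaSum.bump {n : ℕ} {ld fa : ℕ → ℕ} (h : FaSum n ld fa) {a x : ℕ} (hx : x < n) :
    FaSum n (Function.update ld (a * n + x) (ld (a * n + x) + 1))
      (Function.update fa a (fa a + 1)) := by
  intro a' ha'
  have e : ∀ y ∈ Finset.range n,
      Function.update ld (a * n + x) (ld (a * n + x) + 1) (a' * n + y) =
        ld (a' * n + y) + if a' = a ∧ y = x then 1 else 0 := fun y hy => by
    rw [Function.update_apply]
    simp only [cell_inj (Finset.mem_range.1 hy) hx]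
    split_ifs with h
    · rw [h.1, h.2]
    · rfl
  rw [Finset.sum_congr rfl e, Finset.sum_add_distrib, ← h a' ha', Function.update_apply]
  by_cases ha : a' = a
  · subst ha; simp [hx]
  · simp [ha]

/-- Try all edges as the place of one unit of load, and solve the remaining problem by `p`. -/
def guessBody (p : Com) (j : ℕ) : Com :=
  .seq (.seq (.set .a (.get .ea (.var (.g j)))) <| .seq (.set .x (.get .eb (.var (.g j)))) <|
    .seq (.put .ld (.cell (.var .a) (.var .x)) (.suc (.get .ld (.cell (.var .a) (.var .x))))) <|
    .put .fa (.var .a) (.suc (.get .fa (.var .a)))) <|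
  .seq p <|
  .seq (.set .a (.get .ea (.var (.g j)))) <| .seq (.set .x (.get .eb (.var (.g j)))) <|
    .seq (.put .ld (.cell (.var .a) (.var .x))
      (.sub (.get .ld (.cell (.var .a) (.var .x))) .one)) <|
    .seq (.put .fa (.var .a) (.sub (.get .fa (.var .a)) .one)) <|
    .set (.g j) (.suc (.var (.g j)))

/-- Decide whether there is a solution after distributing at most `j` units of load. -/
def guess : ℕ → Com
  | 0 => decide
  | j + 1 => .seq (guess j) <| .seq (.set (.g j) .zero) <|
      .loop (.lt (.var (.g j)) (.var .m)) (guessBody (guess j) j)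

theorem guess_keepsVar {i j : ℕ} (h : j ≤ i) : (guess j).KeepsVar (.g i) := by
  induction j with
  | zero => exact decide_keepsVar_g i
  | succ j ih =>
    have : i ≠ j := by omega
    have ih := ih (by omega)
    simp [guess, guessBody, ih, this]

/-- A bound of the running time of `guess j`. -/
def guessTime (n m D j : ℕ) : ℕ :=
  (m + 1) ^ j * (3000 * ((n * n + 2) * ((m + 2 * n + 4) * (D + 2))) + 150 * j)

theorem guessTime_succ (n m D j : ℕ) :
    (m + 1) * (guessTime n m D j + 150) ≤ guessTime n m D (j + 1) := by
  unfold guessTime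
  have : 1 ≤ (m + 1) ^ j := Nat.one_le_pow _ _ (by omega)
  rw [pow_succ]
  nlinarith [Nat.mul_le_mul_left (150 * (m + 1)) this]

/-- Each trial adds one unit of load, recurses and takes the unit away again, so all trials start
from the same data. A failed trial leaves `res` unchanged and a successful one sets it to `1`; thus
`res` accumulates the disjunction over all trials. -/
theorem run_guess {n m D : ℕ} {I : ℕ → ℕ}
    (hlev : ∀ ld fa, FaSum n ld fa → (∃ l M, (loadedOf I n ld fa).Solution l M) →
      ∃ l M, (loadedOf I n ld fa).Solution l M ∧ ∀ b < n, l b < n) (j : ℕ) {σ : State}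
    (hI : σ.I = I) (hR : σ.Ready n m D) (hF : FaSum n (σ.r .ld) (σ.r .fa)) :
    ∃ t σ', Run (guess j) σ t σ' ∧ SameData σ σ' ∧
      (Success I n j (σ.r .ld) (σ.r .fa) → σ'.v .res = 1) ∧
      (¬ Success I n j (σ.r .ld) (σ.r .fa) → σ'.v .res = σ.v .res) ∧ t ≤ guessTime n m D j := by
  induction j generalizing σ with
  | zero =>
    subst hI
    obtain ⟨t, σ', hr, h1, h2, ht⟩ := run_decide hR (hF.loadsLe _) (hlev _ _ hF)
    exact ⟨t, σ', hr, hr.frame.sameData decide_keepsData, h1, h2, by simpa [guessTime] using ht⟩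
  | succ j ih =>
    obtain ⟨t1, σ1, hr1, hs1, hy1, hn1, ht1⟩ := ih hI hR hF
    set ld := σ.r .ld with hld
    set fa := σ.r .fa with hfa
    set ea := σ.r .ea with hea
    set eb := σ.r .eb with heb
    set S : ℕ → Prop := fun i => Success I n j
      (Function.update ld (ea i * n + eb i) (ld (ea i * n + eb i) + 1))
      (Function.update fa (ea i) (fa (ea i) + 1)) with hS
    have hR1 := hR.of_same hs1
    have hset : SameData σ1 (σ1.setv (.g j) 0) := by constructor <;> simp
    obtain ⟨t2, σ2, hr2, -, hI2, hb2, ht2⟩ := run_loop (σ := σ1.setv (.g j) 0)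
      (b := .lt (.var (.g j)) (.var .m)) (p := guessBody (guess j) j)
      (fun σ' => SameData σ σ' ∧ σ'.v (.g j) ≤ m ∧
        ((Success I n j ld fa ∨ ∃ i < σ'.v (.g j), S i) → σ'.v .res = 1) ∧
        (¬ (Success I n j ld fa ∨ ∃ i < σ'.v (.g j), S i) → σ'.v .res = σ.v .res))
      (fun σ' => (guessTime n m D j + 145) * (m - σ'.v (.g j)))
      ⟨hs1.trans hset, by simp, by simpa using hy1, by simpa using hn1⟩ (by
        rintro σ' - ⟨hs, hle, hy, hno⟩ hb
        have hR' := hR.of_same hs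
        simp only [Cond.Holds, Expr.eval, hR'.m_eq] at hb
        set i := σ'.v (.g j) with hi
        obtain ⟨t3, hr3, ht3⟩ := Com.LoopFree.run
          (p := .seq (.set .a (.get .ea (.var (.g j)))) <|
            .seq (.set .x (.get .eb (.var (.g j)))) <|
            .seq (.put .ld (.cell (.var .a) (.var .x))
              (.suc (.get .ld (.cell (.var .a) (.var .x))))) <|
            .put .fa (.var .a) (.suc (.get .fa (.var .a)))) (by simp) σ'
        set σ3 := Com.den _ σ' with hσ3
        have hea' : σ'.r .ea = ea := hs.ea
        have heb' : σ'.r .eb = eb := hs.eb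
        have hld3 : σ3.r .ld =
            Function.update ld (ea i * n + eb i) (ld (ea i * n + eb i) + 1) := by
          simp [hσ3, hea', heb', ← hi, hR'.n_eq, hs.ld, ← hld]
        have hfa3 : σ3.r .fa = Function.update fa (ea i) (fa (ea i) + 1) := by
          simp [hσ3, hea', ← hi, hs.fa, ← hfa]
        have hI3 : σ3.I = I := by simp [hσ3, hs.I, hI]
        have hea3 : σ3.r .ea = ea := by simp [hσ3, hea']
        have heb3 : σ3.r .eb = eb := by simp [hσ3, heb']
        have hst3 : σ3.r .st = σ.r .st := by simp [hσ3, hs.st]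
        have hR3 : σ3.Ready n m D := by
          refine ⟨by simp [hσ3, hR'.n_eq], by simp [hσ3, hR'.m_eq], by simp [hσ3, hR'.D_eq],
            hR.le_sq, ?_⟩
          rw [hI3, hea3, heb3, hst3, ← hI]
          exact hR.edges
        obtain ⟨t4, σ4, hr4, hs4, hy4, hn4, ht4⟩ := ih hI3 hR3 (by
          rw [hld3, hfa3]; exact hF.bump (hR.edges.eb_lt i hb))
        rw [hld3, hfa3] at hy4 hn4
        have hg4 : σ4.v (.g j) = i := by
          rw [hr4.frame.v _ (guess_keepsVar le_rfl)]
          simp [hσ3, ← hi]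
        have hres3 : σ3.v .res = σ'.v .res := by simp [hσ3]
        rw [hres3] at hn4
        obtain ⟨t5, hr5, ht5⟩ := Com.LoopFree.run
          (p := .seq (.set .a (.get .ea (.var (.g j)))) <|
            .seq (.set .x (.get .eb (.var (.g j)))) <|
            .seq (.put .ld (.cell (.var .a) (.var .x))
              (.sub (.get .ld (.cell (.var .a) (.var .x))) .one)) <|
            .seq (.put .fa (.var .a) (.sub (.get .fa (.var .a)) .one)) <|
            .set (.g j) (.suc (.var (.g j)))) (by simp) σ4
        set σ5 := Com.den _ σ4 with hσ5
        have hR4 := hR3.of_same hs4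
        have hea4 : σ4.r .ea = ea := hs4.ea.trans hea3
        have heb4 : σ4.r .eb = eb := hs4.eb.trans heb3
        have hg5 : σ5.v (.g j) = i + 1 := by simp [hσ5, hg4]
        have hres5 : σ5.v .res = σ4.v .res := by simp [hσ5]
        have hex : (∃ i' < i + 1, S i') ↔ (∃ i' < i, S i') ∨ S i := by
          constructor
          · rintro ⟨i', h1, h2⟩
            rcases Nat.lt_succ_iff_lt_or_eq.1 h1 with h1 | rfl
            · exact .inl ⟨i', h1, h2⟩
            · exact .inr h2
          · rintro (⟨i', h1, h2⟩ | h)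
            · exact ⟨i', by omega, h2⟩
            · exact ⟨i, by omega, h⟩
        refine ⟨_, σ5, .seq hr3 (.seq hr4 hr5), ⟨?_, by omega, ?_, ?_⟩, ?_⟩
        · refine ⟨?_, ?_, ?_, ?_, ?_, ?_, ?_, ?_, ?_⟩
          · simp [hσ5, hR4.n_eq, hR.n_eq]
          · simp [hσ5, hR4.m_eq, hR.m_eq]
          · simp [hσ5, hR4.D_eq, hR.D_eq]
          · simp [hσ5, hea4, ← hea]
          · simp [hσ5, heb4, ← heb]
          · simp [hσ5, hs4.st, hst3]
          · simp [hσ5, hea4, heb4, hg4, hR4.n_eq, hs4.ld, hld3, ← hld]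
          · simp [hσ5, hea4, hg4, hs4.fa, hfa3, ← hfa]
          · simp [hσ5, hs4.I, hI3, hI]
        · rw [hg5, hres5, hex, ← or_assoc]
          intro h
          by_cases h' : S i
          · exact hy4 h'
          · rw [hn4 h']
            exact hy (h.resolve_right h')
        · rw [hg5, hres5, hex, ← or_assoc]
          intro h
          obtain ⟨h1, h2⟩ := not_or.1 h
          rw [hn4 h2]
          exact hno h1
        · rw [hg5]
          have : m - i = (m - (i + 1)) + 1 := by omega
          rw [this, Nat.mul_succ (guessTime n m D j + 145)]
          simp at ht3 ht5 ⊢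
          omega)
    obtain ⟨hs2, hle, hy2, hn2⟩ := hI2
    simp only [Cond.Holds, Expr.eval, (hR.of_same hs2).m_eq] at hb2
    have hg : σ2.v (.g j) = m := by omega
    rw [hg] at hy2 hn2
    -- The edge list enumerates exactly the adjacent pairs, so running through positions tries every
    -- edge.
    have hiff : Success I n (j + 1) ld fa ↔ Success I n j ld fa ∨ ∃ i < m, S i := by
      refine or_congr_right ⟨?_, ?_⟩
      · rintro ⟨a, ha, x, hx, hax, h⟩
        obtain ⟨i, hi, e1, e2⟩ := hR.edges.surj a ha x hx (by rw [hI]; exact hax)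
        refine ⟨i, hi, ?_⟩
        have e1 : ea i = a := e1
        have e2 : eb i = x := e2
        simp only [hS, e1, e2]
        exact h
      · rintro ⟨i, hi, h⟩
        refine ⟨ea i, hR.edges.ea_lt i hi, eb i, hR.edges.eb_lt i hi, ?_, h⟩
        rw [← hI]
        exact hR.edges.isAdj i hi
    refine ⟨_, σ2, .seq hr1 (.seq .set hr2), hs2, fun h => hy2 (hiff.1 h),
      fun h => hn2 fun h' => h (hiff.2 h'), ?_⟩
    refine le_trans ?_ (guessTime_succ n m D j)
    simp at ht2 ⊢
    nlinarith

/-! ### The answer of the guesses is the margin -/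

/-- The levels `l` and the loads `s` certify that the matching `M` has unpopularity margin at most
`∑ a, s a`, for an instance that is given by its encoding. -/
structure Cert (I : ℕ → ℕ) (n : ℕ) (l M s : ℕ → ℕ) : Prop where
  lt : ∀ a < n, M a < n
  inj : ∀ a < n, ∀ a' < n, M a = M a' → a = a'
  isAdj : ∀ a < n, adj I n a (M a)
  le : ∀ a < n, ∀ b < n, adj I n a b → l b + pf I n a b (M a) ≤ l (M a) + s a + pf I n a (M a) b

/-! ### Guessed loads and certificates -/

theorem solution_iff {I : ℕ → ℕ} {n : ℕ} {ld fa l M : ℕ → ℕ} :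
    (loadedOf I n ld fa).Solution l M ↔
      Cert I n l M (fun a => ld (a * n + M a)) ∧ ∀ a < n, fa a ≤ ld (a * n + M a) := by
  constructor
  · intro h
    exact ⟨⟨h.lt, h.inj, fun a ha => (h.acc a ha).1,
      fun a ha b hb hab => not_lt.1 ((h.acc a ha).2.2 b hb hab)⟩, fun a ha => (h.acc a ha).2.1⟩
  · rintro ⟨h, hfa⟩
    exact ⟨h.lt, h.inj, fun a ha => ⟨h.isAdj a ha, hfa a ha,
      fun b hb hab => not_lt.2 (h.le a ha b hb hab)⟩⟩

theorem sum_bump {n a : ℕ} (ha : a < n) (fa : ℕ → ℕ) :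
    ∑ b ∈ Finset.range n, Function.update fa a (fa a + 1) b = ∑ b ∈ Finset.range n, fa b + 1 := by
  have : ∀ b ∈ Finset.range n, Function.update fa a (fa a + 1) b = fa b + if b = a then 1 else 0 := by
    intro b _
    rw [Function.update_apply]
    split_ifs with e
    · rw [e]
    · rfl
  rw [Finset.sum_congr rfl this, Finset.sum_add_distrib]
  simp [ha]

/-- The certificate uses the loads of the matched edges only. Each is a single term of the total at
its agent, so the sum is at most the number of units placed. -/
theorem Success.exists_cert {I : ℕ → ℕ} {n j : ℕ} {ld fa : ℕ → ℕ} (hF : FaSum n ld fa)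
    (h : Success I n j ld fa) : ∃ l M s, Cert I n l M s ∧
      ∑ a ∈ Finset.range n, s a ≤ ∑ a ∈ Finset.range n, fa a + j := by
  induction j generalizing ld fa with
  | zero =>
    obtain ⟨l, M, h⟩ := h
    obtain ⟨hc, -⟩ := solution_iff.1 h
    refine ⟨l, M, _, hc, Finset.sum_le_sum fun a ha => ?_⟩
    have ha := Finset.mem_range.1 ha
    rw [hF a ha]
    exact Finset.single_le_sum (f := fun x => ld (a * n + x)) (fun _ _ => Nat.zero_le _)
      (Finset.mem_range.2 (hc.lt a ha))
  | succ j ih =>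
    rcases h with h | ⟨a, ha, x, hx, -, h⟩
    · obtain ⟨l, M, s, hc, hs⟩ := ih hF h
      exact ⟨l, M, s, hc, by omega⟩
    · obtain ⟨l, M, s, hc, hs⟩ := ih (hF.bump hx) h
      rw [sum_bump ha] at hs
      exact ⟨l, M, s, hc, by omega⟩

/-- The successful guess puts all units on the edges of `M`: as long as some agent has less load
than the certificate gives her, the next unit goes to her matched edge. Once the totals agree, the
loads agree at every agent. -/
theorem Cert.success {I : ℕ → ℕ} {n j : ℕ} {l M s ld fa : ℕ → ℕ} (h : Cert I n l M s)
    (hfa : ∀ a < n, fa a ≤ s a) (hld : ∀ a < n, ld (a * n + M a) = fa a)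
    (hs : ∑ a ∈ Finset.range n, s a ≤ ∑ a ∈ Finset.range n, fa a + j) : Success I n j ld fa := by
  induction j generalizing ld fa with
  | zero =>
    have heq := (Finset.sum_eq_sum_iff_of_le fun a ha => hfa a (Finset.mem_range.1 ha)).1
      (le_antisymm (Finset.sum_le_sum fun a ha => hfa a (Finset.mem_range.1 ha)) hs)
    refine ⟨l, M, solution_iff.2 ⟨⟨h.lt, h.inj, h.isAdj, fun a ha b hb hab => ?_⟩,
      fun a ha => (hld a ha).ge⟩⟩
    simp only [hld a ha, heq a (Finset.mem_range.2 ha)]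
    exact h.le a ha b hb hab
  | succ j ih =>
    by_cases hc : ∑ a ∈ Finset.range n, s a ≤ ∑ a ∈ Finset.range n, fa a + j
    · exact .inl (ih hfa hld hc)
    obtain ⟨a, ha, hlt⟩ : ∃ a ∈ Finset.range n, fa a < s a :=
      Finset.exists_lt_of_sum_lt (by omega)
    have ha := Finset.mem_range.1 ha
    refine .inr ⟨a, ha, M a, h.lt a ha, h.isAdj a ha, ih ?_ ?_ ?_⟩
    · intro a' ha'
      rw [Function.update_apply]
      split_ifs with e
      · rw [e]; exact hlt
      · exact hfa a' ha'
    · intro a' ha'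
      rw [Function.update_apply, Function.update_apply]
      by_cases e : a' = a
      · subst e; simp [hld a' ha']
      · rw [if_neg e, if_neg (by
          rw [cell_inj (h.lt a' ha') (h.lt a ha)]
          exact fun h => e h.1), hld a' ha']
    · rw [sum_bump ha]
      omega

section Encode

variable {n : ℕ} (G : PrefInstance n)

/-! ### The memory encoding and the instance -/

theorem pair_lt {n : ℕ} (a b : Fin n) : (a : ℕ) * n + b < n * n := by
  have := Nat.mul_le_mul_right n (Nat.succ_le_of_lt a.2)
  rw [Nat.succ_mul] at this
  have := b.2
  omega

theorem triple_lt {n : ℕ} (a b c : Fin n) : ((a : ℕ) * n + b) * n + c < n * n * n := by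
  have := Nat.mul_le_mul_right n (Nat.succ_le_of_lt (pair_lt a b))
  rw [Nat.succ_mul] at this
  have := c.2
  omega

/-- The adjacency matrix ends before the table of comparison bits begins, so a cell of the matrix
cannot be set by a comparison. -/
theorem adj_encode (a b : Fin n) : adj G.encode n a b ↔ (a, b) ∈ G.edges := by
  classical
  unfold adj PrefInstance.encode
  rw [if_neg (by omega), if_neg (by omega)]
  constructor
  · intro h
    split_ifs at h with hc
    rcases hc with ⟨a', b', hE, e⟩ | ⟨a', b', c', -, e⟩
    · obtain ⟨e1, e2⟩ := (cell_inj b.2 b'.2).1 (Nat.add_left_cancel e)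
      rwa [Fin.ext e1, Fin.ext e2]
    · have := pair_lt a b
      omega
  · intro h
    rw [if_pos (.inl ⟨a, b, h, rfl⟩)]

theorem pf_encode (a b c : Fin n) : pf G.encode n a b c = G.bit a b c := by
  classical
  unfold pf PrefInstance.encode PrefInstance.bit
  rw [if_neg (by omega), if_neg (by omega)]
  refine if_congr ⟨?_, fun h => .inr ⟨a, b, c, h, rfl⟩⟩ rfl rfl
  rintro (⟨a', b', -, e⟩ | ⟨a', b', c', hp, e⟩)
  · have := pair_lt a' b'
    omega
  · obtain ⟨e1, e2⟩ := (cell_inj c.2 c'.2).1 (Nat.add_left_cancel e)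
    obtain ⟨e3, e4⟩ := (cell_inj b.2 b'.2).1 e1
    rwa [Fin.ext e2, Fin.ext e3, Fin.ext e4]

theorem card_edges_le : G.edges.card ≤ n * n := by
  simpa using Finset.card_le_univ G.edges

theorem encode_le (i : ℕ) : G.encode i ≤ (n + 2) ^ 2 := by
  classical
  have := card_edges_le G
  unfold PrefInstance.encode
  split_ifs <;> nlinarith

theorem encode_eq_zero {i : ℕ} (hi : (n + 2) ^ 3 ≤ i) : G.encode i = 0 := by
  classical
  have h : n * n * n + n * n + 2 ≤ i := by nlinarith
  unfold PrefInstance.encode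
  rw [if_neg (by omega), if_neg (by nlinarith), if_neg]
  rintro (⟨a, b, -, e⟩ | ⟨a, b, c, -, e⟩)
  · have := pair_lt a b
    omega
  · have := triple_lt a b c
    omega

variable {G}

theorem cert_iff {M' : Fin n ≃ Fin n} {l M s : ℕ → ℕ} (hM : ∀ a : Fin n, M a = M' a) :
    Cert G.encode n l M s ↔ G.Certifies M' (fun b => l b) (fun a => s a) := by
  constructor
  · intro h
    refine ⟨fun a => ?_, fun a b hab => ?_⟩
    · rw [← adj_encode, ← hM]
      exact h.isAdj a a.2
    · have := h.le a a.2 b b.2 ((adj_encode G a b).2 hab)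
      rwa [hM, pf_encode, pf_encode] at this
  · intro h
    refine ⟨fun a ha => ?_, fun a ha a' ha' e => ?_, fun a ha => ?_, fun a ha b hb hab => ?_⟩
    · rw [hM ⟨a, ha⟩]; exact (M' _).2
    · have e' : M' ⟨a, ha⟩ = M' ⟨a', ha'⟩ := Fin.ext (by rw [← hM, ← hM]; exact e)
      exact Fin.ext_iff.1 (M'.injective e')
    · have := (adj_encode G ⟨a, ha⟩ (M' ⟨a, ha⟩)).2 (h.isAssignment _)
      rwa [← hM] at this
    · have := h.le ⟨a, ha⟩ ⟨b, hb⟩ ((adj_encode G _ _).1 hab)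
      rwa [← pf_encode, ← pf_encode, ← hM] at this

theorem Cert.exists_equiv {l M s : ℕ → ℕ} (h : Cert G.encode n l M s) :
    ∃ M' : Fin n ≃ Fin n, ∀ a : Fin n, M a = M' a := by
  have hinj : Function.Injective fun a : Fin n => (⟨M a, h.lt a a.2⟩ : Fin n) := fun a a' e =>
    Fin.ext (h.inj a a.2 a' a'.2 (Fin.ext_iff.1 e))
  exact ⟨.ofBijective _ (Finite.injective_iff_bijective.1 hinj), fun a => rfl⟩

theorem exists_extension (f : Fin n → ℕ) : ∃ g : ℕ → ℕ, f = fun a : Fin n => g a :=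
  ⟨fun a => if h : a < n then f ⟨a, h⟩ else 0, by ext a; simp⟩

theorem Cert.exists_lt {l M s : ℕ → ℕ} (h : Cert G.encode n l M s) :
    ∃ l', Cert G.encode n l' M s ∧ ∀ b < n, l' b < n := by
  obtain ⟨M', hM⟩ := h.exists_equiv
  obtain ⟨l', hl', hlt⟩ := ((cert_iff hM).1 h).exists_lt
  obtain ⟨g, rfl⟩ := exists_extension l'
  exact ⟨g, (cert_iff hM).2 hl', fun b hb => hlt ⟨b, hb⟩⟩

/-- Compressing the levels keeps the matching and its loads, so the solution persists for the same
guess. -/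
theorem exists_solution_lt {ld fa : ℕ → ℕ} (h : ∃ l M, (loadedOf G.encode n ld fa).Solution l M) :
    ∃ l M, (loadedOf G.encode n ld fa).Solution l M ∧ ∀ b < n, l b < n := by
  obtain ⟨l, M, h⟩ := h
  obtain ⟨hc, hfa⟩ := solution_iff.1 h
  obtain ⟨l', hl', hlt⟩ := hc.exists_lt
  exact ⟨l', M, solution_iff.2 ⟨hl', hfa⟩, hlt⟩

theorem success_iff {k : ℕ} :
    Success G.encode n k (fun _ => 0) (fun _ => 0) ↔ G.HasMarginAtMost k := by
  constructor
  · intro h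
    obtain ⟨l, M, s, hc, hs⟩ := h.exists_cert (by simp [FaSum])
    obtain ⟨M', hM⟩ := hc.exists_equiv
    have hc' := (cert_iff hM).1 hc
    refine ⟨M', hc'.isAssignment, hc'.unpopularityMargin_le ?_⟩
    rw [Fin.sum_univ_eq_sum_range]
    simpa using hs
  · rintro ⟨M', hM', hk⟩
    obtain ⟨l, s, hc, hs⟩ := PrefInstance.exists_certifies hM' hk
    obtain ⟨l, rfl⟩ := exists_extension l
    obtain ⟨s, rfl⟩ := exists_extension s
    obtain ⟨M, hM⟩ := exists_extension fun a => (M' a : ℕ)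
    rw [Fin.sum_univ_eq_sum_range] at hs
    exact ((cert_iff fun a => (congrFun hM a).symm).2 hc).success (fun _ _ => Nat.zero_le _)
      (fun _ _ => rfl) (by simpa using hs)

/-- The list has no repetitions, as agents strictly increase among positions with the same object.
So its length is bounded by the number of edges that the time bound refers to. -/
theorem EdgeList.le_card {m : ℕ} {ea eb st : ℕ → ℕ}
    (h : EdgeList n m (adj G.encode n) ea eb st) : m ≤ G.edges.card := by
  classical
  have : (Finset.univ : Finset (Fin m)).card ≤ G.edges.card :=
    Finset.card_le_card_of_injOn
      (fun i : Fin m => ((⟨ea i, h.ea_lt i i.2⟩ : Fin n), (⟨eb i, h.eb_lt i i.2⟩ : Fin n)))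
      (fun i _ => (adj_encode G _ _).1 (h.isAdj i i.2))
      (fun i _ i' _ e => by
        simp only [Prod.mk.injEq, Fin.mk.injEq] at e
        rcases lt_trichotomy (i : ℕ) i' with hlt | heq | hlt
        · have := h.inj i i' hlt i'.2 e.2; omega
        · exact Fin.ext heq
        · have := h.inj i' i hlt i.2 e.2.symm; omega)
  simpa using this

theorem card_le_of_hasMarginAtMost {k : ℕ} (h : G.HasMarginAtMost k) : n ≤ G.edges.card := by
  obtain ⟨M, hM, -⟩ := h
  simpa using Finset.card_le_card_of_injOn (s := Finset.univ) (fun a => (a, M a)) (fun a _ => hM a)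
    (fun a _ a' _ e => (Prod.ext_iff.1 e).1)

end Encode

/-! ### The algorithm -/

/-- Decide whether there is an assignment with unpopularity margin at most `k`. -/
def main (k : ℕ) : Com :=
  .seq (.set .n (.inp .zero)) <| .seq (.set .m (.inp .one)) <|
  .ite (.lt (.var .m) (.var .n)) .skip <| .seq sqrtLoop <| .seq buildEdges (guess k)

theorem guess_tame (k : ℕ) : (guess k).Tame := by
  induction k with
  | zero =>
    simp [guess, decide, initLv, initCnt, initCntBody, countLoop, countBody, decideBody,
      matchObjects, auction, resetBody, auctionLoop, auctionBody, takeEdge, phase, phaseBody,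
      search, searchInit, searchBody, clearBody, augment, augmentBody, raise, raiseBody]
  | succ k ih => simp [guess, guessBody, ih]

theorem main_tame (k : ℕ) : (main k).Tame := by
  simp [main, guess_tame, sqrtLoop, buildEdges, buildBody]

/-- The main factor of the running time. -/
def mainTime (n e D k : ℕ) : ℕ := (e + 1) ^ k * ((n * n + 2) * ((e + 2 * n + 4) * (D + 2)))

/-- An instance with fewer than `n` edges is rejected in constant time. In the other case `n ≤
G.edges.card`, which later allows terms in `n` to be absorbed into the number of edges. -/
theorem run_main (k : ℕ) {n : ℕ} (G : PrefInstance n) :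
    ∃ t σ D, Run (main k) (State.init G.encode) t σ ∧
      (G.HasMarginAtMost k → σ.v .res = 1) ∧ (¬ G.HasMarginAtMost k → σ.v .res = 0) ∧
      (D = 0 ∨ (D - 1) * (D - 1) < n) ∧
      (t ≤ 30 ∨ n ≤ G.edges.card ∧ t ≤ (5000 + 150 * k) * mainTime n G.edges.card D k) := by
  set I := G.encode with hI
  have hI0 : I 0 = n := by simp [hI, PrefInstance.encode]
  have hI1 : I 1 = G.edges.card := by simp [hI, PrefInstance.encode]
  set σ0 := ((State.init I).setv .n n).setv .m G.edges.card with hσ0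
  have hr0 : Run (.set .n (.inp .zero)) (State.init I) (Expr.cost (.inp .zero) + 1) ((State.init I).setv .n n) := by
    have : Expr.eval (.inp .zero) (State.init I) = n := hI0
    rw [← this]
    exact .set
  have hr0' : Run (.set .m (.inp .one)) ((State.init I).setv .n n)
      (Expr.cost (.inp .one) + 1) σ0 := by
    have : Expr.eval (.inp .one) ((State.init I).setv .n n) = G.edges.card := hI1
    rw [hσ0, ← this]
    exact .set
  have hn0 : σ0.v .n = n := by simp [hσ0]
  have hm0 : σ0.v .m = G.edges.card := by simp [hσ0]
  have hres0 : σ0.v .res = 0 := by simp [hσ0, State.init]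
  have hD0 : σ0.v .D = 0 := by simp [hσ0, State.init]
  by_cases hlt : G.edges.card < n
  · refine ⟨_, _, 0, .seq hr0 (.seq hr0' (.ite_true (by simpa [hn0, hm0] using hlt) .skip)),
      fun h => ?_, fun _ => hres0, .inl rfl, .inl (by simp)⟩
    have := card_le_of_hasMarginAtMost h
    omega
  obtain ⟨t1, σ1, hr1, hF1, hD1, hD1', ht1⟩ := run_sqrtLoop σ0 hD0
  have hn1 : σ1.v .n = n := (hF1.v .n (by simp [sqrtLoop])).trans hn0
  have hI1' : σ1.I = I := hF1.I
  obtain ⟨t2, σ2, hr2, hF2, hE, ht2⟩ := run_buildEdges σ1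
  have hn2 : σ2.v .n = n := (hF2.v .n (by simp [buildEdges, buildBody])).trans hn1
  have hD2 : σ2.v .D = σ1.v .D := hF2.v .D (by simp [buildEdges, buildBody])
  have hI2 : σ2.I = I := hF2.I.trans hI1'
  have hld : σ2.r .ld = fun _ => 0 :=
    (hF2.r .ld (by simp [buildEdges, buildBody])).trans (hF1.r .ld (by simp [sqrtLoop]))
  have hfa : σ2.r .fa = fun _ => 0 :=
    (hF2.r .fa (by simp [buildEdges, buildBody])).trans (hF1.r .fa (by simp [sqrtLoop]))
  have hres2 : σ2.v .res = 0 := (hF2.v .res (by simp [buildEdges, buildBody])).trans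
    ((hF1.v .res (by simp [sqrtLoop])).trans hres0)
  rw [hn1, hI1'] at hE
  rw [hn0] at hD1 hD1' ht1
  rw [hn1] at ht2
  have hR : σ2.Ready n (σ2.v .m) (σ1.v .D) := ⟨hn2, rfl, hD2, hD1, by rw [hI2]; exact hE⟩
  obtain ⟨t3, σ3, hr3, -, hy, hno, ht3⟩ := run_guess (fun ld fa _ => exists_solution_lt) k hI2 hR
    (by rw [hld, hfa]; simp [FaSum])
  rw [hld, hfa, success_iff] at hy hno
  rw [hres2] at hno
  refine ⟨_, σ3, σ1.v .D, .seq hr0 (.seq hr0' (.ite_false (by simpa [hn0, hm0] using hlt)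
    (.seq hr1 (.seq hr2 hr3)))), hy, hno, hD1', .inr ⟨by omega, ?_⟩⟩
  have hm : σ2.v .m ≤ G.edges.card := EdgeList.le_card hE
  set e := G.edges.card
  set D := σ1.v .D
  set X := (n * n + 2) * ((e + 2 * n + 4) * (D + 2)) with hX
  have hp : (σ2.v .m + 1) ^ k ≤ (e + 1) ^ k := Nat.pow_le_pow_left (by omega) k
  have hq : (n * n + 2) * ((σ2.v .m + 2 * n + 4) * (D + 2)) ≤ X :=
    Nat.mul_le_mul_left _ (Nat.mul_le_mul_right _ (by omega))
  have hone : 1 ≤ (e + 1) ^ k := Nat.one_le_pow _ _ (by omega)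
  have hX1 : n * n + 2 ≤ X := Nat.le_mul_of_pos_right _ (Nat.mul_pos (by omega) (by omega))
  have hY : X ≤ (e + 1) ^ k * X := Nat.le_mul_of_pos_left _ hone
  have h1 : guessTime n (σ2.v .m) D k ≤ (3000 + 150 * k) * ((e + 1) ^ k * X) := by
    unfold guessTime
    calc _ ≤ (e + 1) ^ k * (3000 * X + 150 * k * X) :=
          Nat.mul_le_mul hp (Nat.add_le_add (Nat.mul_le_mul_left _ hq)
            (Nat.le_mul_of_pos_right _ (by omega)))
      _ = _ := by ring
  have h2 : (5000 + 150 * k) * mainTime n e D k =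
      (3000 + 150 * k) * ((e + 1) ^ k * X) + 2000 * ((e + 1) ^ k * X) := by
    simp only [mainTime, ← hX]; ring
  rw [h2]
  simp only [Cond.cost, Expr.cost]
  nlinarith

/-! ### Bounds for the running time -/

/-- This crude polynomial bound serves only to fix the word length and the base address. -/
theorem mainTime_le_pow {n e D k : ℕ} (he : e ≤ n * n) (hD : D = 0 ∨ (D - 1) * (D - 1) < n) :
    mainTime n e D k ≤ (n + 2) ^ (2 * k + 6) := by
  have hD' : D ≤ n + 1 := by
    rcases hD with rfl | hD
    · omega
    · have := Nat.le_mul_self (D - 1)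
      omega
  have h1 : e + 1 ≤ (n + 2) ^ 2 := by nlinarith
  have h2 : n * n + 2 ≤ (n + 2) ^ 2 := by nlinarith
  have h3 : e + 2 * n + 4 ≤ (n + 2) ^ 2 := by nlinarith
  have h4 : D + 2 ≤ (n + 2) ^ 2 := by nlinarith
  calc mainTime n e D k
      ≤ ((n + 2) ^ 2) ^ k * ((n + 2) ^ 2 * ((n + 2) ^ 2 * (n + 2) ^ 2)) :=
        Nat.mul_le_mul (Nat.pow_le_pow_left h1 k) (Nat.mul_le_mul h2 (Nat.mul_le_mul h3 h4))
    _ = (n + 2) ^ (2 * k + 6) := by generalize n + 2 = x; ring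

/-- For `1 ≤ n ≤ e` the factors are at most `2 ^ k * e ^ k`, `3 * n ^ 2`, `7 * e` and `4 * √n`, and
`84 = 3 * 7 * 4`. The summand `1` on the right covers `n = 0`. -/
theorem mainTime_le {n e D k : ℕ} (he : n ≤ e) (he' : e ≤ n * n)
    (hD : D = 0 ∨ (D - 1) * (D - 1) < n) :
    (mainTime n e D k : ℝ) ≤ 84 * 2 ^ k * ((e : ℝ) ^ (k + 1) * (n : ℝ) ^ ((5 : ℝ) / 2) + 1) := by
  have hk : (1 : ℝ) ≤ 2 ^ k := one_le_pow₀ (by norm_num)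
  rcases Nat.eq_zero_or_pos n with rfl | hn
  · have hD0 : D = 0 := by omega
    have he0 : e = 0 := by omega
    subst hD0 he0
    simp [mainTime]
    linarith
  have hn1 : (1 : ℝ) ≤ n := by exact_mod_cast hn
  have he1 : (n : ℝ) ≤ e := by exact_mod_cast he
  have hs1 : (1 : ℝ) ≤ √n := Real.one_le_sqrt.2 hn1
  -- From `D - 1 ≤ √n` and `1 ≤ √n`, the left side is at most `√n + 3 ≤ 4 * √n`.
  have hDs : (D : ℝ) + 2 ≤ 4 * √n := by
    rcases hD with rfl | hD
    · norm_num; linarith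
    · rcases Nat.eq_zero_or_pos D with rfl | hDpos
      · norm_num; linarith
      have h1 : ((D : ℝ) - 1) * (D - 1) ≤ n := by
        have : (((D - 1) * (D - 1) : ℕ) : ℝ) ≤ n := by exact_mod_cast hD.le
        rwa [Nat.cast_mul, Nat.cast_sub hDpos, Nat.cast_one] at this
      have h2 : (D : ℝ) - 1 ≤ √n := Real.le_sqrt_of_sq_le (by rw [sq]; exact h1)
      linarith
  have hpow : (n : ℝ) ^ ((5 : ℝ) / 2) = (n : ℝ) ^ 2 * √n := by
    rw [Real.sqrt_eq_rpow, ← Real.rpow_natCast, ← Real.rpow_add (by linarith)]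
    norm_num
  have a1 : ((e : ℝ) + 1) ^ k ≤ 2 ^ k * (e : ℝ) ^ k := by
    rw [← mul_pow]
    exact pow_le_pow_left₀ (by linarith) (by linarith) k
  have a2 : (n : ℝ) * n + 2 ≤ 3 * (n : ℝ) ^ 2 := by nlinarith
  have a3 : (e : ℝ) + 2 * n + 4 ≤ 7 * e := by linarith
  calc (mainTime n e D k : ℝ)
      = ((e : ℝ) + 1) ^ k * (((n : ℝ) * n + 2) * (((e : ℝ) + 2 * n + 4) * ((D : ℝ) + 2))) := by
        simp [mainTime]
    _ ≤ (2 ^ k * (e : ℝ) ^ k) * ((3 * (n : ℝ) ^ 2) * ((7 * e) * (4 * √n))) := by gcongr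
    _ = 84 * 2 ^ k * ((e : ℝ) ^ (k + 1) * (n : ℝ) ^ ((5 : ℝ) / 2)) := by rw [hpow]; ring
    _ ≤ _ := by gcongr; linarith

end Imp

theorem theorem2 (k : ℕ) :
    ∃ (P : WordRAM.Prog) (c C : ℕ), ∀ (n : ℕ) (G : PrefInstance n),
      ∃ (t : ℕ) (s : WordRAM.State),
        WordRAM.Exec (2 ^ (c * Nat.size (n + 1))) P (WordRAM.initial G.encode) t s ∧
        (G.HasMarginAtMost k → s.reg 0 = 1) ∧
        (¬ G.HasMarginAtMost k → s.reg 0 = 0) ∧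
        (t : ℝ) ≤ (C : ℝ) *
          ((G.edges.card : ℝ) ^ (k + 1) * (n : ℝ) ^ ((5 : ℝ) / 2) + 1) := by
  set A := 5000 + 150 * k with hA
  have hA30 : 30 ≤ A := by omega
  clear_value A
  obtain ⟨P, c, C, hP⟩ := Imp.exists_prog (Imp.main k) (Imp.main_tame k) (A + (2 * k + 6))
  refine ⟨P, c, A * (84 * 2 ^ k) + 30 + C, fun n G => ?_⟩
  obtain ⟨t, σ, D, hr, hy, hno, hD, ht⟩ := Imp.run_main k G
  rw [← hA] at ht
  have hcard := Imp.card_edges_le G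
  -- The constant factor `A` is turned into a power of `n + 2`, so that the running time has the
  -- purely polynomial form that fixes the word length.
  have hApow : A ≤ (n + 2) ^ A :=
    Nat.lt_two_pow_self.le.trans (Nat.pow_le_pow_left (by omega) A)
  have hpoly : t ≤ (n + 2) ^ (A + (2 * k + 6)) := by
    rw [pow_add]
    rcases ht with ht | ⟨-, ht⟩
    · exact (show t ≤ A by omega).trans
        (hApow.trans (Nat.le_mul_of_pos_right _ (Nat.pow_pos (by omega))))
    · exact ht.trans (Nat.mul_le_mul hApow (Imp.mainTime_le_pow hcard hD))
  obtain ⟨s, hx, hs⟩ := hP n G.encode t σ (by simp [PrefInstance.encode]) (Imp.encode_le G)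
    (fun i hi => Imp.encode_eq_zero G hi) hr hpoly
  refine ⟨t + C, s, hx, fun h => hs.trans (hy h), fun h => hs.trans (hno h), ?_⟩
  set Z := (G.edges.card : ℝ) ^ (k + 1) * (n : ℝ) ^ ((5 : ℝ) / 2) + 1 with hZ
  have hZ1 : 1 ≤ Z := by
    have : 0 ≤ (G.edges.card : ℝ) ^ (k + 1) * (n : ℝ) ^ ((5 : ℝ) / 2) := by positivity
    linarith
  have hCZ : (C : ℝ) ≤ C * Z := le_mul_of_one_le_right (by positivity) hZ1
  have hAZ : 0 ≤ (A : ℝ) * (84 * 2 ^ k) * Z := by positivity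
  -- The second term covers instances that are rejected for having too few edges.
  have key : (t : ℝ) ≤ A * (84 * 2 ^ k) * Z + 30 * Z := by
    rcases ht with ht | ⟨hle, ht⟩
    · have : (t : ℝ) ≤ 30 := by exact_mod_cast ht
      linarith
    · have h1 : (t : ℝ) ≤ A * Imp.mainTime n G.edges.card D k := by exact_mod_cast ht
      have h2 := mul_le_mul_of_nonneg_left (Imp.mainTime_le (k := k) hle hcard hD)
        (show (0 : ℝ) ≤ A by positivity)
      linarith
  push_cast
  linarith
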